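/- Conventions. A finite graph $\Gamma$ may have loops and multiple edges; $|\Gamma|$ is its realization. A point $p$ of a space $X$ is a cutpoint if $X\setminus\{p\}$ is disconnected. A finite graph is \emph{2-connected} if $|\Gamma|$ is nonempty, connected, not a single point, and has no cutpoint. For a finite graph $\Gamma$, nonempty and without isolated vertices, a \emph{normal neighbourhood} of $x\in|\Gamma|$ is a connected closed neighbourhood of $x$ that contains no vertex other than possibly $x$ and contains no whole edge. Let $\mathcal N$ be a family of pairwise disjoint normal neighbourhoods which contains a normal neighbourhood of each vertex and has dense union in $|\Gamma|$. The \emph{punctured graph} is $\Gamma^\circ=|\Gamma|\setminus\bigcup_{B\in\mathcal N}\operatorname{int}B$ together with the family $\{\partial B:B\in\mathcal N\}$ of its \emph{peripherals} (it does not depend on $\mathcal N$ up to homeomorphism). A \emph{tree system of spaces} $\Theta=(T,\{K_t\},\{\Sigma_u\},\{\phi_e\})$ consists of a countable tree $T$ with a bipartition into black vertices $t$ and white vertices $u$ (white vertices having finite degree), nonempty compact metric spaces $K_t$ and $\Sigma_u$, and, for each edge $[t,u]$, a topological embedding $\phi_{[t,u]}:\Sigma_u\to K_t$, such that for each $t$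 the sets $\phi_{[t,u]}(\Sigma_u)$, $u$ adjacent to $t$, are pairwise disjoint and form a null family (for each $\varepsilon>0$ all but finitely many of them have diameter less than $\varepsilon$). Let $\#\Theta$ be the quotient of $\bigsqcup_t K_t$ by the identifications $\phi_{[t,u]}(x)\sim\phi_{[s,u]}(x)$ for white $u$, $x\in\Sigma_u$, and $t,s$ adjacent to $u$; each $K_t$ and each $\Sigma_u$ is viewed as a subset of $\#\Theta$. As a set, $\lim\Theta=\#\Theta\sqcup\partial T$, where $\partial T$ is the set of ends of $T$. Its topology has as a basis the sets $$\mathcal G(U)=U\cup\bigcup_{t\in D_U}K_t\cup\partial_U,$$ where $F$ runs over the finite subtrees of $T$ which contain all neighbours of each of their white vertices, and $U$ over the open subsets of $K_F=\bigcup_{t\in F}K_t\subset\#\Theta$ (with the quotient topology from $\bigsqcup_{t\in F}K_t$) such that for each white $u\notin F$ adjacent to a vertex of $F$ either $\Sigma_u\subset U$ or $\Sigma_u\cap U=\emptyset$. Here $N_U$ is the set of those $u$ with $\Sigma_u\subset U$, $D_U$ is the set of black vertices $t$ for which the path $[u,t]$ is disjoint from $F$ for some $u\in N_U$, and $\partial_U$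 is the set of ends of rays disjoint from $F$ with initial vertex in $N_U$. A \emph{tree system of punctured 2-connected graphs} is a tree system of spaces in which each white vertex of $T$ has degree $2$ and each $K_t$ with the family $\{\phi_{[t,u]}(\Sigma_u)\}_u$ is homeomorphic, as a space with a family of subsets, to the punctured graph $\Gamma_t^\circ$ with its peripherals, for some 2-connected finite graph $\Gamma_t$. A \emph{tree of 2-connected graphs} is a space homeomorphic to the limit of such a system. \textbf{Lemma.} Let $Z$ be a tree of 2-connected graphs; in particular, $Z$ may be the limit $\lim\Theta$ of a tree system $\Theta$ of punctured 2-connected graphs. Then $Z$ is connected, locally connected and has no cutpoint. Moreover, $Z$ has topological dimension exactly $1$ (both its covering dimension and its small inductive dimension are equal to $1$; the two dimensions coincide for compact metrizable spaces). -/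

import Mathlib

open Set Topology

universe u₁ u₂ u₃ u₄ u₅

/-! ### Cutpoints and covering dimension -/

/-- A point `p` is a cutpoint of `X` if `X \ {p}` is disconnected. -/
def IsCutpoint {X : Type*} [TopologicalSpace X] (p : X) : Prop :=
  ¬ IsPreconnected ({p}ᶜ : Set X)

/-- Every finite open cover of `X` has a finite open refinement such that each point of `X` lies in
at most `k` members of the refinement. -/
def HasRefinementsOfMultiplicityLE (X : Type*) [TopologicalSpace X] (k : ℕ) : Prop :=
  ∀ 𝒰 : Set (Set X), 𝒰.Finite → (∀ U ∈ 𝒰, IsOpen U) → ⋃₀ 𝒰 = univ →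
    ∃ 𝒱 : Set (Set X), 𝒱.Finite ∧ (∀ V ∈ 𝒱, IsOpen V) ∧ ⋃₀ 𝒱 = univ ∧
      (∀ V ∈ 𝒱, ∃ U ∈ 𝒰, V ⊆ U) ∧ ∀ x : X, {V ∈ 𝒱 | x ∈ V}.encard ≤ k

/-- The Lebesgue covering dimension of `X` is exactly `n`: it is at most `n` (refinements of
multiplicity at most `n + 1` exist), and it is not at most `n - 1`. -/
def HasCoveringDim (X : Type*) [TopologicalSpace X] (n : ℕ) : Prop :=
  HasRefinementsOfMultiplicityLE X (n + 1) ∧ ¬ HasRefinementsOfMultiplicityLE X n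

/-! ### Finite graphs, their realizations, and punctured graphs -/

/-- A finite graph; loops and multiple edges are allowed. Each edge is given with a parametrization
direction, which only serves to describe the realization. -/
structure FiniteMultigraph where
  V : Type
  E : Type
  [finiteV : Finite V]
  [finiteE : Finite E]
  /-- the two (possibly equal) endpoints of an edge -/
  src : E → V
  tgt : E → V

namespace FiniteMultigraph

variable (Γ : FiniteMultigraph)

/-- Nonempty and without isolated vertices. -/
def Essential : Prop :=
  Nonempty Γ.V ∧ ∀ v : Γ.V, ∃ e : Γ.E, Γ.src e = v ∨ Γ.tgt e = v

/-- The disjoint union of a point for each vertex and of a unit interval for each edge. -/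
abbrev PreRealization : Type :=
  (Σ _ : Γ.V, PUnit.{1}) ⊕ (Σ _ : Γ.E, unitInterval)

/-- The endpoints of the interval of an edge are glued to the endpoints of the edge. -/
inductive RealizationRel : Γ.PreRealization → Γ.PreRealization → Prop
  | src (e : Γ.E) : RealizationRel (Sum.inr ⟨e, 0⟩) (Sum.inl ⟨Γ.src e, PUnit.unit⟩)
  | tgt (e : Γ.E) : RealizationRel (Sum.inr ⟨e, 1⟩) (Sum.inl ⟨Γ.tgt e, PUnit.unit⟩)

/-- The realization `|Γ|`, with the quotient topology. -/
def Realization : Type := Quot Γ.RealizationRel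

instance : TopologicalSpace Γ.Realization :=
  inferInstanceAs (TopologicalSpace (Quot Γ.RealizationRel))

/-- The point of `|Γ|` given by a vertex. -/
def vertexPoint (v : Γ.V) : Γ.Realization := Quot.mk _ (Sum.inl ⟨v, PUnit.unit⟩)

/-- The point with parameter `s` on the edge `e`. -/
def edgePoint (e : Γ.E) (s : unitInterval) : Γ.Realization := Quot.mk _ (Sum.inr ⟨e, s⟩)

/-- A finite graph is 2-connected if its realization is (nonempty and) connected, is not a single
point, and has no cutpoint. -/
def TwoConnected : Prop :=
  ConnectedSpace Γ.Realization ∧ Nontrivial Γ.Realization ∧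
    ∀ x : Γ.Realization, ¬ IsCutpoint x

/-- `B` is a normal neighbourhood of `x` in `|Γ|`: a connected closed neighbourhood which contains
no vertex except possibly `x` itself. The last clause, that `B` contains no whole edge, follows
from this for edges that are not loops; for a loop it excludes a neighbourhood `B` of its vertex
that runs around the whole loop. -/
def IsNormalNhd (x : Γ.Realization) (B : Set Γ.Realization) : Prop :=
  IsConnected B ∧ IsClosed B ∧ B ∈ 𝓝 x ∧
    B ∩ range Γ.vertexPoint = {x} ∩ range Γ.vertexPoint ∧
    ∀ e : Γ.E, ¬ range (Γ.edgePoint e) ⊆ B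

/-- `𝒩` is a standard dense family of normal neighbourhoods in `Γ`. -/
def IsStandardDenseFamily (𝒩 : Set (Set Γ.Realization)) : Prop :=
  (∀ B ∈ 𝒩, ∃ x, Γ.IsNormalNhd x B) ∧ 𝒩.PairwiseDisjoint id ∧
    (∀ v : Γ.V, ∃ B ∈ 𝒩, Γ.IsNormalNhd (Γ.vertexPoint v) B) ∧ Dense (⋃₀ 𝒩)

/-- The underlying set of the punctured graph `Γ°`, as a subspace of `|Γ|`. -/
def punctured (𝒩 : Set (Set Γ.Realization)) : Set Γ.Realization :=
  (⋃ B ∈ 𝒩, interior B)ᶜ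

/-- The space `K` with the family `Ω` of peripherals is isomorphic to the punctured graph `Γ°`: some
homeomorphism from `K` to `Γ°` maps the family `Ω` onto the family of boundaries of the members of a
standard dense family of normal neighbourhoods. -/
def IsPuncturedVersion {K : Type*} [TopologicalSpace K] (Ω : Set (Set K)) : Prop :=
  ∃ 𝒩 : Set (Set Γ.Realization), Γ.IsStandardDenseFamily 𝒩 ∧
    ∃ h : K ≃ₜ Γ.punctured 𝒩, (fun A : Set K => (fun x => (h x : Γ.Realization)) '' A) '' Ω =
      (fun B => frontier B) '' 𝒩

end FiniteMultigraph

/-! ### Rays and ends of a tree -/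

/-- A ray: an infinite embedded path with an initial vertex. -/
structure TreeRay {V : Type*} (T : SimpleGraph V) where
  toFun : ℕ → V
  adj : ∀ n, T.Adj (toFun n) (toFun (n + 1))
  injective : Function.Injective toFun

/-- Two rays are equivalent if they coincide except possibly at some finite initial parts. -/
def TreeRay.setoid {V : Type*} (T : SimpleGraph V) : Setoid (TreeRay T) where
  r ρ σ := ∃ m n : ℕ, ∀ k, ρ.toFun (m + k) = σ.toFun (n + k)
  iseqv :=
    { refl := fun _ => ⟨0, 0, fun _ => rfl⟩
      symm := fun ⟨m, n, h⟩ => ⟨n, m, fun k => (h k).symm⟩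
      trans := by
        rintro ρ σ τ ⟨m, n, h⟩ ⟨m', n', h'⟩
        refine ⟨m + m', n' + n, fun k => ?_⟩
        have h₁ := h (m' + k)
        have h₂ := h' (n + k)
        rw [show m + m' + k = m + (m' + k) by omega, h₁,
          show n + (m' + k) = m' + (n + k) by omega, h₂,
          show n' + (n + k) = n' + n + k by omega] }

/-- The set of ends of a tree. -/
def TreeEnds {V : Type*} (T : SimpleGraph V) : Type _ := Quotient (TreeRay.setoid T)

/-- The end determined by a ray. -/
def TreeRay.toEnd {V : Type*} {T : SimpleGraph V} (ρ : TreeRay T) : TreeEnds T :=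
  Quotient.mk (TreeRay.setoid T) ρ

/-! ### Tree systems of spaces and their limits -/

/-- A tree system of spaces. -/
structure TreeSystem where
  /-- the black vertices of the underlying tree -/
  Black : Type u₁
  /-- the white vertices of the underlying tree -/
  White : Type u₂
  [countable_black : Countable Black]
  [countable_white : Countable White]
  /-- the underlying tree -/
  tree : SimpleGraph (Black ⊕ White)
  isTree : tree.IsTree
  not_adj_black : ∀ t s : Black, ¬ tree.Adj (Sum.inl t) (Sum.inl s)
  not_adj_white : ∀ u w : White, ¬ tree.Adj (Sum.inr u) (Sum.inr w)
  finite_degree : ∀ u : White, {t : Black | tree.Adj (Sum.inl t) (Sum.inr u)}.Finite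
  /-- the constituent spaces -/
  K : Black → Type u₃
  [metricK : ∀ t, MetricSpace (K t)]
  [compactK : ∀ t, CompactSpace (K t)]
  [nonemptyK : ∀ t, Nonempty (K t)]
  /-- the peripheral spaces -/
  P : White → Type u₄
  [metricP : ∀ u, MetricSpace (P u)]
  [compactP : ∀ u, CompactSpace (P u)]
  [nonemptyP : ∀ u, Nonempty (P u)]
  /-- the connecting maps -/
  φ : ∀ (t : Black) (u : White), tree.Adj (Sum.inl t) (Sum.inr u) → P u → K t
  isEmbedding_φ : ∀ t u h, IsEmbedding (φ t u h)
  /-- the peripherals of a constituent space are pairwise disjoint -/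
  disjoint_φ : ∀ t u u' h h', u ≠ u' → Disjoint (range (φ t u h)) (range (φ t u' h'))
  /-- the peripherals of a constituent space form a null family -/
  null_φ : ∀ (t : Black) (ε : ℝ), 0 < ε →
    {u : White | ∃ h, ε ≤ Metric.diam (range (φ t u h))}.Finite

attribute [instance] TreeSystem.countable_black TreeSystem.countable_white
  TreeSystem.metricK TreeSystem.compactK TreeSystem.nonemptyK
  TreeSystem.metricP TreeSystem.compactP TreeSystem.nonemptyP

namespace TreeSystem

variable (Θ : TreeSystem.{u₁, u₂, u₃, u₄})

/-- The family of peripherals of the constituent space at `t`. -/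
def peripherals (t : Θ.Black) : Set (Set (Θ.K t)) :=
  {A | ∃ u h, A = range (Θ.φ t u h)}

/-- Every white vertex has degree 2, and each constituent space with peripherals is the punctured
version of a finite essential graph which is 2-connected. -/
def IsOfPuncturedTwoConnectedGraphs : Prop :=
  (∀ u : Θ.White, {t : Θ.Black | Θ.tree.Adj (Sum.inl t) (Sum.inr u)}.ncard = 2) ∧
    ∀ t : Θ.Black, ∃ Γ : FiniteMultigraph, Γ.Essential ∧ Γ.TwoConnected ∧
      Γ.IsPuncturedVersion (Θ.peripherals t)

/-- The identifications of points of the peripherals of constituent spaces. -/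
inductive GlueRel : (Σ t : Θ.Black, Θ.K t) → (Σ t : Θ.Black, Θ.K t) → Prop
  | glue (u : Θ.White) (x : Θ.P u) (t s : Θ.Black) (ht : Θ.tree.Adj (Sum.inl t) (Sum.inr u))
      (hs : Θ.tree.Adj (Sum.inl s) (Sum.inr u)) :
      GlueRel ⟨t, Θ.φ t u ht x⟩ ⟨s, Θ.φ s u hs x⟩

/-- The set `#Θ`, the quotient of the disjoint union of all constituent spaces. -/
def Glued : Type _ := Quot Θ.GlueRel

/-- The canonical map from a constituent space to `#Θ`. -/
def toGlued (t : Θ.Black) (x : Θ.K t) : Θ.Glued := Quot.mk _ ⟨t, x⟩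

/-- The peripheral space at `u` as a subset of `#Θ` (the sets `range (Θ.φ t u h)`, for all `t`
adjacent to `u`, are identified with each other in `#Θ`). -/
def gluedPeripheral (u : Θ.White) : Set Θ.Glued :=
  {p | ∃ t h x, p = Θ.toGlued t (Θ.φ t u h x)}

/-- The limit of the tree system as a set: the disjoint union of `#Θ` and of the ends of the
underlying tree. -/
def Limit : Type _ := Θ.Glued ⊕ TreeEnds Θ.tree

/-- `F` is the vertex set of a finite b-subtree: a finite subtree which contains all neighbours of
each of its white vertices. -/
def IsFiniteBSubtree (F : Set (Θ.Black ⊕ Θ.White)) : Prop :=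
  F.Finite ∧ (Θ.tree.induce F).IsTree ∧
    ∀ (u : Θ.White) (t : Θ.Black), Sum.inr u ∈ F → Θ.tree.Adj (Sum.inl t) (Sum.inr u) →
      Sum.inl t ∈ F

variable (F : Set (Θ.Black ⊕ Θ.White))

/-- The set `N_F` of the (white) vertices outside `F` which are adjacent to a vertex of `F`. -/
def outerNeighbors : Set Θ.White :=
  {u | Sum.inr u ∉ F ∧ ∃ t : Θ.Black, Sum.inl t ∈ F ∧ Θ.tree.Adj (Sum.inl t) (Sum.inr u)}

/-- The partial union `K_F` as a subset of `#Θ`. -/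
def partialUnion : Set Θ.Glued :=
  ⋃ (t : Θ.Black) (_ : Sum.inl t ∈ F), range (Θ.toGlued t)

/-- `U` is an open subset of the partial union `K_F`, for its topology as a quotient of the disjoint
union of the constituent spaces `K t` with `t` in `F`. -/
def IsOpenInPartialUnion (U : Set Θ.Glued) : Prop :=
  U ⊆ Θ.partialUnion F ∧ ∀ t : Θ.Black, Sum.inl t ∈ F → IsOpen (Θ.toGlued t ⁻¹' U)

/-- `U` is saturated with respect to the peripherals of the partial union `K_F`. -/
def IsSaturated (U : Set Θ.Glued) : Prop :=
  ∀ u ∈ Θ.outerNeighbors F, Θ.gluedPeripheral u ⊆ U ∨ Disjoint (Θ.gluedPeripheral u) U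

/-- The set `N_U` of those vertices in `N_F` whose peripheral is contained in `U`. -/
def outerNeighborsIn (U : Set Θ.Glued) : Set Θ.White :=
  {u ∈ Θ.outerNeighbors F | Θ.gluedPeripheral u ⊆ U}

/-- The set `D_U` of those black vertices `t` for which the path from some `u` in `N_U` to `t` is
disjoint from `F`. -/
def blackBeyond (U : Set Θ.Glued) : Set Θ.Black :=
  {t | ∃ u ∈ Θ.outerNeighborsIn F U, ∃ p : Θ.tree.Walk (Sum.inr u) (Sum.inl t),
    p.IsPath ∧ ∀ v ∈ p.support, v ∉ F}

/-- The set `∂_U` of the ends of rays which start in `N_U` and are disjoint from `F`. -/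
def endsBeyond (U : Set Θ.Glued) : Set (TreeEnds Θ.tree) :=
  {ξ | ∃ ρ : TreeRay Θ.tree, (∃ u ∈ Θ.outerNeighborsIn F U, ρ.toFun 0 = Sum.inr u) ∧
    (∀ n, ρ.toFun n ∉ F) ∧ ρ.toEnd = ξ}

/-- The subset `𝒢(U)` of the limit. -/
def basicSet (U : Set Θ.Glued) : Set Θ.Limit :=
  Sum.inl '' (U ∪ ⋃ t ∈ Θ.blackBeyond F U, range (Θ.toGlued t)) ∪ Sum.inr '' Θ.endsBeyond F U

/-- The topology on the limit given by the sets `𝒢(U)`, for all finite b-subtrees `F` and all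
open saturated subsets `U` of `K_F`. -/
instance : TopologicalSpace Θ.Limit :=
  TopologicalSpace.generateFrom
    {G | ∃ (F : Set (Θ.Black ⊕ Θ.White)) (U : Set Θ.Glued), Θ.IsFiniteBSubtree F ∧
      Θ.IsOpenInPartialUnion F U ∧ Θ.IsSaturated F U ∧ G = Θ.basicSet F U}

end TreeSystem

/-!
The limit of a tree system of punctured 2-connected graphs is studied through the parts
`TreeSystem.beyond Θ a b` of the limit that lie beyond an edge `ab` of the tree. For every edge the
two parts on its sides are closed, cover the limit and meet in the finite peripheral at the white
end of the edge. Two kinds of facts are needed about them.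

*Induction along the tree.* If a property of sides of edges passes from the sides of the edges that
continue a given edge to the side of this edge, and if each ray has an edge with the property, then
all edges have it, since a counterexample could be prolonged to a ray without such an edge
(`treeSide_noetherian_induction`). The condition on rays is of a local nature at the end of the ray,
because the parts beyond the edges of a ray form a neighbourhood basis of its end
(`TreeSystem.exists_beyond_subset`). In this way, compactness of the limit
(`TreeSystem.compactSpace_limit`) and connectedness of each part
(`TreeSystem.isPreconnected_beyond`) are reduced to statements about a single constituent space.

*Punctured graphs.* What matters about a constituent space with its peripherals is collected in
`IsGraphlike`. Peripherals are finite, have at least two points and empty interior, and there are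
many clopen sets: the trace of the punctured graph on an edge is a closed set with empty interior,
and each of its gaps is the interior of a member of the dense family of normal neighbourhoods. A
continuous two-valued function which is constant on peripherals takes one value on each edge, since
it takes the same value at both ends of every gap; and it takes the same value on edges with a
common vertex. So, if it is defined only outside of a single peripheral or of a single point, two
values would divide the complement of a point in the graph, which is connected as there are no
cutpoints (`FiniteMultigraph.IsPuncturedVersion.isGraphlike`). As the parts of the limit beyond
peripherals are connected, this shows that the limit is connected and without cutpoints
(`TreeSystem.not_isCutpoint`).

Finally, the limit has a basis of closed connected neighbourhoods which arise from open sets by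
adding finitely many points (`TreeSystem.hasFiniteBoundaryBasis_limit`). At an end these are parts
beyond edges. At a point of a constituent space `K` one takes a small clopen subset `A` of `K` with
everything beyond the peripherals contained in `A`; as peripherals form a null family, only finitely
many of them are cut by `A`, so that finitely many points are in excess. At a point of a peripheral
this is done on both sides. Such a basis gives local connectedness, regularity, and the bound 1 for
both dimensions (`HasFiniteBoundaryBasis`); dimension 0 is excluded for a connected space with more
than one point.
-/

/-! ### Spaces with a basis of neighbourhoods of finite boundary -/

/-- Each point has arbitrarily small neighbourhoods `N` which are closed and connected and arise
from an open set `O` by adding finitely many points. -/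
def HasFiniteBoundaryBasis (X : Type*) [TopologicalSpace X] : Prop :=
  ∀ z : X, ∀ W ∈ 𝓝 z, ∃ O N : Set X, IsOpen O ∧ IsClosed N ∧ z ∈ O ∧ O ⊆ N ∧ N ⊆ W ∧
    (N \ O).Finite ∧ IsPreconnected N

namespace HasFiniteBoundaryBasis

variable {X : Type*} [TopologicalSpace X]

theorem regularSpace (h : HasFiniteBoundaryBasis X) : RegularSpace X := by
  refine RegularSpace.of_exists_mem_nhds_isClosed_subset fun z W hW => ?_
  obtain ⟨O, N, hO, hN, hz, hON, hNW, -, -⟩ := h z W hW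
  exact ⟨N, Filter.mem_of_superset (hO.mem_nhds hz) hON, hN, hNW⟩

theorem locallyConnectedSpace (h : HasFiniteBoundaryBasis X) : LocallyConnectedSpace X := by
  refine locallyConnectedSpace_of_connected_bases (fun _ N => N)
    (fun z N => N ∈ 𝓝 z ∧ IsPreconnected N) (fun z => ?_) fun z N hN => hN.2
  refine ⟨fun W => ⟨fun hW => ?_, fun ⟨N, hN, hNW⟩ => Filter.mem_of_superset hN.1 hNW⟩⟩
  obtain ⟨O, N, hO, -, hz, hON, hNW, -, hc⟩ := h z W hW
  exact ⟨N, ⟨Filter.mem_of_superset (hO.mem_nhds hz) hON, hc⟩, hNW⟩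

theorem exists_finite_frontier (h : HasFiniteBoundaryBasis X) {z : X} {W : Set X} (hW : W ∈ 𝓝 z) :
    ∃ O : Set X, IsOpen O ∧ z ∈ O ∧ O ⊆ W ∧ (frontier O).Finite := by
  obtain ⟨O, N, hO, hN, hz, hON, hNW, hfin, -⟩ := h z W hW
  refine ⟨O, hO, hz, hON.trans hNW, hfin.subset ?_⟩
  rw [hO.frontier_eq]
  exact sdiff_subset_sdiff_left (hN.closure_subset_iff.2 hON)

theorem of_homeomorph {Y : Type*} [TopologicalSpace Y] (e : X ≃ₜ Y)
    (h : HasFiniteBoundaryBasis Y) : HasFiniteBoundaryBasis X := by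
  intro z W hW
  have hW' : e.symm ⁻¹' W ∈ 𝓝 (e z) :=
    e.symm.continuous.continuousAt.preimage_mem_nhds (by simpa using hW)
  obtain ⟨O, N, hO, hN, hz, hON, hNW, hfin, hc⟩ := h (e z) _ hW'
  refine ⟨e ⁻¹' O, e ⁻¹' N, hO.preimage e.continuous, hN.preimage e.continuous, hz,
    preimage_mono hON, fun x hx => by simpa using hNW hx, ?_, e.isPreconnected_preimage.2 hc⟩
  rw [← preimage_sdiff]
  exact hfin.preimage e.injective.injOn

theorem hasSmallInductiveDimensionLE_one [T1Space X] (h : HasFiniteBoundaryBasis X) :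
    HasSmallInductiveDimensionLE X 1 := by
  refine .succ 1 {O | IsOpen O ∧ (frontier O).Finite} ?_ ?_
  · refine TopologicalSpace.isTopologicalBasis_of_isOpen_of_nhds (fun O hO => hO.1) ?_
    intro z W hz hW
    obtain ⟨O, hO, hzO, hOW, hfin⟩ := h.exists_finite_frontier (hW.mem_nhds hz)
    exact ⟨O, ⟨hO, hfin⟩, hzO, hOW⟩
  · rintro O ⟨-, hfin⟩
    have : Finite (frontier O) := hfin
    rw [hasSmallInductiveDimensionLT_one_iff]
    exact (isTopologicalBasis_singletons _).of_isOpen_of_subset (fun U _ => isOpen_discrete U)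
      fun U _ => isClopen_discrete U

/-- Cover the space by finitely many open sets `O i` with finite boundaries. Subtracting from each
`O i` the closures of the preceding ones leaves disjoint open sets that miss only finitely many
points, and these points have disjoint neighbourhoods. -/
theorem hasRefinementsOfMultiplicityLE_two [CompactSpace X] [T2Space X]
    (h : HasFiniteBoundaryBasis X) : HasRefinementsOfMultiplicityLE X 2 := by
  intro 𝒰 _ hopen hcov
  have hex : ∀ x : X, ∃ U ∈ 𝒰, x ∈ U := fun x => by
    have : x ∈ ⋃₀ 𝒰 := hcov ▸ mem_univ x
    simpa using this
  choose U hU hxU using hex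
  choose O hO hxO hOU hfr using fun x =>
    h.exists_finite_frontier ((hopen _ (hU x)).mem_nhds (hxU x))
  obtain ⟨s, hs⟩ := isCompact_univ.elim_finite_subcover O hO
    fun x _ => mem_iUnion.2 ⟨x, hxO x⟩
  obtain ⟨n, p, hp⟩ : ∃ (n : ℕ) (p : Fin n → X), ∀ x, ∃ i, x ∈ O (p i) := by
    refine ⟨s.card, fun i => (s.equivFin.symm i : X), fun x => ?_⟩
    obtain ⟨y, hy, hxy⟩ := mem_iUnion₂.1 (hs (mem_univ x))
    exact ⟨s.equivFin ⟨y, hy⟩, by simpa using hxy⟩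
  set R : Set X := ⋃ i, frontier (O (p i)) with hR
  have hRfin : R.Finite := finite_iUnion fun i => hfr _
  obtain ⟨D, hD, hdisj⟩ := hRfin.t2_separation
  set A : Fin n → Set X := fun i => O (p i) \ ⋃ j : Fin n, ⋃ _ : j < i, closure (O (p j)) with hA
  have hAopen : ∀ i, IsOpen (A i) := fun i =>
    (hO _).sdiff (isClosed_iUnion_of_finite fun j => isClosed_iUnion_of_finite
      fun _ => isClosed_closure)
  have hAlt : ∀ {x i j}, x ∈ A i → x ∈ A j → ¬ i < j := by
    intro x i j hi hj hij
    exact hj.2 (mem_iUnion₂.2 ⟨i, hij, subset_closure hi.1⟩)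
  refine ⟨range A ∪ (fun r => D r ∩ U r) '' R, (finite_range _).union (hRfin.image _), ?_, ?_, ?_,
    ?_⟩
  · rintro V (⟨i, rfl⟩ | ⟨r, -, rfl⟩)
    exacts [hAopen i, (hD r).2.inter (hopen _ (hU r))]
  · refine eq_univ_of_forall fun x => ?_
    by_cases hx : x ∈ R
    · exact ⟨_, Or.inr ⟨x, hx, rfl⟩, (hD x).1, hxU x⟩
    · obtain ⟨i, hi, hmin⟩ := WellFounded.has_min (wellFounded_lt (α := Fin n))
        {i | x ∈ O (p i)} (hp x)
      refine ⟨_, Or.inl ⟨i, rfl⟩, hi, fun hmem => ?_⟩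
      obtain ⟨j, hj, hxj⟩ := mem_iUnion₂.1 hmem
      refine hx (mem_iUnion.2 ⟨j, ?_⟩)
      rw [(hO _).frontier_eq]
      exact ⟨hxj, fun h => hmin j h hj⟩
  · rintro V (⟨i, rfl⟩ | ⟨r, -, rfl⟩)
    exacts [⟨_, hU (p i), sdiff_subset.trans (hOU _)⟩, ⟨_, hU r, inter_subset_right⟩]
  · intro x
    have hsub : {V ∈ range A ∪ (fun r => D r ∩ U r) '' R | x ∈ V} ⊆
        {V ∈ range A | x ∈ V} ∪ {V ∈ (fun r => D r ∩ U r) '' R | x ∈ V} := by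
      rintro V ⟨hV | hV, hx⟩
      exacts [Or.inl ⟨hV, hx⟩, Or.inr ⟨hV, hx⟩]
    have h1 : {V ∈ range A | x ∈ V}.encard ≤ 1 := by
      rw [encard_le_one_iff]
      rintro _ _ ⟨⟨i, rfl⟩, hi⟩ ⟨⟨j, rfl⟩, hj⟩
      rw [le_antisymm (not_lt.1 (hAlt hj hi)) (not_lt.1 (hAlt hi hj))]
    have h2 : {V ∈ (fun r => D r ∩ U r) '' R | x ∈ V}.encard ≤ 1 := by
      rw [encard_le_one_iff]
      rintro _ _ ⟨⟨i, hiR, rfl⟩, hi⟩ ⟨⟨j, hjR, rfl⟩, hj⟩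
      have : i = j := by
        by_contra hij
        exact disjoint_left.1 (hdisj hiR hjR hij) hi.1 hj.1
      rw [this]
    calc _ ≤ _ := encard_le_encard hsub
      _ ≤ _ := encard_union_le _ _
      _ ≤ 1 + 1 := add_le_add h1 h2
      _ = ((2 : ℕ) : ℕ∞) := by norm_num

theorem hasCoveringDim_one [CompactSpace X] [T2Space X] [ConnectedSpace X] [Nontrivial X]
    (h : HasFiniteBoundaryBasis X) : HasCoveringDim X 1 := by
  refine ⟨h.hasRefinementsOfMultiplicityLE_two, fun h1 => ?_⟩
  obtain ⟨a, b, hab⟩ := exists_pair_ne X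
  obtain ⟨𝒱, -, hopen, hcov, href, hmul⟩ := h1 {{a}ᶜ, {b}ᶜ} (by simp)
    (by rintro U (rfl | rfl) <;> exact isOpen_compl_singleton)
    (by
      refine eq_univ_of_forall fun x => ?_
      by_cases hx : x = a
      · exact ⟨{b}ᶜ, by simp, by simpa [hx] using hab⟩
      · exact ⟨{a}ᶜ, by simp, hx⟩)
  obtain ⟨V, hV, haV⟩ : a ∈ ⋃₀ 𝒱 := hcov ▸ mem_univ a
  -- a cover of multiplicity one consists of clopen sets
  have hclopen : IsClopen V := by
    refine ⟨⟨?_⟩, hopen V hV⟩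
    have : Vᶜ = ⋃₀ (𝒱 \ {V}) := by
      ext x
      constructor
      · intro hx
        obtain ⟨V', hV', hxV'⟩ : x ∈ ⋃₀ 𝒱 := hcov ▸ mem_univ x
        exact ⟨V', ⟨hV', fun h => hx (h ▸ hxV')⟩, hxV'⟩
      · rintro ⟨V', ⟨hV', hne⟩, hxV'⟩ hx
        have hm : {V ∈ 𝒱 | x ∈ V}.encard ≤ 1 := mod_cast hmul x
        exact hne (encard_le_one_iff.1 hm V' V ⟨hV', hxV'⟩ ⟨hV, hx⟩)
    rw [this]
    exact isOpen_sUnion fun V' hV' => hopen V' hV'.1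
  have huniv : V = univ := (isClopen_iff.1 hclopen).resolve_left (Nonempty.ne_empty ⟨a, haV⟩)
  obtain ⟨U, hU | hU, hVU⟩ := href V hV
  · exact (hU ▸ hVU) haV rfl
  · exact (hU ▸ hVU) (huniv ▸ mem_univ b) rfl

theorem smallInductiveDimension_eq_one [T1Space X] [ConnectedSpace X] [Nontrivial X]
    (h : HasFiniteBoundaryBasis X) : smallInductiveDimension X = 1 := by
  refine mod_cast smallInductiveDimension_eq 1 h.hasSmallInductiveDimensionLE_one fun h1 => ?_
  rw [hasSmallInductiveDimensionLT_one_iff] at h1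
  obtain ⟨a, b, hab⟩ := exists_pair_ne X
  obtain ⟨V, hV, haV, hVb⟩ := h1.exists_subset_of_mem_open (show a ∈ ({b}ᶜ : Set X) from hab)
    isOpen_compl_singleton
  rcases isClopen_iff.1 hV with rfl | rfl
  exacts [haV, hVb (mem_univ b) rfl]

end HasFiniteBoundaryBasis

/-! ### Two-valued functions on spaces and on closed subsets of an interval -/

/-- `f` takes at most one value on `S`. -/
def ConstOn {X : Type*} (f : X → Bool) (S : Set X) : Prop :=
  ∀ x ∈ S, ∀ y ∈ S, f x = f y

/-- A continuous two-valued function which is constant on a dense part is constant. -/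
theorem ConstOn.of_dense {X : Type*} [TopologicalSpace X] {f : X → Bool} {S S' : Set X}
    (h : ConstOn f S) (hf : ContinuousOn f S') (hS : S ⊆ S') (hd : S' ⊆ closure S) :
    ConstOn f S' := by
  have key : ∀ x ∈ S', ∃ y ∈ S, f x = f y := by
    intro x hx
    have h1 : f ⁻¹' {f x} ∈ 𝓝[S'] x := hf x hx (by simp [nhds_discrete])
    obtain ⟨V, hV, hxV, hVS⟩ := mem_nhdsWithin.1 h1
    obtain ⟨y, hyV, hyS⟩ := mem_closure_iff.1 (hd hx) V hV hxV
    exact ⟨y, hyS, (hVS ⟨hyV, hS hyS⟩).symm⟩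
  intro x hx y hy
  obtain ⟨x', hx', h1⟩ := key x hx
  obtain ⟨y', hy', h2⟩ := key y hy
  rw [h1, h2, h x' hx' y' hy']

/-- If a two-valued continuous function on a closed subset `K` of a line takes equal values at the
two ends of each gap of `K`, then it is constant: between two points with different values there is
a last point with the first value before the first point with the other value. -/
theorem constOn_of_gaps {α : Type*} [LinearOrder α] [TopologicalSpace α] [OrderTopology α]
    [CompactIccSpace α] {K J : Set α} (hK : IsClosed K) (hJ : J.OrdConnected) {f : α → Bool}
    (hf : ContinuousOn f (J ∩ K))
    (hgap : ∀ c ∈ J ∩ K, ∀ d ∈ J ∩ K, c < d → Disjoint (Ioo c d) K → f c = f d) :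
    ConstOn f (J ∩ K) := by
  have key : ∀ x ∈ J ∩ K, ∀ y ∈ J ∩ K, x ≤ y → f x = f y := by
    intro x hx y hy hxy
    by_contra hne
    have hJ' : Icc x y ∩ K ⊆ J ∩ K := inter_subset_inter_left _ (hJ.out hx.1 hy.1)
    have hcl : IsClosed (Icc x y ∩ K) := isClosed_Icc.inter hK
    have hT : IsClosed (Icc x y ∩ K ∩ f ⁻¹' {f x}ᶜ) :=
      (hf.mono hJ').preimage_isClosed_of_isClosed hcl (isClosed_discrete _)
    obtain ⟨d, hd, hdmin⟩ := (isCompact_Icc.of_isClosed_subset hT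
      fun z hz => hz.1.1).exists_isLeast ⟨y, ⟨⟨hxy, le_rfl⟩, hy.2⟩, fun h => hne h.symm⟩
    have hT' : IsClosed (Icc x d ∩ (Icc x y ∩ K ∩ f ⁻¹' {f x})) :=
      isClosed_Icc.inter ((hf.mono hJ').preimage_isClosed_of_isClosed hcl (isClosed_discrete _))
    obtain ⟨c, hc, hcmax⟩ := (isCompact_Icc.of_isClosed_subset hT'
      fun z hz => hz.1).exists_isGreatest
        ⟨x, ⟨le_rfl, hd.1.1.1⟩, ⟨⟨le_rfl, hxy⟩, hx.2⟩, rfl⟩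
    have hcd : c < d := hc.1.2.lt_of_ne fun h => hd.2 (h ▸ hc.2.2)
    have hfc : f c = f x := hc.2.2
    refine hd.2 ?_
    rw [mem_singleton_iff, ← hfc]
    refine (hgap c (hJ' hc.2.1) d (hJ' hd.1) hcd ?_).symm
    rw [disjoint_left]
    intro z hz hzK
    have hzI : z ∈ Icc x y ∩ K :=
      ⟨⟨hc.1.1.trans hz.1.le, hz.2.le.trans hd.1.1.2⟩, hzK⟩
    by_cases hfz : f z = f x
    · exact (hcmax ⟨⟨hzI.1.1, hz.2.le⟩, hzI, hfz⟩).not_gt hz.1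
    · exact (hdmin ⟨hzI, hfz⟩).not_gt hz.2
  intro x hx y hy
  rcases le_total x y with h | h
  exacts [key x hx y hy h, (key y hy x hx h).symm]

/-- If `X \ {p}` is connected, then finitely many closed sets which cover `X` and are not contained
in `{p}` cannot be divided into two classes such that members of different classes meet at most
in `p`. -/
theorem eq_of_closed_cover {X κ : Type*} [TopologicalSpace X] [Finite κ] {p : X}
    (hp : IsPreconnected ({p}ᶜ : Set X)) {C : κ → Set X} (hC : ∀ k, IsClosed (C k))
    (hcov : ∀ x, ∃ k, x ∈ C k) (hne : ∀ k, ∃ x ∈ C k, x ≠ p) {F : κ → Bool}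
    (hF : ∀ k l x, x ≠ p → x ∈ C k → x ∈ C l → F k = F l) (k l : κ) : F k = F l := by
  have hcl : ∀ b, IsClosed (⋃ i : {i // F i = b}, C i) := fun b =>
    isClosed_iUnion_of_finite fun i => hC i
  by_contra hkl
  obtain ⟨x, hx, hxk⟩ := hne k
  obtain ⟨y, hy, hyl⟩ := hne l
  obtain ⟨z, hz, hz1, hz2⟩ := isPreconnected_closed_iff.1 hp _ _ (hcl (F k)) (hcl (F l))
    (fun w _ => by
      obtain ⟨i, hi⟩ := hcov w
      by_cases h : F i = F k
      · exact Or.inl (mem_iUnion.2 ⟨⟨i, h⟩, hi⟩)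
      · refine Or.inr (mem_iUnion.2 ⟨⟨i, ?_⟩, hi⟩)
        cases h1 : F i <;> cases h2 : F k <;> cases h3 : F l <;> simp_all)
    ⟨x, hxk, mem_iUnion.2 ⟨⟨k, rfl⟩, hx⟩⟩ ⟨y, hyl, mem_iUnion.2 ⟨⟨l, rfl⟩, hy⟩⟩
  obtain ⟨⟨i, hi⟩, hzi⟩ := mem_iUnion.1 hz1
  obtain ⟨⟨j, hj⟩, hzj⟩ := mem_iUnion.1 hz2
  exact hkl (hi.symm.trans ((hF i j z hz hzi hzj).trans hj))

/-! ### The realization of a finite graph -/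

namespace FiniteMultigraph

variable {Γ : FiniteMultigraph}

theorem edgePoint_zero (e : Γ.E) : Γ.edgePoint e 0 = Γ.vertexPoint (Γ.src e) :=
  Quot.sound (.src e)

theorem edgePoint_one (e : Γ.E) : Γ.edgePoint e 1 = Γ.vertexPoint (Γ.tgt e) :=
  Quot.sound (.tgt e)

open Classical in
/-- A point of the realization is either a vertex or an interior point of an edge. -/
noncomputable def normalForm (Γ : FiniteMultigraph) : Γ.Realization → Γ.V ⊕ (Γ.E × unitInterval) :=
  Quot.lift
    (fun x => match x with
      | Sum.inl ⟨v, _⟩ => Sum.inl v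
      | Sum.inr ⟨e, s⟩ =>
        if s = 0 then Sum.inl (Γ.src e) else if s = 1 then Sum.inl (Γ.tgt e) else Sum.inr (e, s))
    (by rintro _ _ (e | e) <;> simp)

theorem normalForm_vertexPoint (v : Γ.V) : Γ.normalForm (Γ.vertexPoint v) = Sum.inl v := rfl

theorem normalForm_edgePoint {e : Γ.E} {s : unitInterval} (h0 : 0 < s) (h1 : s < 1) :
    Γ.normalForm (Γ.edgePoint e s) = Sum.inr (e, s) := by
  change (if s = 0 then _ else if s = 1 then _ else _) = _
  rw [if_neg h0.ne', if_neg h1.ne]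

theorem vertexPoint_injective : Function.Injective Γ.vertexPoint := fun _ _ h =>
  Sum.inl_injective (congrArg Γ.normalForm h)

theorem vertexPoint_ne_edgePoint {v : Γ.V} {e : Γ.E} {s : unitInterval} (h0 : 0 < s) (h1 : s < 1) :
    Γ.vertexPoint v ≠ Γ.edgePoint e s := fun h => by
  have := congrArg Γ.normalForm h
  rw [normalForm_vertexPoint, normalForm_edgePoint h0 h1] at this
  cases this

theorem eq_zero_or_eq_one_or (s : unitInterval) : s = 0 ∨ s = 1 ∨ (0 < s ∧ s < 1) := by
  rcases eq_or_ne s 0 with h | h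
  · exact Or.inl h
  rcases eq_or_ne s 1 with h' | h'
  · exact Or.inr (Or.inl h')
  · exact Or.inr (Or.inr ⟨unitInterval.pos_iff_ne_zero.2 h, unitInterval.lt_one_iff_ne_one.2 h'⟩)

/-- An interior point of an edge determines the edge and the parameter. -/
theorem edgePoint_inj {e e' : Γ.E} {s s' : unitInterval} (h0 : 0 < s) (h1 : s < 1)
    (h : Γ.edgePoint e' s' = Γ.edgePoint e s) : e' = e ∧ s' = s := by
  rcases eq_zero_or_eq_one_or s' with rfl | rfl | ⟨h0', h1'⟩
  · rw [edgePoint_zero] at h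
    exact absurd h (vertexPoint_ne_edgePoint h0 h1)
  · rw [edgePoint_one] at h
    exact absurd h (vertexPoint_ne_edgePoint h0 h1)
  · have := congrArg Γ.normalForm h
    rw [normalForm_edgePoint h0 h1, normalForm_edgePoint h0' h1'] at this
    simpa using this

theorem continuous_edgePoint (e : Γ.E) : Continuous (Γ.edgePoint e) :=
  (continuous_quot_mk.comp continuous_inr).comp continuous_sigmaMk

theorem isClosed_of_preimage {S : Set Γ.Realization}
    (h : ∀ e, IsClosed (Γ.edgePoint e ⁻¹' S)) : IsClosed S := by
  have hq : IsQuotientMap (Quot.mk Γ.RealizationRel) := isQuotientMap_quot_mk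
  refine hq.isClosed_preimage.1 (isClosed_sum_iff.2 ⟨isClosed_discrete _, ?_⟩)
  exact isClosed_sigma_iff.2 h

theorem isOpen_of_preimage {S : Set Γ.Realization}
    (h : ∀ e, IsOpen (Γ.edgePoint e ⁻¹' S)) : IsOpen S :=
  isClosed_compl_iff.1 (isClosed_of_preimage fun e => (h e).isClosed_compl)

theorem isClosed_image_edgePoint (e : Γ.E) {C : Set unitInterval} (hC : IsClosed C) :
    IsClosed (Γ.edgePoint e '' C) := by
  refine isClosed_of_preimage fun e' => ?_
  have h01 : IsClosed (Γ.edgePoint e' ⁻¹' (Γ.edgePoint e '' C) ∩ {0, 1}) :=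
    ((toFinite {0, 1}).subset inter_subset_right).isClosed
  by_cases he : e' = e
  · subst he
    convert hC.union h01 using 1
    ext s
    constructor
    · rintro ⟨r, hr, hrs⟩
      rcases eq_zero_or_eq_one_or s with rfl | rfl | ⟨h0, h1⟩
      · exact Or.inr ⟨⟨r, hr, hrs⟩, by simp⟩
      · exact Or.inr ⟨⟨r, hr, hrs⟩, by simp⟩
      · exact Or.inl ((edgePoint_inj h0 h1 hrs).2 ▸ hr)
    · rintro (hs | hs)
      exacts [mem_image_of_mem _ hs, hs.1]
  · convert h01 using 1
    refine (inter_eq_left.2 ?_).symm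
    rintro s ⟨r, hr, hrs⟩
    rcases eq_zero_or_eq_one_or s with rfl | rfl | ⟨h0, h1⟩
    · simp
    · simp
    · exact absurd (edgePoint_inj h0 h1 hrs).1.symm he

theorem isOpen_image_edgePoint (e : Γ.E) {a b : unitInterval} :
    IsOpen (Γ.edgePoint e '' Ioo a b) := by
  refine isOpen_of_preimage fun e' => ?_
  have h01 : ∀ r ∈ Ioo a b, 0 < r ∧ r < 1 := fun r hr =>
    ⟨lt_of_le_of_lt unitInterval.nonneg' hr.1, lt_of_lt_of_le hr.2 unitInterval.le_one'⟩
  by_cases he : e' = e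
  · subst he
    convert isOpen_Ioo (a := a) (b := b) using 1
    ext s
    refine ⟨?_, fun hs => mem_image_of_mem _ hs⟩
    rintro ⟨r, hr, hrs⟩
    exact (edgePoint_inj (h01 r hr).1 (h01 r hr).2 hrs.symm).2 ▸ hr
  · convert isOpen_empty
    refine eq_empty_of_forall_notMem ?_
    rintro s ⟨r, hr, hrs⟩
    exact he (edgePoint_inj (h01 r hr).1 (h01 r hr).2 hrs.symm).1

theorem Essential.exists_edgePoint (hΓ : Γ.Essential) (y : Γ.Realization) :
    ∃ e s, y = Γ.edgePoint e s := by
  rcases y with ⟨⟨v, ⟨⟩⟩ | ⟨e, s⟩⟩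
  · obtain ⟨e, he | he⟩ := hΓ.2 v
    · exact ⟨e, 0, by rw [edgePoint_zero, he]; rfl⟩
    · exact ⟨e, 1, by rw [edgePoint_one, he]; rfl⟩
  · exact ⟨e, s, rfl⟩

/-- A connected set which misses two points of an edge but contains a point between them lies in the
edge, between the two points. -/
theorem subset_image_Ioo_of_isPreconnected {B : Set Γ.Realization} (hB : IsPreconnected B)
    {e : Γ.E} {a s b : unitInterval} (has : a < s) (hsb : s < b) (ha : Γ.edgePoint e a ∉ B)
    (hs : Γ.edgePoint e s ∈ B) (hb : Γ.edgePoint e b ∉ B) : B ⊆ Γ.edgePoint e '' Ioo a b := by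
  refine hB.subset_of_closure_inter_subset (isOpen_image_edgePoint e)
    ⟨_, hs, mem_image_of_mem _ ⟨has, hsb⟩⟩ ?_
  rintro y ⟨hy, hyB⟩
  have : closure (Γ.edgePoint e '' Ioo a b) ⊆ Γ.edgePoint e '' Icc a b :=
    closure_minimal (image_mono Ioo_subset_Icc_self) (isClosed_image_edgePoint e isClosed_Icc)
  obtain ⟨r, hr, rfl⟩ := this hy
  refine mem_image_of_mem _ ⟨hr.1.lt_of_ne ?_, hr.2.lt_of_ne ?_⟩
  · rintro rfl; exact ha hyB
  · rintro rfl; exact hb hyB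

/-! ### The punctured graph -/

variable {𝒩 : Set (Set Γ.Realization)}

/-- The parameters of the points of an edge which belong to the punctured graph. -/
def trace (Γ : FiniteMultigraph) (𝒩 : Set (Set Γ.Realization)) (e : Γ.E) : Set unitInterval :=
  Γ.edgePoint e ⁻¹' Γ.punctured 𝒩

theorem isClosed_punctured : IsClosed (Γ.punctured 𝒩) :=
  (isOpen_biUnion fun _ _ => isOpen_interior).isClosed_compl

theorem isClosed_trace (e : Γ.E) : IsClosed (Γ.trace 𝒩 e) :=
  isClosed_punctured.preimage (continuous_edgePoint e)

theorem notMem_punctured {y : Γ.Realization} :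
    y ∉ Γ.punctured 𝒩 ↔ ∃ B ∈ 𝒩, y ∈ interior B := by
  simp [punctured]

namespace IsStandardDenseFamily

theorem isClosed (h𝒩 : Γ.IsStandardDenseFamily 𝒩) {B : Set Γ.Realization} (hB : B ∈ 𝒩) :
    IsClosed B :=
  (h𝒩.1 B hB).choose_spec.2.1

theorem isPreconnected (h𝒩 : Γ.IsStandardDenseFamily 𝒩) {B : Set Γ.Realization} (hB : B ∈ 𝒩) :
    IsPreconnected B :=
  (h𝒩.1 B hB).choose_spec.1.isPreconnected

theorem eq_of_mem (h𝒩 : Γ.IsStandardDenseFamily 𝒩) {B B' : Set Γ.Realization} (hB : B ∈ 𝒩)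
    (hB' : B' ∈ 𝒩) {y : Γ.Realization} (hy : y ∈ B) (hy' : y ∈ B') : B = B' :=
  h𝒩.2.1.elim_set hB hB' y hy hy'

theorem exists_notMem_edge (h𝒩 : Γ.IsStandardDenseFamily 𝒩) {B : Set Γ.Realization} (hB : B ∈ 𝒩)
    (e : Γ.E) : ∃ s, Γ.edgePoint e s ∉ B := by
  obtain ⟨x, hx⟩ := h𝒩.1 B hB
  by_contra! h
  exact hx.2.2.2.2 e (range_subset_iff.2 h)

theorem exists_mem_vertex (h𝒩 : Γ.IsStandardDenseFamily 𝒩) (v : Γ.V) :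
    ∃ B ∈ 𝒩, Γ.vertexPoint v ∈ B := by
  obtain ⟨B, hB, hv⟩ := h𝒩.2.2.1 v
  exact ⟨B, hB, mem_of_mem_nhds hv.2.2.1⟩

theorem eq_vertex (h𝒩 : Γ.IsStandardDenseFamily 𝒩) {B : Set Γ.Realization} (hB : B ∈ 𝒩)
    {v w : Γ.V} (hv : Γ.vertexPoint v ∈ B) (hw : Γ.vertexPoint w ∈ B) : v = w := by
  obtain ⟨x, hx⟩ := h𝒩.1 B hB
  have hv' := (hx.2.2.2.1.subset ⟨hv, mem_range_self v⟩).1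
  have hw' := (hx.2.2.2.1.subset ⟨hw, mem_range_self w⟩).1
  exact vertexPoint_injective (hv'.trans hw'.symm)

theorem vertexPoint_notMem_punctured (h𝒩 : Γ.IsStandardDenseFamily 𝒩) (v : Γ.V) :
    Γ.vertexPoint v ∉ Γ.punctured 𝒩 := by
  obtain ⟨B, hB, hv⟩ := h𝒩.2.2.1 v
  exact notMem_punctured.2 ⟨B, hB, mem_interior_iff_mem_nhds.2 hv.2.2.1⟩

theorem pos_of_mem_trace (h𝒩 : Γ.IsStandardDenseFamily 𝒩) {e : Γ.E} {s : unitInterval}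
    (hs : s ∈ Γ.trace 𝒩 e) : 0 < s := by
  refine unitInterval.pos_iff_ne_zero.2 ?_
  rintro rfl
  exact h𝒩.vertexPoint_notMem_punctured (Γ.src e) (edgePoint_zero e ▸ hs)

theorem lt_one_of_mem_trace (h𝒩 : Γ.IsStandardDenseFamily 𝒩) {e : Γ.E} {s : unitInterval}
    (hs : s ∈ Γ.trace 𝒩 e) : s < 1 := by
  refine unitInterval.lt_one_iff_ne_one.2 ?_
  rintro rfl
  exact h𝒩.vertexPoint_notMem_punctured (Γ.tgt e) (edgePoint_one e ▸ hs)

theorem exists_trace (hΓ : Γ.Essential) {y : Γ.Realization}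
    (hy : y ∈ Γ.punctured 𝒩) : ∃ e, ∃ s ∈ Γ.trace 𝒩 e, y = Γ.edgePoint e s := by
  obtain ⟨e, s, rfl⟩ := hΓ.exists_edgePoint y
  exact ⟨e, s, hy, rfl⟩

theorem edgePoint_inj_of_trace (h𝒩 : Γ.IsStandardDenseFamily 𝒩) {e e' : Γ.E} {s s' : unitInterval}
    (hs : s ∈ Γ.trace 𝒩 e) (h : Γ.edgePoint e' s' = Γ.edgePoint e s) : e' = e ∧ s' = s :=
  edgePoint_inj (h𝒩.pos_of_mem_trace hs) (h𝒩.lt_one_of_mem_trace hs) h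

/-- The boundary of a member of the family consists of its points in the punctured graph. -/
theorem frontier_eq (h𝒩 : Γ.IsStandardDenseFamily 𝒩) {B : Set Γ.Realization} (hB : B ∈ 𝒩) :
    frontier B = B ∩ Γ.punctured 𝒩 := by
  rw [(h𝒩.isClosed hB).frontier_eq]
  ext y
  refine and_congr_right fun hy => ⟨fun hyi => ?_, fun hyM hyi => ?_⟩
  · by_contra hyM
    obtain ⟨B', hB', hy'⟩ := notMem_punctured.1 hyM
    exact hyi (h𝒩.eq_of_mem hB hB' hy (interior_subset hy') ▸ hy')
  · exact notMem_punctured.2 ⟨B, hB, hyi⟩ hyM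

/-- A connected set outside the punctured graph lies in a single member of the family, since the
interiors of the members are disjoint open sets. -/
theorem subset_interior (h𝒩 : Γ.IsStandardDenseFamily 𝒩) {S : Set Γ.Realization}
    (hS : IsPreconnected S) (hne : S.Nonempty) (hd : Disjoint S (Γ.punctured 𝒩)) :
    ∃ B ∈ 𝒩, S ⊆ interior B := by
  obtain ⟨y, hy⟩ := hne
  obtain ⟨B, hB, hyB⟩ := notMem_punctured.1 (disjoint_left.1 hd hy)
  refine ⟨B, hB, hS.subset_of_closure_inter_subset isOpen_interior ⟨y, hy, hyB⟩ ?_⟩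
  rintro z ⟨hz, hzS⟩
  have hzB : z ∈ B := closure_minimal interior_subset (h𝒩.isClosed hB) hz
  obtain ⟨B', hB', hzB'⟩ := notMem_punctured.1 (disjoint_left.1 hd hzS)
  exact h𝒩.eq_of_mem hB hB' hzB (interior_subset hzB') ▸ hzB'

theorem subset_interior_of_disjoint_trace (h𝒩 : Γ.IsStandardDenseFamily 𝒩) {e : Γ.E}
    {J : Set unitInterval} (hJ : IsPreconnected J) (hne : J.Nonempty)
    (hd : Disjoint J (Γ.trace 𝒩 e)) : ∃ B ∈ 𝒩, Γ.edgePoint e '' J ⊆ interior B := by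
  refine h𝒩.subset_interior (hJ.image _ (continuous_edgePoint e).continuousOn) (hne.image _) ?_
  rw [disjoint_left]
  rintro _ ⟨s, hs, rfl⟩ hM
  exact disjoint_left.1 hd hs hM

theorem trace_nonempty (h𝒩 : Γ.IsStandardDenseFamily 𝒩) (e : Γ.E) : (Γ.trace 𝒩 e).Nonempty := by
  by_contra h
  rw [not_nonempty_iff_eq_empty] at h
  obtain ⟨B, hB, hsub⟩ := h𝒩.subset_interior_of_disjoint_trace (e := e) isPreconnected_univ
    ⟨0, mem_univ _⟩ (by simp [h])
  obtain ⟨s, hs⟩ := h𝒩.exists_notMem_edge hB e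
  exact hs (interior_subset (hsub ⟨s, mem_univ s, rfl⟩))

theorem exists_isLeast_trace (h𝒩 : Γ.IsStandardDenseFamily 𝒩) (e : Γ.E) :
    ∃ a, IsLeast (Γ.trace 𝒩 e) a :=
  (isClosed_trace e).isCompact.exists_isLeast (h𝒩.trace_nonempty e)

theorem exists_isGreatest_trace (h𝒩 : Γ.IsStandardDenseFamily 𝒩) (e : Γ.E) :
    ∃ b, IsGreatest (Γ.trace 𝒩 e) b :=
  (isClosed_trace e).isCompact.exists_isGreatest (h𝒩.trace_nonempty e)

/-- The part of an edge before the first point of the punctured graph lies in the member of the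
family around the initial vertex. -/
theorem Icc_subset_of_isLeast (h𝒩 : Γ.IsStandardDenseFamily 𝒩) {e : Γ.E} {a : unitInterval}
    (ha : IsLeast (Γ.trace 𝒩 e) a) {B : Set Γ.Realization} (hB : B ∈ 𝒩)
    (hv : Γ.vertexPoint (Γ.src e) ∈ B) {s : unitInterval} (hs : s ≤ a) : Γ.edgePoint e s ∈ B := by
  have h0 := h𝒩.pos_of_mem_trace ha.1
  obtain ⟨B', hB', hsub⟩ := h𝒩.subset_interior_of_disjoint_trace (e := e)
    (isPreconnected_Ico (a := 0) (b := a)) ⟨0, le_rfl, h0⟩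
    (disjoint_left.2 fun r hr hrM => (ha.2 hrM).not_gt hr.2)
  have : B = B' := h𝒩.eq_of_mem hB hB' hv
    (interior_subset (hsub ⟨0, ⟨le_rfl, h0⟩, edgePoint_zero e⟩))
  subst this
  have hcl : IsClosed (Γ.edgePoint e ⁻¹' B) := (h𝒩.isClosed hB).preimage (continuous_edgePoint e)
  have : Icc 0 a ⊆ Γ.edgePoint e ⁻¹' B := by
    rw [← closure_Ico h0.ne]
    exact closure_minimal (fun r hr => interior_subset (s := B) (hsub ⟨r, hr, rfl⟩)) hcl
  exact this ⟨unitInterval.nonneg', hs⟩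

theorem Icc_subset_of_isGreatest (h𝒩 : Γ.IsStandardDenseFamily 𝒩) {e : Γ.E} {b : unitInterval}
    (hb : IsGreatest (Γ.trace 𝒩 e) b) {B : Set Γ.Realization} (hB : B ∈ 𝒩)
    (hv : Γ.vertexPoint (Γ.tgt e) ∈ B) {s : unitInterval} (hs : b ≤ s) : Γ.edgePoint e s ∈ B := by
  have h1 := h𝒩.lt_one_of_mem_trace hb.1
  obtain ⟨B', hB', hsub⟩ := h𝒩.subset_interior_of_disjoint_trace (e := e)
    (isPreconnected_Ioc (a := b) (b := 1)) ⟨1, h1, le_rfl⟩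
    (disjoint_left.2 fun r hr hrM => (hb.2 hrM).not_gt hr.1)
  have : B = B' := h𝒩.eq_of_mem hB hB' hv
    (interior_subset (hsub ⟨1, ⟨h1, le_rfl⟩, edgePoint_one e⟩))
  subst this
  have hcl : IsClosed (Γ.edgePoint e ⁻¹' B) := (h𝒩.isClosed hB).preimage (continuous_edgePoint e)
  have : Icc b 1 ⊆ Γ.edgePoint e ⁻¹' B := by
    rw [← closure_Ioc h1.ne]
    exact closure_minimal (fun r hr => interior_subset (s := B) (hsub ⟨r, hr, rfl⟩)) hcl
  exact this ⟨hs, unitInterval.le_one'⟩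

/-- The trace on an edge is not a single point: otherwise the neighbourhoods of the two endpoints of
the edge would share this point, so they would agree and contain the whole edge. -/
theorem isLeast_lt_isGreatest (h𝒩 : Γ.IsStandardDenseFamily 𝒩) {e : Γ.E} {a b : unitInterval}
    (ha : IsLeast (Γ.trace 𝒩 e) a) (hb : IsGreatest (Γ.trace 𝒩 e) b) : a < b := by
  refine (ha.2 hb.1).lt_of_ne ?_
  rintro rfl
  obtain ⟨B, hB, hv⟩ := h𝒩.exists_mem_vertex (Γ.src e)
  obtain ⟨B', hB', hv'⟩ := h𝒩.exists_mem_vertex (Γ.tgt e)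
  have : B = B' := h𝒩.eq_of_mem hB hB' (h𝒩.Icc_subset_of_isLeast ha hB hv le_rfl)
    (h𝒩.Icc_subset_of_isGreatest hb hB' hv' le_rfl)
  subst this
  obtain ⟨s, hs⟩ := h𝒩.exists_notMem_edge hB e
  rcases le_total s a with h | h
  exacts [hs (h𝒩.Icc_subset_of_isLeast ha hB hv h), hs (h𝒩.Icc_subset_of_isGreatest hb hB hv' h)]

/-- Points of the punctured graph are not interior to members of the family. -/
theorem exists_notMem_Ioo {B : Set Γ.Realization} (hB : B ∈ 𝒩) {e : Γ.E} {a s b : unitInterval}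
    (hs : s ∈ Γ.trace 𝒩 e) (has : a < s) (hsb : s < b) :
    ∃ r ∈ Ioo a b, Γ.edgePoint e r ∉ B := by
  by_contra! h
  exact notMem_punctured.2 ⟨B, hB, mem_interior.2 ⟨_, image_subset_iff.2 h,
    isOpen_image_edgePoint e, mem_image_of_mem _ ⟨has, hsb⟩⟩⟩ hs

/-- Each gap of the trace of the punctured graph on an edge comes from a member of the family. -/
theorem exists_eq_Icc_of_gap (h𝒩 : Γ.IsStandardDenseFamily 𝒩) {e : Γ.E} {c d : unitInterval}
    (hc : c ∈ Γ.trace 𝒩 e) (hd : d ∈ Γ.trace 𝒩 e) (hcd : c < d)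
    (hgap : Disjoint (Ioo c d) (Γ.trace 𝒩 e)) : ∃ B ∈ 𝒩, B = Γ.edgePoint e '' Icc c d := by
  obtain ⟨m, hm⟩ := exists_between hcd
  obtain ⟨B, hB, hsub⟩ := h𝒩.subset_interior_of_disjoint_trace isPreconnected_Ioo ⟨m, hm⟩ hgap
  have hcl : IsClosed (Γ.edgePoint e ⁻¹' B) := (h𝒩.isClosed hB).preimage (continuous_edgePoint e)
  have hIcc : Icc c d ⊆ Γ.edgePoint e ⁻¹' B := by
    rw [← closure_Ioo hcd.ne]
    exact closure_minimal (fun r hr => interior_subset (s := B) (hsub ⟨r, hr, rfl⟩)) hcl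
  refine ⟨B, hB, Subset.antisymm ?_ (image_subset_iff.2 hIcc)⟩
  -- points outside `B` arbitrarily close to the gap confine `B`
  have hleft : ∀ r < c, ∃ r' ∈ Ico r c, Γ.edgePoint e r' ∉ B := by
    intro r hr
    obtain ⟨r', hr', hnot⟩ := exists_notMem_Ioo hB hc hr hcd
    refine ⟨r', ⟨hr'.1.le, not_le.1 fun h => hnot (hIcc ⟨h, hr'.2.le⟩)⟩, hnot⟩
  have hright : ∀ r, d < r → ∃ r' ∈ Ioc d r, Γ.edgePoint e r' ∉ B := by
    intro r hr
    obtain ⟨r', hr', hnot⟩ := exists_notMem_Ioo hB hd hcd hr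
    refine ⟨r', ⟨not_le.1 fun h => hnot (hIcc ⟨hr'.1.le, h⟩), hr'.2.le⟩, hnot⟩
  have hmB : Γ.edgePoint e m ∈ B := hIcc ⟨hm.1.le, hm.2.le⟩
  obtain ⟨l, hl, hlB⟩ := hleft 0 (h𝒩.pos_of_mem_trace hc)
  obtain ⟨u, hu, huB⟩ := hright 1 (h𝒩.lt_one_of_mem_trace hd)
  intro y hy
  obtain ⟨r, hr, rfl⟩ := subset_image_Ioo_of_isPreconnected (h𝒩.isPreconnected hB)
    (hl.2.trans hm.1) (hm.2.trans hu.1) hlB hmB huB hy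
  have hr0 : 0 < r := lt_of_le_of_lt unitInterval.nonneg' hr.1
  have hr1 : r < 1 := lt_of_lt_of_le hr.2 unitInterval.le_one'
  refine mem_image_of_mem _ ⟨not_lt.1 fun h => ?_, not_lt.1 fun h => ?_⟩
  · obtain ⟨l', hl', hlB'⟩ := hleft r h
    obtain ⟨r', hr', hrr'⟩ := subset_image_Ioo_of_isPreconnected (h𝒩.isPreconnected hB)
      (hl'.2.trans hm.1) (hm.2.trans hu.1) hlB' hmB huB hy
    rw [(edgePoint_inj hr0 hr1 hrr').2] at hr'
    exact hl'.1.not_gt hr'.1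
  · obtain ⟨u', hu', huB'⟩ := hright r h
    obtain ⟨r', hr', hrr'⟩ := subset_image_Ioo_of_isPreconnected (h𝒩.isPreconnected hB)
      (hl.2.trans hm.1) (hm.2.trans hu'.1) hlB hmB huB' hy
    rw [(edgePoint_inj hr0 hr1 hrr').2] at hr'
    exact hu'.2.not_gt hr'.2

/-- A member of the family which contains no vertex is an interval filling a gap of the trace on an
edge. -/
theorem exists_gap_or_vertex (h𝒩 : Γ.IsStandardDenseFamily 𝒩) (hΓ : Γ.Essential)
    {B : Set Γ.Realization} (hB : B ∈ 𝒩) :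
    (∃ v, Γ.vertexPoint v ∈ B) ∨ ∃ e, ∃ c ∈ Γ.trace 𝒩 e, ∃ d ∈ Γ.trace 𝒩 e, c < d ∧
      Disjoint (Ioo c d) (Γ.trace 𝒩 e) ∧ B = Γ.edgePoint e '' Icc c d := by
  by_cases hv : ∃ v, Γ.vertexPoint v ∈ B
  · exact Or.inl hv
  right
  push Not at hv
  obtain ⟨x, hx⟩ := h𝒩.1 B hB
  have hxB : x ∈ interior B := mem_interior_iff_mem_nhds.2 hx.2.2.1
  obtain ⟨e, s, rfl⟩ := hΓ.exists_edgePoint x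
  have hs : s ∉ Γ.trace 𝒩 e := fun h => notMem_punctured.2 ⟨B, hB, hxB⟩ h
  obtain ⟨a, ha⟩ := h𝒩.exists_isLeast_trace e
  obtain ⟨b, hb⟩ := h𝒩.exists_isGreatest_trace e
  have has : a < s := by
    by_contra h
    obtain ⟨B', hB', hv'⟩ := h𝒩.exists_mem_vertex (Γ.src e)
    have := h𝒩.eq_of_mem hB hB' (interior_subset hxB)
      (h𝒩.Icc_subset_of_isLeast ha hB' hv' (not_lt.1 h))
    exact hv _ (this ▸ hv')
  have hsb : s < b := by
    by_contra h
    obtain ⟨B', hB', hv'⟩ := h𝒩.exists_mem_vertex (Γ.tgt e)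
    have := h𝒩.eq_of_mem hB hB' (interior_subset hxB)
      (h𝒩.Icc_subset_of_isGreatest hb hB' hv' (not_lt.1 h))
    exact hv _ (this ▸ hv')
  obtain ⟨c, hc, hcmax⟩ := (isClosed_Iic.inter (isClosed_trace (𝒩 := 𝒩) e) :
    IsClosed (Iic s ∩ _)).isCompact.exists_isGreatest ⟨a, has.le, ha.1⟩
  obtain ⟨d, hd, hdmin⟩ := (isClosed_Ici.inter (isClosed_trace (𝒩 := 𝒩) e) :
    IsClosed (Ici s ∩ _)).isCompact.exists_isLeast ⟨b, hsb.le, hb.1⟩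
  have hcs : c < s := lt_of_le_of_ne hc.1 fun h => hs (h ▸ hc.2)
  have hsd : s < d := lt_of_le_of_ne hd.1 fun h => hs (h ▸ hd.2)
  have hgap : Disjoint (Ioo c d) (Γ.trace 𝒩 e) := by
    rw [disjoint_left]
    intro r hr hrM
    rcases le_total r s with h | h
    exacts [(hcmax ⟨h, hrM⟩).not_gt hr.1, (hdmin ⟨h, hrM⟩).not_gt hr.2]
  obtain ⟨B', hB', hBe⟩ := h𝒩.exists_eq_Icc_of_gap hc.2 hd.2 (hcs.trans hsd) hgap
  refine ⟨e, c, hc.2, d, hd.2, hcs.trans hsd, hgap, ?_⟩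
  rw [← hBe]
  exact h𝒩.eq_of_mem hB hB' (interior_subset hxB) (hBe ▸ mem_image_of_mem _ ⟨hcs.le, hsd.le⟩)

theorem vertexPoint_notMem_Icc (h𝒩 : Γ.IsStandardDenseFamily 𝒩) {e : Γ.E} {c d : unitInterval}
    (hc : c ∈ Γ.trace 𝒩 e) (hd : d ∈ Γ.trace 𝒩 e) (v : Γ.V) :
    Γ.vertexPoint v ∉ Γ.edgePoint e '' Icc c d := by
  rintro ⟨r, hr, hrv⟩
  exact vertexPoint_ne_edgePoint ((h𝒩.pos_of_mem_trace hc).trans_le hr.1)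
    (hr.2.trans_lt (h𝒩.lt_one_of_mem_trace hd)) hrv.symm

/-- A member of the family around a vertex meets the trace on an edge only in the two extreme
points. -/
theorem eq_end_of_mem_vertex (h𝒩 : Γ.IsStandardDenseFamily 𝒩) {B : Set Γ.Realization} (hB : B ∈ 𝒩)
    {v : Γ.V} (hv : Γ.vertexPoint v ∈ B) {e : Γ.E} {s : unitInterval} (hs : s ∈ Γ.trace 𝒩 e)
    (hsB : Γ.edgePoint e s ∈ B) :
    IsLeast (Γ.trace 𝒩 e) s ∨ IsGreatest (Γ.trace 𝒩 e) s := by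
  obtain ⟨a, ha⟩ := h𝒩.exists_isLeast_trace e
  obtain ⟨b, hb⟩ := h𝒩.exists_isGreatest_trace e
  by_contra! h
  have has : a < s := (ha.2 hs).lt_of_ne fun h' => h.1 (h' ▸ ha)
  have hsb : s < b := (hb.2 hs).lt_of_ne fun h' => h.2 (h' ▸ hb)
  obtain ⟨A, hA, hvA⟩ := h𝒩.exists_mem_vertex (Γ.src e)
  obtain ⟨D, hD, hvD⟩ := h𝒩.exists_mem_vertex (Γ.tgt e)
  have hl : ∃ l < s, Γ.edgePoint e l ∉ B := by
    by_contra! hl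
    obtain ⟨r, hr, hrB⟩ := exists_notMem_Ioo hB ha.1 (h𝒩.pos_of_mem_trace ha.1) has
    exact hrB (hl r hr.2)
  have hu : ∃ u, s < u ∧ Γ.edgePoint e u ∉ B := by
    by_contra! hu
    obtain ⟨r, hr, hrB⟩ := exists_notMem_Ioo hB hb.1 hsb (h𝒩.lt_one_of_mem_trace hb.1)
    exact hrB (hu r hr.1)
  obtain ⟨l, hls, hl⟩ := hl
  obtain ⟨u, hsu, hu⟩ := hu
  obtain ⟨r, hr, hrv⟩ :=
    subset_image_Ioo_of_isPreconnected (h𝒩.isPreconnected hB) hls hsu hl hsB hu hv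
  exact vertexPoint_ne_edgePoint (lt_of_le_of_lt unitInterval.nonneg' hr.1)
    (lt_of_lt_of_le hr.2 unitInterval.le_one') hrv.symm

/-! ### Gaps and boundaries -/

/-- The trace of the punctured graph on an edge has empty interior. -/
theorem exists_notMem_trace (h𝒩 : Γ.IsStandardDenseFamily 𝒩) (hΓ : Γ.Essential) (e : Γ.E)
    {a b : unitInterval} (hab : a < b) : ∃ m ∈ Ioo a b, m ∉ Γ.trace 𝒩 e := by
  by_contra! h
  obtain ⟨m, hm⟩ := exists_between hab
  obtain ⟨_, ⟨r, hr, rfl⟩, B, hB, hrB⟩ := h𝒩.2.2.2.inter_open_nonempty _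
    (isOpen_image_edgePoint e (a := a) (b := b)) ⟨_, m, hm, rfl⟩
  have hrM := h r hr
  rcases h𝒩.exists_gap_or_vertex hΓ hB with ⟨v, hv⟩ | ⟨e', c, hc, d, hd, hcd, hgap, rfl⟩
  · rcases h𝒩.eq_end_of_mem_vertex hB hv hrM hrB with hr' | hr'
    · obtain ⟨m, hm⟩ := exists_between hr.1
      exact (hr'.2 (h m ⟨hm.1, hm.2.trans hr.2⟩)).not_gt hm.2
    · obtain ⟨m, hm⟩ := exists_between hr.2
      exact (hr'.2 (h m ⟨hr.1.trans hm.1, hm.2⟩)).not_gt hm.1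
  · obtain ⟨r', hr', hrr'⟩ := hrB
    obtain ⟨rfl, rfl⟩ := h𝒩.edgePoint_inj_of_trace hrM hrr'
    rcases hr'.2.lt_or_eq with hlt | rfl
    · obtain ⟨m, hm⟩ := exists_between (lt_min hlt hr.2)
      exact disjoint_left.1 hgap ⟨hr'.1.trans_lt hm.1, hm.2.trans_le (min_le_left _ _)⟩
        (h m ⟨hr.1.trans hm.1, hm.2.trans_le (min_le_right _ _)⟩)
    · obtain ⟨m, hm⟩ := exists_between (max_lt hcd hr.1)
      exact disjoint_left.1 hgap ⟨(le_max_left _ _).trans_lt hm.1, hm.2⟩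
        (h m ⟨(le_max_right _ _).trans_lt hm.1, hm.2.trans hr.2⟩)

/-- Points of the trace have small intervals around them whose ends lie outside the trace. -/
theorem exists_Ioo_subset (h𝒩 : Γ.IsStandardDenseFamily 𝒩) (hΓ : Γ.Essential) {e : Γ.E}
    {s : unitInterval} (hs : s ∈ Γ.trace 𝒩 e) {V : Set Γ.Realization}
    (hV : V ∈ 𝓝 (Γ.edgePoint e s)) : ∃ l u, l ∉ Γ.trace 𝒩 e ∧ u ∉ Γ.trace 𝒩 e ∧ l < s ∧ s < u ∧
      Γ.edgePoint e '' Ioo l u ⊆ V := by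
  have hV' : Γ.edgePoint e ⁻¹' V ∈ 𝓝 s := (continuous_edgePoint e).continuousAt hV
  obtain ⟨l, u, hlu, hsub⟩ := (mem_nhds_iff_exists_Ioo_subset' ⟨0, h𝒩.pos_of_mem_trace hs⟩
    ⟨1, h𝒩.lt_one_of_mem_trace hs⟩).1 hV'
  obtain ⟨l', hl', hlM⟩ := h𝒩.exists_notMem_trace hΓ e hlu.1
  obtain ⟨u', hu', huM⟩ := h𝒩.exists_notMem_trace hΓ e hlu.2
  refine ⟨l', u', hlM, huM, hl'.2, hu'.1, ?_⟩
  rintro _ ⟨r, hr, rfl⟩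
  exact hsub ⟨hl'.1.trans hr.1, hr.2.trans hu'.2⟩

/-- The punctured graph has no isolated points, since the members of the family are disjoint. -/
theorem exists_ne_mem_nhds (h𝒩 : Γ.IsStandardDenseFamily 𝒩) (hΓ : Γ.Essential) {e : Γ.E}
    {s : unitInterval} (hs : s ∈ Γ.trace 𝒩 e) {V : Set Γ.Realization}
    (hV : V ∈ 𝓝 (Γ.edgePoint e s)) : ∃ s' ∈ Γ.trace 𝒩 e, s' ≠ s ∧ Γ.edgePoint e s' ∈ V := by
  obtain ⟨l, u, hl, hu, hls, hsu, hsub⟩ := h𝒩.exists_Ioo_subset hΓ hs hV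
  by_contra! h
  have hiso : ∀ r ∈ Γ.trace 𝒩 e, r ≠ s → r ∉ Ioo l u := fun r hr hne hrI =>
    h r hr hne (hsub (mem_image_of_mem _ hrI))
  obtain ⟨a, ha⟩ := h𝒩.exists_isLeast_trace e
  obtain ⟨b, hb⟩ := h𝒩.exists_isGreatest_trace e
  have hleft : a ≠ s → ∃ c ∈ Γ.trace 𝒩 e, c < s ∧ ∃ B ∈ 𝒩, B = Γ.edgePoint e '' Icc c s := by
    intro hne
    have hal : a ≤ l := by
      by_contra hal
      exact hiso a ha.1 hne ⟨not_le.1 hal, (ha.2 hs).trans_lt hsu⟩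
    obtain ⟨c, hc, hcmax⟩ := (isClosed_Iic.inter (isClosed_trace (𝒩 := 𝒩) e) :
      IsClosed (Iic l ∩ _)).isCompact.exists_isGreatest ⟨a, hal, ha.1⟩
    have hcs := lt_of_le_of_lt hc.1 hls
    refine ⟨c, hc.2, hcs, h𝒩.exists_eq_Icc_of_gap hc.2 hs hcs (disjoint_left.2 fun r hr hrM => ?_)⟩
    rcases le_or_gt r l with h' | h'
    exacts [(hcmax ⟨h', hrM⟩).not_gt hr.1, hiso r hrM hr.2.ne ⟨h', hr.2.trans hsu⟩]
  have hright : b ≠ s → ∃ d ∈ Γ.trace 𝒩 e, s < d ∧ ∃ B ∈ 𝒩, B = Γ.edgePoint e '' Icc s d := by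
    intro hne
    have hal : u ≤ b := by
      by_contra hal
      exact hiso b hb.1 hne ⟨hls.trans_le (hb.2 hs), not_le.1 hal⟩
    obtain ⟨d, hd, hdmin⟩ := (isClosed_Ici.inter (isClosed_trace (𝒩 := 𝒩) e) :
      IsClosed (Ici u ∩ _)).isCompact.exists_isLeast ⟨b, hal, hb.1⟩
    have hsd := lt_of_lt_of_le hsu hd.1
    refine ⟨d, hd.2, hsd, h𝒩.exists_eq_Icc_of_gap hs hd.2 hsd (disjoint_left.2 fun r hr hrM => ?_)⟩
    rcases le_or_gt u r with h' | h'
    exacts [(hdmin ⟨h', hrM⟩).not_gt hr.2, hiso r hrM hr.1.ne' ⟨hls.trans hr.1, h'⟩]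
  have hab := h𝒩.isLeast_lt_isGreatest ha hb
  by_cases has : a = s
  · obtain ⟨d, hd, hsd, B, hB, hBe⟩ := hright fun h => hab.ne (has.trans h.symm)
    obtain ⟨A, hA, hv⟩ := h𝒩.exists_mem_vertex (Γ.src e)
    have hAB : A = B := h𝒩.eq_of_mem hA hB (h𝒩.Icc_subset_of_isLeast ha hA hv has.ge)
      (hBe ▸ mem_image_of_mem _ ⟨le_rfl, hsd.le⟩)
    rw [hAB, hBe] at hv
    exact h𝒩.vertexPoint_notMem_Icc hs hd _ hv
  · obtain ⟨c, hc, hcs, B, hB, hBe⟩ := hleft has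
    have hsB : Γ.edgePoint e s ∈ B := hBe ▸ mem_image_of_mem _ ⟨hcs.le, le_rfl⟩
    by_cases hbs : b = s
    · obtain ⟨A, hA, hv⟩ := h𝒩.exists_mem_vertex (Γ.tgt e)
      have hAB : A = B := h𝒩.eq_of_mem hA hB (h𝒩.Icc_subset_of_isGreatest hb hA hv hbs.le) hsB
      rw [hAB, hBe] at hv
      exact h𝒩.vertexPoint_notMem_Icc hc hs _ hv
    · obtain ⟨d, hd, hsd, B', hB', hBe'⟩ := hright hbs
      have hBB : B = B' := h𝒩.eq_of_mem hB hB' hsB (hBe' ▸ mem_image_of_mem _ ⟨le_rfl, hsd.le⟩)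
      have hcB : Γ.edgePoint e c ∈ B := hBe ▸ mem_image_of_mem _ ⟨le_rfl, hcs.le⟩
      rw [hBB, hBe'] at hcB
      obtain ⟨r, hr, hrc⟩ := hcB
      rw [(h𝒩.edgePoint_inj_of_trace hc hrc).2] at hr
      exact hr.1.not_gt hcs

/-- The part of the punctured graph in an interval of an edge cannot be divided by a continuous
two-valued function which is constant on the boundaries of the members of the family contained in
the interval. -/
theorem constOn_trace (h𝒩 : Γ.IsStandardDenseFamily 𝒩) {e : Γ.E} {J : Set unitInterval}
    (hJ : J.OrdConnected) {f : Γ.Realization → Bool}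
    (hf : ContinuousOn f (Γ.edgePoint e '' (J ∩ Γ.trace 𝒩 e)))
    (hconst : ∀ B ∈ 𝒩, ∀ c ∈ J, ∀ d ∈ J, B = Γ.edgePoint e '' Icc c d →
      ConstOn f (B ∩ Γ.punctured 𝒩)) : ConstOn f (Γ.edgePoint e '' (J ∩ Γ.trace 𝒩 e)) := by
  have := constOn_of_gaps (isClosed_trace (𝒩 := 𝒩) e) hJ (f := f ∘ Γ.edgePoint e)
    (hf.comp (continuous_edgePoint e).continuousOn fun s hs => mem_image_of_mem _ hs) ?_
  · rintro _ ⟨s, hs, rfl⟩ _ ⟨r, hr, rfl⟩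
    exact this s hs r hr
  · intro c hc d hd hcd hgap
    obtain ⟨B, hB, hBe⟩ := h𝒩.exists_eq_Icc_of_gap hc.2 hd.2 hcd hgap
    refine hconst B hB c hc.1 d hd.1 hBe _ ⟨?_, hc.2⟩ _ ⟨?_, hd.2⟩
    · exact hBe ▸ mem_image_of_mem _ ⟨le_rfl, hcd.le⟩
    · exact hBe ▸ mem_image_of_mem _ ⟨hcd.le, le_rfl⟩

/-- The boundary of a member of the family is finite: it consists of the two ends of a gap, or of
the extreme points of the traces on some edges. -/
theorem finite_inter_punctured (h𝒩 : Γ.IsStandardDenseFamily 𝒩) (hΓ : Γ.Essential)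
    {B : Set Γ.Realization} (hB : B ∈ 𝒩) : (B ∩ Γ.punctured 𝒩).Finite := by
  have := Γ.finiteE
  rcases h𝒩.exists_gap_or_vertex hΓ hB with ⟨v, hv⟩ | ⟨e, c, hc, d, hd, hcd, hgap, rfl⟩
  · choose a ha using h𝒩.exists_isLeast_trace
    choose b hb using h𝒩.exists_isGreatest_trace
    refine ((finite_range fun e => Γ.edgePoint e (a e)).union
      (finite_range fun e => Γ.edgePoint e (b e))).subset ?_
    rintro y ⟨hyB, hyM⟩
    obtain ⟨e, s, hs, rfl⟩ := exists_trace hΓ hyM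
    rcases h𝒩.eq_end_of_mem_vertex hB hv hs hyB with h | h
    · exact Or.inl ⟨e, by rw [h.unique (ha e)]⟩
    · exact Or.inr ⟨e, by rw [h.unique (hb e)]⟩
  · refine (toFinite {Γ.edgePoint e c, Γ.edgePoint e d}).subset ?_
    rintro _ ⟨⟨r, hr, rfl⟩, hrM⟩
    rcases hr.1.eq_or_lt with rfl | h1
    · exact Or.inl rfl
    rcases hr.2.eq_or_lt with rfl | h2
    · exact Or.inr rfl
    exact absurd hrM (disjoint_left.1 hgap ⟨h1, h2⟩)

theorem exists_trace_of_src (h𝒩 : Γ.IsStandardDenseFamily 𝒩) (e : Γ.E) {B : Set Γ.Realization}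
    (hB : B ∈ 𝒩) (hv : Γ.vertexPoint (Γ.src e) ∈ B) :
    ∃ a, IsLeast (Γ.trace 𝒩 e) a ∧ Γ.edgePoint e a ∈ B ∩ Γ.punctured 𝒩 := by
  obtain ⟨a, ha⟩ := h𝒩.exists_isLeast_trace e
  exact ⟨a, ha, h𝒩.Icc_subset_of_isLeast ha hB hv le_rfl, ha.1⟩

theorem exists_trace_of_tgt (h𝒩 : Γ.IsStandardDenseFamily 𝒩) (e : Γ.E) {B : Set Γ.Realization}
    (hB : B ∈ 𝒩) (hv : Γ.vertexPoint (Γ.tgt e) ∈ B) :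
    ∃ b, IsGreatest (Γ.trace 𝒩 e) b ∧ Γ.edgePoint e b ∈ B ∩ Γ.punctured 𝒩 := by
  obtain ⟨b, hb⟩ := h𝒩.exists_isGreatest_trace e
  exact ⟨b, hb, h𝒩.Icc_subset_of_isGreatest hb hB hv le_rfl, hb.1⟩

/-- Each endpoint of an edge is separated from the rest of the edge by a point of the trace. -/
theorem exists_trace_of_end (h𝒩 : Γ.IsStandardDenseFamily 𝒩) {e : Γ.E} {s : unitInterval} {v : Γ.V}
    (hs : Γ.edgePoint e s = Γ.vertexPoint v) {B : Set Γ.Realization}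
    (hB : B ∈ 𝒩) (hv : Γ.vertexPoint v ∈ B) :
    ∃ r ∈ Γ.trace 𝒩 e, Γ.edgePoint e r ∈ B ∧
      (s = 0 ∧ IsLeast (Γ.trace 𝒩 e) r ∨ s = 1 ∧ IsGreatest (Γ.trace 𝒩 e) r) := by
  rcases eq_zero_or_eq_one_or s with rfl | rfl | ⟨h0, h1⟩
  · rw [edgePoint_zero] at hs
    obtain ⟨a, ha, haB⟩ := h𝒩.exists_trace_of_src e hB (hs ▸ hv)
    exact ⟨a, ha.1, haB.1, Or.inl ⟨rfl, ha⟩⟩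
  · rw [edgePoint_one] at hs
    obtain ⟨a, ha, haB⟩ := h𝒩.exists_trace_of_tgt e hB (hs ▸ hv)
    exact ⟨a, ha.1, haB.1, Or.inr ⟨rfl, ha⟩⟩
  · exact absurd hs.symm (vertexPoint_ne_edgePoint h0 h1)

/-- If the only incidence of a vertex is with one end of one edge, then the midpoint of this edge is
a cutpoint. -/
theorem exists_second_incidence (hΓ : Γ.Essential) (h2 : Γ.TwoConnected) {e : Γ.E}
    {s : unitInterval} {v : Γ.V} (hs : Γ.edgePoint e s = Γ.vertexPoint v) :
    ∃ e' s', Γ.edgePoint e' s' = Γ.vertexPoint v ∧ (e' ≠ e ∨ s' ≠ s) := by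
  have := Γ.finiteE
  by_contra! h
  have hs01 : s = 0 ∨ s = 1 := by
    rcases eq_zero_or_eq_one_or s with h | h | ⟨h0, h1⟩
    · exact Or.inl h
    · exact Or.inr h
    · exact absurd hs.symm (vertexPoint_ne_edgePoint h0 h1)
  obtain ⟨m, hm0, hm1⟩ := exists_between (zero_lt_one (α := unitInterval))
  -- the two halves of the edge: the first one contains the vertex
  obtain ⟨C, D, hC, hD, hCD, hint, hsC, hsD⟩ : ∃ C D : Set unitInterval, IsClosed C ∧ IsClosed D ∧
      (∀ r, r ∈ C ∨ r ∈ D) ∧ (∀ r ∈ C, (r ∈ D ∨ r = 0 ∨ r = 1) → r = m ∨ r = s) ∧ s ∈ C ∧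
      s ∉ D ∧ ∃ r ∈ D, r ≠ m := by
    rcases hs01 with rfl | rfl
    · refine ⟨Iic m, Ici m, isClosed_Iic, isClosed_Ici, fun r => le_total r m, ?_, hm0.le,
        hm0.not_ge, 1, hm1.le, hm1.ne'⟩
      rintro r hr (h | h | h)
      · exact Or.inl (le_antisymm hr h)
      · exact Or.inr h
      · exact absurd (h ▸ hr : (1 : unitInterval) ≤ m) hm1.not_ge
    · refine ⟨Ici m, Iic m, isClosed_Ici, isClosed_Iic, fun r => le_total m r, ?_, hm1.le,
        hm1.not_ge, 0, hm0.le, hm0.ne⟩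
      rintro r hr (h | h | h)
      · exact Or.inl (le_antisymm h hr)
      · exact absurd (h ▸ hr : m ≤ 0) hm0.not_ge
      · exact Or.inr h
  obtain ⟨hsD, r₀, hr₀, hr₀m⟩ := hsD
  have hp : IsPreconnected ({Γ.edgePoint e m}ᶜ : Set Γ.Realization) := not_not.1 (h2.2.2 _)
  have hcl : IsClosed ((Γ.edgePoint e '' D) ∪ ⋃ e' : {e' // e' ≠ e}, Γ.edgePoint e' '' univ) :=
    (isClosed_image_edgePoint e hD).union
      (isClosed_iUnion_of_finite fun e' => isClosed_image_edgePoint _ isClosed_univ)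
  have hne : ∀ r, r ≠ m → Γ.edgePoint e r ≠ Γ.edgePoint e m := fun r hr h' =>
    hr (edgePoint_inj hm0 hm1 h').2
  obtain ⟨z, hz, ⟨r, hr, rfl⟩, hz2⟩ := isPreconnected_closed_iff.1 hp _ _
    (isClosed_image_edgePoint e hC) hcl
    (fun w _ => by
      obtain ⟨e', r, rfl⟩ := hΓ.exists_edgePoint w
      by_cases he : e' = e
      · subst he
        rcases hCD r with h | h
        exacts [Or.inl ⟨r, h, rfl⟩, Or.inr (Or.inl ⟨r, h, rfl⟩)]
      · exact Or.inr (Or.inr (mem_iUnion.2 ⟨⟨e', he⟩, r, trivial, rfl⟩)))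
    ⟨Γ.edgePoint e s, hne s (by rcases hs01 with rfl | rfl <;> [exact hm0.ne; exact hm1.ne']),
      s, hsC, rfl⟩
    ⟨Γ.edgePoint e r₀, hne r₀ hr₀m, Or.inl ⟨r₀, hr₀, rfl⟩⟩
  have hrm : r ≠ m := fun h' => hz (h' ▸ rfl)
  -- any second representation of a point of the first half is one of the vertex
  have hkey : ∀ e' r', Γ.edgePoint e' r' = Γ.edgePoint e r → (e' = e → r' ∈ D) → False := by
    intro e' r' hr' hD'
    have hrs : r = s := by
      rcases eq_zero_or_eq_one_or r with h0 | h0 | ⟨h0, h1⟩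
      · exact (hint r hr (Or.inr (Or.inl h0))).resolve_left hrm
      · exact (hint r hr (Or.inr (Or.inr h0))).resolve_left hrm
      · obtain ⟨he, rfl⟩ := edgePoint_inj h0 h1 hr'
        exact (hint r' hr (Or.inl (hD' he))).resolve_left hrm
    subst hrs
    obtain ⟨he, hr⟩ := h e' r' (hr'.trans hs)
    exact hsD (hr ▸ hD' he)
  rcases hz2 with ⟨r', hr', h'⟩ | hz2
  · exact hkey e r' h' fun _ => hr'
  · obtain ⟨⟨e', he'⟩, r', -, h'⟩ := mem_iUnion.1 hz2
    exact hkey e' r' h' fun h => absurd h he'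

/-- The boundary of a member of the family has two points: around a vertex, one for each of the at
least two incidences of the vertex with ends of edges. -/
theorem nontrivial_inter_punctured (h𝒩 : Γ.IsStandardDenseFamily 𝒩) (hΓ : Γ.Essential)
    (h2 : Γ.TwoConnected) {B : Set Γ.Realization} (hB : B ∈ 𝒩) :
    (B ∩ Γ.punctured 𝒩).Nontrivial := by
  rcases h𝒩.exists_gap_or_vertex hΓ hB with ⟨v, hv⟩ | ⟨e, c, hc, d, hd, hcd, hgap, rfl⟩
  · obtain ⟨e, s, hs⟩ := hΓ.exists_edgePoint (Γ.vertexPoint v)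
    obtain ⟨e', s', hs', hne⟩ := exists_second_incidence hΓ h2 hs.symm
    obtain ⟨r, hr, hrB, hrs⟩ := h𝒩.exists_trace_of_end hs.symm hB hv
    obtain ⟨r', hr', hrB', hrs'⟩ := h𝒩.exists_trace_of_end hs' hB hv
    refine ⟨_, ⟨hrB, hr⟩, _, ⟨hrB', hr'⟩, fun h => ?_⟩
    obtain ⟨rfl, rfl⟩ := h𝒩.edgePoint_inj_of_trace hr' h
    have hlt : ∀ a b, IsLeast (Γ.trace 𝒩 e) a → IsGreatest (Γ.trace 𝒩 e) b → a ≠ b :=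
      fun a b ha hb => (h𝒩.isLeast_lt_isGreatest ha hb).ne
    rcases hrs with ⟨h1, h1'⟩ | ⟨h1, h1'⟩ <;> rcases hrs' with ⟨h3, h3'⟩ | ⟨h3, h3'⟩
    · exact hne.elim (· rfl) (· (h3.trans h1.symm))
    · exact hlt _ _ h1' h3' rfl
    · exact hlt _ _ h3' h1' rfl
    · exact hne.elim (· rfl) (· (h3.trans h1.symm))
  · refine ⟨_, ⟨mem_image_of_mem _ ⟨le_rfl, hcd.le⟩, hc⟩, _, ⟨mem_image_of_mem _ ⟨hcd.le, le_rfl⟩,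
      hd⟩, fun h => ?_⟩
    exact hcd.ne (h𝒩.edgePoint_inj_of_trace hd h).2

end IsStandardDenseFamily

theorem edgePoint_eq_vertexPoint_or (e : Γ.E) (s : unitInterval) :
    (∃ w, Γ.edgePoint e s = Γ.vertexPoint w) ∨ (0 < s ∧ s < 1) := by
  rcases eq_zero_or_eq_one_or s with rfl | rfl | h
  exacts [Or.inl ⟨_, edgePoint_zero e⟩, Or.inl ⟨_, edgePoint_one e⟩, Or.inr h]

namespace IsStandardDenseFamily

/-! ### Connectedness properties of the punctured graph -/

/-- Removing the neighbourhood of a vertex `v` does not disconnect the punctured graph: the function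
takes one value on each edge, and edges with a common endpoint other than `v` have the same value;
so two values would divide the complement of `v`. -/
theorem constOn_diff_vertex (h𝒩 : Γ.IsStandardDenseFamily 𝒩) (hΓ : Γ.Essential)
    (h2 : Γ.TwoConnected) {B₀ : Set Γ.Realization} (hB₀ : B₀ ∈ 𝒩) {v : Γ.V}
    (hv : Γ.vertexPoint v ∈ B₀) {f : Γ.Realization → Bool}
    (hf : ContinuousOn f (Γ.punctured 𝒩 \ B₀))
    (hconst : ∀ B ∈ 𝒩, B ≠ B₀ → ConstOn f (B ∩ Γ.punctured 𝒩)) :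
    ConstOn f (Γ.punctured 𝒩 \ B₀) := by
  have := Γ.finiteE
  have hJ : ∀ e, {s | Γ.edgePoint e s ∉ B₀}.OrdConnected := fun e => by
    refine ⟨fun a ha b hb s hs hsB => ?_⟩
    have has : a < s := hs.1.lt_of_ne fun h => ha (h ▸ hsB)
    have hsb : s < b := hs.2.lt_of_ne fun h => hb (h ▸ hsB)
    obtain ⟨r, hr, hrv⟩ :=
      subset_image_Ioo_of_isPreconnected (h𝒩.isPreconnected hB₀) has hsb ha hsB hb hv
    exact vertexPoint_ne_edgePoint (lt_of_le_of_lt unitInterval.nonneg' hr.1)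
      (lt_of_lt_of_le hr.2 unitInterval.le_one') hrv.symm
  have hedge : ∀ e, ConstOn f (Γ.edgePoint e '' ({s | Γ.edgePoint e s ∉ B₀} ∩ Γ.trace 𝒩 e)) := by
    refine fun e => h𝒩.constOn_trace (hJ e) (hf.mono ?_) fun B hB c hc d hd hBe =>
      hconst B hB ?_
    · rintro _ ⟨s, hs, rfl⟩
      exact ⟨hs.2, hs.1⟩
    · rintro rfl
      rw [hBe] at hv
      obtain ⟨r, hr, -⟩ := hv
      exact hc (hBe ▸ mem_image_of_mem _ ⟨le_rfl, hr.1.trans hr.2⟩)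
  have hex : ∀ e, ∃ r, r ∈ Γ.trace 𝒩 e ∧ Γ.edgePoint e r ∉ B₀ := by
    intro e
    by_contra! h
    obtain ⟨a, ha⟩ := h𝒩.exists_isLeast_trace e
    obtain ⟨b, hb⟩ := h𝒩.exists_isGreatest_trace e
    have hab := h𝒩.isLeast_lt_isGreatest ha hb
    obtain ⟨B, hB, hBe⟩ := h𝒩.exists_eq_Icc_of_gap ha.1 hb.1 hab (disjoint_left.2 fun r hr hrM => by
      rcases h𝒩.eq_end_of_mem_vertex hB₀ hv hrM (h r hrM) with h' | h'
      exacts [(h'.2 ha.1).not_gt hr.1, (h'.2 hb.1).not_gt hr.2])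
    have hBB : B₀ = B := h𝒩.eq_of_mem hB₀ hB (h a ha.1) (hBe ▸ mem_image_of_mem _ ⟨le_rfl, hab.le⟩)
    rw [hBB, hBe] at hv
    exact h𝒩.vertexPoint_notMem_Icc ha.1 hb.1 v hv
  choose r hr hrB using hex
  have key : ∀ e e', f (Γ.edgePoint e (r e)) = f (Γ.edgePoint e' (r e')) := by
    refine eq_of_closed_cover (p := Γ.vertexPoint v) (not_not.1 (h2.2.2 _))
      (C := fun e => Γ.edgePoint e '' univ) (fun e => isClosed_image_edgePoint e isClosed_univ)
      (fun x => ?_) (fun e => ⟨_, mem_image_of_mem _ (mem_univ (r e)), fun h => hrB e (h ▸ hv)⟩)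
      (F := fun e => f (Γ.edgePoint e (r e))) ?_
    · obtain ⟨e, s, rfl⟩ := hΓ.exists_edgePoint x
      exact ⟨e, mem_image_of_mem _ (mem_univ s)⟩
    · rintro e e' x hx ⟨s, -, rfl⟩ ⟨s', -, hss⟩
      rcases edgePoint_eq_vertexPoint_or e s with ⟨w, hw⟩ | ⟨h0, h1⟩
      · obtain ⟨B, hB, hwB⟩ := h𝒩.exists_mem_vertex w
        have hne : B ≠ B₀ := fun h => hx (hw.trans (by rw [h𝒩.eq_vertex hB hwB (h ▸ hv)]))
        have hout : ∀ y ∈ B, y ∉ B₀ := fun y hy hy' => hne (h𝒩.eq_of_mem hB hB₀ hy hy')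
        obtain ⟨t, ht, htB, -⟩ := h𝒩.exists_trace_of_end hw hB hwB
        obtain ⟨t', ht', htB', -⟩ := h𝒩.exists_trace_of_end (hss.trans hw) hB hwB
        have e1 := hedge e _ ⟨r e, ⟨hrB e, hr e⟩, rfl⟩ _ ⟨t, ⟨hout _ htB, ht⟩, rfl⟩
        have e2 := hedge e' _ ⟨r e', ⟨hrB e', hr e'⟩, rfl⟩ _ ⟨t', ⟨hout _ htB', ht'⟩, rfl⟩
        exact e1.trans ((hconst B hB hne _ ⟨htB, ht⟩ _ ⟨htB', ht'⟩).trans e2.symm)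
      · rw [(edgePoint_inj h0 h1 hss).1]
  rintro x ⟨hxM, hxB⟩ y ⟨hyM, hyB⟩
  obtain ⟨e, s, hs, rfl⟩ := exists_trace hΓ hxM
  obtain ⟨e', s', hs', rfl⟩ := exists_trace hΓ hyM
  rw [hedge e _ ⟨s, ⟨hxB, hs⟩, rfl⟩ _ ⟨r e, ⟨hrB e, hr e⟩, rfl⟩, key e e',
    hedge e' _ ⟨s', ⟨hyB, hs'⟩, rfl⟩ _ ⟨r e', ⟨hrB e', hr e'⟩, rfl⟩]

/-- Removing a gap with its two ends, or a single point that belongs to no member of the family (the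
case `c = d`), does not disconnect the punctured graph. The edge `e₀` contributes two arcs to the
complement of the point `c`, each other edge one arc; the function takes one value on each arc, and
arcs with a common endpoint have the same value. -/
theorem constOn_diff_Icc (h𝒩 : Γ.IsStandardDenseFamily 𝒩) (hΓ : Γ.Essential)
    (h2 : Γ.TwoConnected) {e₀ : Γ.E} {c d : unitInterval} (hc : c ∈ Γ.trace 𝒩 e₀)
    (hd : d ∈ Γ.trace 𝒩 e₀) (hcd : c ≤ d) (hgap : Disjoint (Ioo c d) (Γ.trace 𝒩 e₀))
    {R : Set Γ.Realization} (hR : R = Γ.edgePoint e₀ '' Icc c d)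
    (hRB : ∀ B ∈ 𝒩, ∀ y ∈ B, y ∈ R → B = R) {f : Γ.Realization → Bool}
    (hf : ContinuousOn f (Γ.punctured 𝒩 \ R))
    (hconst : ∀ B ∈ 𝒩, B ≠ R → ConstOn f (B ∩ Γ.punctured 𝒩)) :
    ConstOn f (Γ.punctured 𝒩 \ R) := by
  have := Γ.finiteE
  choose a ha using h𝒩.exists_isLeast_trace
  choose b hb using h𝒩.exists_isGreatest_trace
  have hcR : Γ.edgePoint e₀ c ∈ R := hR ▸ mem_image_of_mem _ ⟨le_rfl, hcd⟩
  have hdR : Γ.edgePoint e₀ d ∈ R := hR ▸ mem_image_of_mem _ ⟨hcd, le_rfl⟩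
  have hvR : ∀ v, Γ.vertexPoint v ∉ R := fun v => hR ▸ h𝒩.vertexPoint_notMem_Icc hc hd v
  have hac : a e₀ < c := by
    refine ((ha e₀).2 hc).lt_of_ne fun h => ?_
    obtain ⟨A, hA, hv⟩ := h𝒩.exists_mem_vertex (Γ.src e₀)
    exact hvR _ (hRB A hA _ (h𝒩.Icc_subset_of_isLeast (ha e₀) hA hv h.ge) hcR ▸ hv)
  have hdb : d < b e₀ := by
    refine ((hb e₀).2 hd).lt_of_ne fun h => ?_
    obtain ⟨A, hA, hv⟩ := h𝒩.exists_mem_vertex (Γ.tgt e₀)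
    exact hvR _ (hRB A hA _ (h𝒩.Icc_subset_of_isGreatest (hb e₀) hA hv h.ge) hdR ▸ hv)
  have hnotR : ∀ e, ∀ s ∈ Γ.trace 𝒩 e, Γ.edgePoint e s ∈ R ↔ e = e₀ ∧ s ∈ Icc c d := by
    intro e s hs
    rw [hR]
    constructor
    · rintro ⟨r, hr, hrs⟩
      obtain ⟨he, rfl⟩ := h𝒩.edgePoint_inj_of_trace hs hrs
      exact ⟨he.symm, hr⟩
    · rintro ⟨rfl, hs⟩
      exact mem_image_of_mem _ hs
  have hsome : ∀ e, ConstOn f (Γ.edgePoint e '' ({s | e = e₀ → s < c} ∩ Γ.trace 𝒩 e)) := by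
    refine fun e => h𝒩.constOn_trace ?_ (hf.mono ?_) fun B hB c' hc' d' hd' hBe => hconst B hB ?_
    · exact ⟨fun x hx y hy s hs he => hs.2.trans_lt (hy he)⟩
    · rintro _ ⟨s, hs, rfl⟩
      exact ⟨hs.2, fun h => ((hnotR e s hs.2).1 h).2.1.not_gt (hs.1 ((hnotR e s hs.2).1 h).1)⟩
    · rintro rfl
      rw [hBe] at hcR
      obtain ⟨s, hs, hsc⟩ := hcR
      obtain ⟨he, rfl⟩ := h𝒩.edgePoint_inj_of_trace hc hsc
      exact hs.2.not_gt (hd' he)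
  have hnone : ConstOn f (Γ.edgePoint e₀ '' (Ioi d ∩ Γ.trace 𝒩 e₀)) := by
    refine h𝒩.constOn_trace ordConnected_Ioi (hf.mono ?_) fun B hB c' hc' d' hd' hBe =>
      hconst B hB ?_
    · rintro _ ⟨s, hs, rfl⟩
      exact ⟨hs.2, fun h => ((hnotR e₀ s hs.2).1 h).2.2.not_gt hs.1⟩
    · rintro rfl
      rw [hBe] at hdR
      obtain ⟨s, hs, hsc⟩ := hdR
      obtain ⟨he, rfl⟩ := h𝒩.edgePoint_inj_of_trace hd hsc
      exact hs.1.not_gt hc'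
  set C : Option Γ.E → Set Γ.Realization := fun k =>
    k.elim (Γ.edgePoint e₀ '' Ici c) fun e => Γ.edgePoint e '' {s | e = e₀ → s ≤ c} with hC
  set F : Option Γ.E → Bool := fun k =>
    k.elim (f (Γ.edgePoint e₀ (b e₀))) fun e => f (Γ.edgePoint e (a e)) with hF
  -- the value on an arc at a vertex is the value on the boundary of the neighbourhood of the vertex
  have hCsome : ∀ e x, x ≠ Γ.edgePoint e₀ c → x ∈ C (some e) →
      (∃ w, x = Γ.vertexPoint w ∧ ∀ B ∈ 𝒩, Γ.vertexPoint w ∈ B →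
        ∃ y ∈ B ∩ Γ.punctured 𝒩, f y = F (some e)) ∨
      ∃ s, 0 < s ∧ s < 1 ∧ x = Γ.edgePoint e s ∧ (e = e₀ → s < c) := by
    rintro e _ hx ⟨s, hs, rfl⟩
    rcases edgePoint_eq_vertexPoint_or e s with ⟨w, hw⟩ | ⟨h0, h1⟩
    · refine Or.inl ⟨w, hw, fun B hB hwB => ?_⟩
      obtain ⟨r, hr, hrB, ⟨rfl, hr'⟩ | ⟨rfl, hr'⟩⟩ := h𝒩.exists_trace_of_end hw hB hwB
      · exact ⟨_, ⟨hrB, hr⟩, by rw [hr'.unique (ha e)]; rfl⟩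
      · have he : e ≠ e₀ := fun h => (h𝒩.lt_one_of_mem_trace hc).not_ge (hs h)
        exact ⟨_, ⟨hrB, hr⟩, hsome e _ ⟨r, ⟨fun h => absurd h he, hr⟩, rfl⟩ _
          ⟨a e, ⟨fun h => absurd h he, (ha e).1⟩, rfl⟩⟩
    · refine Or.inr ⟨s, h0, h1, rfl, fun he => (hs he).lt_of_ne ?_⟩
      rintro rfl
      exact hx (he ▸ rfl)
  have hCnone : ∀ x, x ≠ Γ.edgePoint e₀ c → x ∈ C none →
      (∃ w, x = Γ.vertexPoint w ∧ ∀ B ∈ 𝒩, Γ.vertexPoint w ∈ B →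
        ∃ y ∈ B ∩ Γ.punctured 𝒩, f y = F none) ∨
      ∃ s, 0 < s ∧ s < 1 ∧ x = Γ.edgePoint e₀ s ∧ c < s := by
    rintro _ hx ⟨s, hs, rfl⟩
    rcases edgePoint_eq_vertexPoint_or e₀ s with ⟨w, hw⟩ | ⟨h0, h1⟩
    · refine Or.inl ⟨w, hw, fun B hB hwB => ?_⟩
      obtain ⟨r, hr, hrB, ⟨rfl, hr'⟩ | ⟨rfl, hr'⟩⟩ := h𝒩.exists_trace_of_end hw hB hwB
      · exact absurd hs (h𝒩.pos_of_mem_trace hc).not_ge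
      · exact ⟨_, ⟨hrB, hr⟩, by rw [hr'.unique (hb e₀)]; rfl⟩
    · refine Or.inr ⟨s, h0, h1, rfl, lt_of_le_of_ne hs ?_⟩
      rintro rfl
      exact hx rfl
  have hvert : ∀ (k l : Option Γ.E) (w w' : Γ.V), Γ.vertexPoint w = Γ.vertexPoint w' →
      (∀ B ∈ 𝒩, Γ.vertexPoint w ∈ B → ∃ y ∈ B ∩ Γ.punctured 𝒩, f y = F k) →
      (∀ B ∈ 𝒩, Γ.vertexPoint w' ∈ B → ∃ y ∈ B ∩ Γ.punctured 𝒩, f y = F l) → F k = F l := by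
    intro k l w w' hww hk hl
    obtain ⟨B, hB, hwB⟩ := h𝒩.exists_mem_vertex w
    obtain ⟨y, hy, hyk⟩ := hk B hB hwB
    obtain ⟨z, hz, hzl⟩ := hl B hB (hww ▸ hwB)
    rw [← hyk, ← hzl]
    exact hconst B hB (fun h => hvR w (h ▸ hwB)) y hy z hz
  have hmixed : ∀ e x, x ≠ Γ.edgePoint e₀ c → x ∈ C (some e) → x ∈ C none →
      F (some e) = F none := by
    intro e x hx h h'
    rcases hCsome e x hx h with ⟨w, rfl, hw⟩ | ⟨s, h0, h1, rfl, hs⟩ <;>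
      rcases hCnone _ hx h' with ⟨w', hww, hw'⟩ | ⟨s', h0', h1', hss, hs'⟩
    · exact hvert _ _ _ _ hww hw hw'
    · exact absurd hss (vertexPoint_ne_edgePoint h0' h1')
    · exact absurd hww.symm (vertexPoint_ne_edgePoint h0 h1)
    · obtain ⟨he, rfl⟩ := edgePoint_inj h0' h1' hss
      exact absurd (hs he) hs'.not_gt
  have key : ∀ k l, F k = F l := by
    refine eq_of_closed_cover (p := Γ.edgePoint e₀ c) (not_not.1 (h2.2.2 _)) (C := C) ?_ ?_ ?_ ?_
    · rintro (_ | e)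
      · exact isClosed_image_edgePoint e₀ isClosed_Ici
      · refine isClosed_image_edgePoint e ?_
        by_cases he : e = e₀
        · convert isClosed_Iic (a := c) using 1
          ext s
          simp [he]
        · simp [he]
    · intro x
      obtain ⟨e, s, rfl⟩ := hΓ.exists_edgePoint x
      by_cases h : e = e₀ → s ≤ c
      · exact ⟨some e, s, h, rfl⟩
      · push Not at h
        obtain ⟨rfl, h⟩ := h
        exact ⟨none, s, h.le, rfl⟩
    · rintro (_ | e)
      · refine ⟨_, mem_image_of_mem _ (hcd.trans hdb.le), fun h => ?_⟩
        exact (hcd.trans_lt hdb).ne (h𝒩.edgePoint_inj_of_trace hc h).2.symm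
      · refine ⟨_, mem_image_of_mem _ (show e = e₀ → a e ≤ c from fun h => h ▸ hac.le), fun h => ?_⟩
        obtain ⟨rfl, h'⟩ := h𝒩.edgePoint_inj_of_trace hc h
        exact hac.ne h'
    · rintro (_ | e) (_ | e') x hx hk hl
      · rfl
      · exact (hmixed e' x hx hl hk).symm
      · exact hmixed e x hx hk hl
      · rcases hCsome e x hx hk with ⟨w, rfl, hw⟩ | ⟨s, h0, h1, rfl, hs⟩ <;>
          rcases hCsome e' _ hx hl with ⟨w', hww, hw'⟩ | ⟨s', h0', h1', hss, hs'⟩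
        · exact hvert _ _ _ _ hww hw hw'
        · exact absurd hss (vertexPoint_ne_edgePoint h0' h1')
        · exact absurd hww.symm (vertexPoint_ne_edgePoint h0 h1)
        · rw [(edgePoint_inj h0' h1' hss).1]
  have hval : ∀ y ∈ Γ.punctured 𝒩 \ R, ∃ k, f y = F k := by
    rintro y ⟨hyM, hyR⟩
    obtain ⟨e, s, hs, rfl⟩ := exists_trace hΓ hyM
    by_cases h : e = e₀ → s < c
    · exact ⟨some e, hsome e _ ⟨s, ⟨h, hs⟩, rfl⟩ _ ⟨a e, ⟨fun h => h ▸ hac, (ha e).1⟩, rfl⟩⟩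
    · push Not at h
      obtain ⟨rfl, h⟩ := h
      have hds : d < s := not_le.1 fun h' => hyR ((hnotR e s hs).2 ⟨rfl, h, h'⟩)
      exact ⟨none, hnone _ ⟨s, ⟨hds, hs⟩, rfl⟩ _ ⟨b e, ⟨hdb, (hb e).1⟩, rfl⟩⟩
  intro x hx y hy
  obtain ⟨k, hk⟩ := hval x hx
  obtain ⟨l, hl⟩ := hval y hy
  rw [hk, hl, key k l]

theorem constOn_diff (h𝒩 : Γ.IsStandardDenseFamily 𝒩) (hΓ : Γ.Essential)
    (h2 : Γ.TwoConnected) {B₀ : Set Γ.Realization} (hB₀ : B₀ ∈ 𝒩) {f : Γ.Realization → Bool}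
    (hf : ContinuousOn f (Γ.punctured 𝒩 \ B₀))
    (hconst : ∀ B ∈ 𝒩, B ≠ B₀ → ConstOn f (B ∩ Γ.punctured 𝒩)) :
    ConstOn f (Γ.punctured 𝒩 \ B₀) := by
  rcases h𝒩.exists_gap_or_vertex hΓ hB₀ with ⟨v, hv⟩ | ⟨e, c, hc, d, hd, hcd, hgap, hBe⟩
  · exact h𝒩.constOn_diff_vertex hΓ h2 hB₀ hv hf hconst
  · exact h𝒩.constOn_diff_Icc hΓ h2 hc hd hcd.le hgap hBe
      (fun B hB y hy hy' => h𝒩.eq_of_mem hB hB₀ hy hy') hf hconst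

theorem constOn_diff_singleton (h𝒩 : Γ.IsStandardDenseFamily 𝒩) (hΓ : Γ.Essential)
    (h2 : Γ.TwoConnected) {x : Γ.Realization} (hx : x ∈ Γ.punctured 𝒩) (hx' : ∀ B ∈ 𝒩, x ∉ B)
    {f : Γ.Realization → Bool} (hf : ContinuousOn f (Γ.punctured 𝒩 \ {x}))
    (hconst : ∀ B ∈ 𝒩, ConstOn f (B ∩ Γ.punctured 𝒩)) : ConstOn f (Γ.punctured 𝒩 \ {x}) := by
  obtain ⟨e, s, hs, rfl⟩ := exists_trace hΓ hx
  refine h𝒩.constOn_diff_Icc hΓ h2 hs hs le_rfl (by simp) (by simp) ?_ hf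
    fun B hB _ => hconst B hB
  rintro B hB y hy rfl
  exact absurd hy (hx' B hB)

end IsStandardDenseFamily
end FiniteMultigraph

/-- The properties of a punctured 2-connected graph with the family `Ω` of its peripherals which the
topology of the limit depends on. Connectedness is expressed by continuous two-valued functions
which are constant on peripherals, as every peripheral is contained in a connected subset of the
limit. -/
structure IsGraphlike {K : Type*} [TopologicalSpace K] (Ω : Set (Set K)) : Prop where
  nonempty : Ω.Nonempty
  finite : ∀ P ∈ Ω, P.Finite
  nontrivial : ∀ P ∈ Ω, P.Nontrivial
  dense_compl : ∀ P ∈ Ω, Dense Pᶜ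
  constOn_compl : ∀ P₀ ∈ Ω, ∀ f : K → Bool, ContinuousOn f P₀ᶜ →
    (∀ P ∈ Ω, P ≠ P₀ → ConstOn f P) → ConstOn f P₀ᶜ
  constOn_compl_singleton : ∀ x, (∀ P ∈ Ω, x ∉ P) → ∀ f : K → Bool, ContinuousOn f {x}ᶜ →
    (∀ P ∈ Ω, ConstOn f P) → ConstOn f {x}ᶜ
  exists_isClopen : ∀ x, ∀ V ∈ 𝓝 x, ∃ A, IsClopen A ∧ x ∈ A ∧ A ⊆ V ∧
    ∀ f : K → Bool, ContinuousOn f A → (∀ P ∈ Ω, P ⊆ A → ConstOn f P) → ConstOn f A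

namespace FiniteMultigraph

theorem IsPuncturedVersion.isGraphlike {Γ : FiniteMultigraph} (hΓ : Γ.Essential)
    (h2 : Γ.TwoConnected) {K : Type*} [TopologicalSpace K] {Ω : Set (Set K)}
    (h : Γ.IsPuncturedVersion Ω) : IsGraphlike Ω := by
  classical
  obtain ⟨𝒩, h𝒩, i, hi⟩ := h
  set j : K → Γ.Realization := fun x => i x with hj
  have hjemb : IsEmbedding j := IsEmbedding.subtypeVal.comp i.isEmbedding
  have hjM : ∀ x, j x ∈ Γ.punctured 𝒩 := fun x => (i x).2
  have hsurj : ∀ y ∈ Γ.punctured 𝒩, ∃ x, j x = y := fun y hy =>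
    ⟨i.symm ⟨y, hy⟩, by simp [hj]⟩
  have hΩ : ∀ P ∈ Ω, ∃ B ∈ 𝒩, ∀ x, x ∈ P ↔ j x ∈ B := by
    intro P hP
    obtain ⟨B, hB, hBP⟩ := hi.subset (mem_image_of_mem _ hP)
    refine ⟨B, hB, fun x => ?_⟩
    change frontier B = j '' P at hBP
    rw [h𝒩.frontier_eq hB] at hBP
    rw [← hjemb.injective.mem_set_image (s := P), show j '' P = _ from hBP.symm]
    exact and_iff_left (hjM x)
  have h𝒩Ω : ∀ B ∈ 𝒩, j ⁻¹' B ∈ Ω := by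
    intro B hB
    obtain ⟨P, hP, hBP⟩ := hi.superset (mem_image_of_mem _ hB)
    convert hP
    ext x
    replace hBP : frontier B = j '' P := hBP.symm
    rw [h𝒩.frontier_eq hB] at hBP
    rw [← hjemb.injective.mem_set_image (s := P), show j '' P = _ from hBP.symm]
    exact (and_iff_left (hjM x)).symm
  -- functions on `K` as functions on the realization
  have hext : ∀ f : K → Bool, ∃ g : Γ.Realization → Bool, (∀ x, g (j x) = f x) ∧
      ∀ S, ContinuousOn f S → ContinuousOn g (j '' S) := by
    intro f
    obtain ⟨g, hg⟩ : ∃ g : Γ.Realization → Bool, ∀ x, g (j x) = f x :=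
      ⟨fun y => if hy : y ∈ Γ.punctured 𝒩 then f (i.symm ⟨y, hy⟩) else false, fun x => by simp [hj]⟩
    refine ⟨g, hg, ?_⟩
    rintro S hf _ ⟨x, hx, rfl⟩
    rw [ContinuousWithinAt, ← hjemb.isInducing.map_nhdsWithin_eq, Filter.tendsto_map'_iff, hg,
      show g ∘ j = f from funext hg]
    exact hf x hx
  have hback : ∀ (f : K → Bool) (g : Γ.Realization → Bool) (S : Set K) (S' : Set Γ.Realization),
      (∀ x, g (j x) = f x) → (∀ x ∈ S, j x ∈ S') → ConstOn g S' → ConstOn f S := by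
    intro f g S S' hg hS hc x hx y hy
    rw [← hg, ← hg]
    exact hc _ (hS x hx) _ (hS y hy)
  have hforth : ∀ (f : K → Bool) (g : Γ.Realization → Bool) (S : Set K) (S' : Set Γ.Realization),
      (∀ x, g (j x) = f x) → (∀ y ∈ S', ∃ x ∈ S, j x = y) → ConstOn f S → ConstOn g S' := by
    intro f g S S' hg hS hc x hx y hy
    obtain ⟨x', hx', rfl⟩ := hS x hx
    obtain ⟨y', hy', rfl⟩ := hS y hy
    rw [hg, hg]
    exact hc _ hx' _ hy'
  have hBM : ∀ B, ∀ y ∈ B ∩ Γ.punctured 𝒩, ∃ x ∈ j ⁻¹' B, j x = y := by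
    rintro B y ⟨hyB, hyM⟩
    obtain ⟨x, rfl⟩ := hsurj y hyM
    exact ⟨x, hyB, rfl⟩
  have hfin : ∀ P ∈ Ω, P.Finite := by
    intro P hP
    obtain ⟨B, hB, hPB⟩ := hΩ P hP
    exact ((h𝒩.finite_inter_punctured hΓ hB).preimage hjemb.injective.injOn).subset
      fun x hx => ⟨(hPB x).1 hx, hjM x⟩
  refine ⟨?_, hfin, ?_, ?_, ?_, ?_, ?_⟩
  · obtain ⟨v⟩ := hΓ.1
    obtain ⟨B, hB, -⟩ := h𝒩.exists_mem_vertex v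
    exact ⟨_, h𝒩Ω B hB⟩
  · intro P hP
    obtain ⟨B, hB, hPB⟩ := hΩ P hP
    obtain ⟨y, hy, z, hz, hyz⟩ := h𝒩.nontrivial_inter_punctured hΓ h2 hB
    obtain ⟨y, hy', rfl⟩ := hBM B y hy
    obtain ⟨z, hz', rfl⟩ := hBM B z hz
    exact ⟨y, (hPB y).2 hy', z, (hPB z).2 hz', fun h => hyz (h ▸ rfl)⟩
  · intro P hP x
    by_cases hx : x ∈ P
    swap
    · exact subset_closure hx
    have : T1Space K := by
      -- points of `K` are closed since points of the realization are
      refine ⟨fun x => ?_⟩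
      obtain ⟨e, s, hs⟩ := hΓ.exists_edgePoint (j x)
      have := (isClosed_image_edgePoint e (isClosed_singleton (x := s))).preimage hjemb.continuous
      rw [image_singleton, ← hs] at this
      convert this
      ext y
      exact hjemb.injective.eq_iff.symm
    rw [mem_closure_iff]
    intro V hV hxV
    have hV' : V \ (P \ {x}) ∈ 𝓝 x :=
      (hV.sdiff ((hfin P hP).subset sdiff_subset).isClosed).mem_nhds ⟨hxV, fun h => h.2 rfl⟩
    rw [hjemb.isInducing.nhds_eq_comap] at hV'
    obtain ⟨W, hW, hWV⟩ := Filter.mem_comap.1 hV'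
    obtain ⟨e, s, hs, hxs⟩ := IsStandardDenseFamily.exists_trace hΓ (hjM x)
    rw [hxs] at hW
    obtain ⟨s', hs', hne, hsW⟩ := h𝒩.exists_ne_mem_nhds hΓ hs hW
    obtain ⟨y, hy⟩ := hsurj _ hs'
    have hyx : y ≠ x := by
      rintro rfl
      exact hne (h𝒩.edgePoint_inj_of_trace hs (hy.symm.trans hxs)).2
    have hyV := hWV (show j y ∈ W from hy ▸ hsW)
    exact ⟨y, hyV.1, fun h => hyV.2 ⟨h, hyx⟩⟩
  · intro P₀ hP₀ f hf hconst
    obtain ⟨B₀, hB₀, hPB⟩ := hΩ P₀ hP₀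
    obtain ⟨g, hg, hgc⟩ := hext f
    refine hback f g _ (_ \ B₀) hg (fun x hx => ⟨hjM x, fun h => hx ((hPB x).2 h)⟩)
      (h𝒩.constOn_diff hΓ h2 hB₀ ((hgc _ hf).mono ?_) fun B hB hne =>
        hforth f g _ _ hg (hBM B) (hconst _ (h𝒩Ω B hB) ?_))
    · rintro y ⟨hyM, hyB⟩
      obtain ⟨x, rfl⟩ := hsurj y hyM
      exact mem_image_of_mem _ fun h => hyB ((hPB x).1 h)
    · rintro rfl
      obtain ⟨y, hy, -⟩ := h𝒩.nontrivial_inter_punctured hΓ h2 hB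
      obtain ⟨x, hx, rfl⟩ := hBM B y hy
      exact hne (h𝒩.eq_of_mem hB hB₀ hx ((hPB x).1 hx))
  · intro x hx f hf hconst
    obtain ⟨g, hg, hgc⟩ := hext f
    refine hback f g _ (_ \ {j x}) hg (fun y hy => ⟨hjM y, fun h => hy (hjemb.injective h)⟩)
      (h𝒩.constOn_diff_singleton hΓ h2 (hjM x) (fun B hB => hx _ (h𝒩Ω B hB)) ((hgc _ hf).mono ?_)
        fun B hB => hforth f g _ _ hg (hBM B) (hconst _ (h𝒩Ω B hB)))
    rintro y ⟨hyM, hyx⟩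
    obtain ⟨y, rfl⟩ := hsurj y hyM
    exact mem_image_of_mem _ fun h => hyx (h ▸ rfl)
  · intro x V hV
    rw [hjemb.isInducing.nhds_eq_comap] at hV
    obtain ⟨W, hW, hWV⟩ := Filter.mem_comap.1 hV
    obtain ⟨e, s, hs, hxs⟩ := IsStandardDenseFamily.exists_trace hΓ (hjM x)
    rw [hxs] at hW
    obtain ⟨l, u, hl, hu, hls, hsu, hsub⟩ := h𝒩.exists_Ioo_subset hΓ hs hW
    have hA : j ⁻¹' (Γ.edgePoint e '' Ioo l u) = j ⁻¹' (Γ.edgePoint e '' Icc l u) := by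
      refine Subset.antisymm (preimage_mono (image_mono Ioo_subset_Icc_self)) ?_
      rintro y ⟨r, hr, hry⟩
      have hrM : r ∈ Γ.trace 𝒩 e := by
        change Γ.edgePoint e r ∈ Γ.punctured 𝒩
        exact hry ▸ hjM y
      exact ⟨r, ⟨hr.1.lt_of_ne fun h => hl (h ▸ hrM), hr.2.lt_of_ne fun h => hu (h ▸ hrM)⟩, hry⟩
    refine ⟨j ⁻¹' (Γ.edgePoint e '' Ioo l u), ⟨?_, ?_⟩, ⟨s, ⟨hls, hsu⟩, hxs.symm⟩,
      fun y hy => hWV (hsub hy), fun f hf hconst => ?_⟩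
    · rw [hA]
      exact (isClosed_image_edgePoint e isClosed_Icc).preimage hjemb.continuous
    · exact (isOpen_image_edgePoint e).preimage hjemb.continuous
    · obtain ⟨g, hg, hgc⟩ := hext f
      refine hback f g _ _ hg ?_ (h𝒩.constOn_trace (e := e) (ordConnected_Ioo (a := l) (b := u))
        ((hgc _ hf).mono ?_) fun B hB c hc d hd hBe =>
          hforth f g _ _ hg (hBM B) (hconst _ (h𝒩Ω B hB) ?_))
      · rintro y ⟨r, hr, hry⟩
        refine ⟨r, ⟨hr, ?_⟩, hry⟩
        change Γ.edgePoint e r ∈ Γ.punctured 𝒩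
        exact hry ▸ hjM y
      · rintro _ ⟨r, ⟨hr, hrM⟩, rfl⟩
        obtain ⟨y, hy⟩ := hsurj _ hrM
        exact ⟨y, ⟨r, hr, hy.symm⟩, hy⟩
      · rw [hBe]
        exact preimage_mono (image_mono (Icc_subset_Ioo hc.1 hd.2))

end FiniteMultigraph

/-! ### The two sides of an edge of a tree -/

section Tree

variable {V : Type*} {T : SimpleGraph V}

/-- The component of `b` after removal of the edge `ab`. -/
def treeSide (T : SimpleGraph V) (a b : V) : Set V :=
  {v | (T.deleteEdges {s(a, b)}).Reachable b v}

theorem mem_treeSide_self (a b : V) : b ∈ treeSide T a b := SimpleGraph.Reachable.refl b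

/-- A side of the edge `ab` is left only through this edge. -/
theorem eq_of_leave_treeSide {a b x y : V} (hx : x ∈ treeSide T a b) (hxy : T.Adj x y)
    (hy : y ∉ treeSide T a b) : x = b ∧ y = a := by
  by_cases h : s(x, y) = s(a, b)
  · rcases Sym2.eq_iff.1 h with ⟨rfl, rfl⟩ | h
    · exact absurd (mem_treeSide_self _ _) hy
    · exact h
  · refine absurd (SimpleGraph.Reachable.trans hx (SimpleGraph.Adj.reachable ?_)) hy
    rw [SimpleGraph.deleteEdges_adj]
    exact ⟨hxy, h⟩

theorem treeSide_induction {a b : V} {Q : V → Prop} (hb : Q b)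
    (hstep : ∀ x y, x ∈ treeSide T a b → Q x → T.Adj x y → y ∈ treeSide T a b → Q y) :
    ∀ v ∈ treeSide T a b, Q v := by
  have key : ∀ x v, (T.deleteEdges {s(a, b)}).Walk x v → x ∈ treeSide T a b → Q x → Q v := by
    intro x v p
    induction p with
    | nil => exact fun _ h => h
    | cons h q ih =>
      intro hx hQ
      have hy := SimpleGraph.Reachable.trans hx h.reachable
      exact ih hy (hstep _ _ hx hQ (SimpleGraph.deleteEdges_adj.1 h).1 hy)
  rintro v ⟨p⟩
  exact key b v p (mem_treeSide_self a b) hb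

theorem reachable_induction (hT : T.IsTree) {Q : V → Prop} {a : V} (ha : Q a)
    (hstep : ∀ x y, Q x → T.Adj x y → Q y) (v : V) : Q v := by
  obtain ⟨p⟩ := hT.1 a v
  induction p with
  | nil => exact ha
  | cons h q ih => exact ih (hstep _ _ ha h)

theorem disjoint_treeSide (hT : T.IsTree) {a b : V} (hab : T.Adj a b) :
    Disjoint (treeSide T a b) (treeSide T b a) := by
  rw [disjoint_left]
  intro v hv hv'
  have h := SimpleGraph.isAcyclic_iff_forall_adj_isBridge.1 hT.2 hab
  rw [SimpleGraph.isBridge_iff] at h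
  rw [treeSide, Sym2.eq_swap] at hv'
  exact h (SimpleGraph.Reachable.trans hv' (SimpleGraph.Reachable.symm hv))

theorem mem_treeSide_or (hT : T.IsTree) (a b v : V) :
    v ∈ treeSide T a b ∨ v ∈ treeSide T b a := by
  refine reachable_induction hT (Q := fun v => v ∈ treeSide T a b ∨ v ∈ treeSide T b a)
    (a := b) (Or.inl (mem_treeSide_self a b)) ?_ v
  rintro x y (hx | hx) hxy
  · by_contra! h
    exact h.2 (by rw [(eq_of_leave_treeSide hx hxy h.1).2]; exact mem_treeSide_self b a)
  · by_contra! h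
    exact h.1 (by rw [(eq_of_leave_treeSide hx hxy h.2).2]; exact mem_treeSide_self a b)

theorem notMem_treeSide_iff (hT : T.IsTree) {a b v : V} (hab : T.Adj a b) :
    v ∉ treeSide T a b ↔ v ∈ treeSide T b a :=
  ⟨(mem_treeSide_or hT a b v).resolve_left, fun h h' =>
    disjoint_left.1 (disjoint_treeSide hT hab) h' h⟩

theorem notMem_treeSide_self (hT : T.IsTree) {a b : V} (hab : T.Adj a b) : a ∉ treeSide T a b :=
  (notMem_treeSide_iff hT hab).2 (mem_treeSide_self b a)

theorem treeSide_subset {a b c d : V} (hcd : T.Adj c d) (hc : c ∈ treeSide T a b)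
    (ha : a ∉ treeSide T c d) : treeSide T c d ⊆ treeSide T a b := by
  refine treeSide_induction ?_ fun x y hx hxs hxy hy => ?_
  · by_contra h
    exact ha ((eq_of_leave_treeSide hc hcd h).2 ▸ mem_treeSide_self c d)
  · by_contra h
    exact ha ((eq_of_leave_treeSide hxs hxy h).2 ▸ hy)

theorem treeSide_subset_of_adj (hT : T.IsTree) {a b c : V} (hab : T.Adj a b) (hbc : T.Adj b c)
    (hca : c ≠ a) : treeSide T b c ⊆ treeSide T a b :=
  treeSide_subset hbc (mem_treeSide_self a b) fun ha =>
    hca (eq_of_leave_treeSide ha hab (notMem_treeSide_self hT hbc)).1.symm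

theorem disjoint_treeSide_of_ne (hT : T.IsTree) {a b c : V} (hb : T.Adj a b) (hc : T.Adj a c)
    (hbc : b ≠ c) : Disjoint (treeSide T a b) (treeSide T a c) :=
  (disjoint_treeSide hT hb).mono_right (treeSide_subset_of_adj hT hb.symm hc hbc.symm)

theorem exists_mem_treeSide (hT : T.IsTree) (a v : V) :
    v = a ∨ ∃ b, T.Adj a b ∧ v ∈ treeSide T a b := by
  refine reachable_induction hT (Q := fun v => v = a ∨ ∃ b, T.Adj a b ∧ v ∈ treeSide T a b)
    (a := a) (Or.inl rfl) ?_ v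
  rintro x y (rfl | ⟨b, hb, hx⟩) hxy
  · exact Or.inr ⟨y, hxy, mem_treeSide_self _ _⟩
  · by_cases h : y ∈ treeSide T a b
    · exact Or.inr ⟨b, hb, h⟩
    · exact Or.inl (eq_of_leave_treeSide hx hxy h).2

/-! ### Rays and ends -/

namespace TreeRay

variable (ρ : TreeRay T)

/-- The part of the tree beyond the `n`th edge of the ray. -/
def side (n : ℕ) : Set V := treeSide T (ρ.toFun n) (ρ.toFun (n + 1))

theorem antitone_side (hT : T.IsTree) : Antitone ρ.side :=
  antitone_nat_of_succ_le fun n => treeSide_subset_of_adj hT (ρ.adj n) (ρ.adj (n + 1))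
    fun h => by have := ρ.injective h; omega

theorem mem_side (hT : T.IsTree) {m n : ℕ} : ρ.toFun m ∈ ρ.side n ↔ n < m := by
  constructor
  · intro h
    by_contra hmn
    exact notMem_treeSide_self hT (ρ.adj m) (ρ.antitone_side hT (not_lt.1 hmn) h)
  · intro h
    obtain ⟨k, rfl⟩ := Nat.exists_eq_add_of_le' (Nat.one_le_of_lt h)
    exact ρ.antitone_side hT (Nat.le_of_lt_succ h) (mem_treeSide_self _ _)

theorem exists_notMem_side (hT : T.IsTree) (v : V) : ∃ n, v ∉ ρ.side n := by
  refine reachable_induction hT (Q := fun v => ∃ n, v ∉ ρ.side n) (a := ρ.toFun 0)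
    ⟨0, notMem_treeSide_self hT (ρ.adj 0)⟩ ?_ v
  rintro x y ⟨n, hx⟩ hxy
  by_cases hy : y ∈ ρ.side n
  · refine ⟨n + 1, ?_⟩
    rw [(eq_of_leave_treeSide hy hxy.symm hx).1]
    exact notMem_treeSide_self hT (ρ.adj (n + 1))
  · exact ⟨n, hy⟩

theorem eventually_ne (v : V) : ∃ N, ∀ n ≥ N, ρ.toFun n ≠ v := by
  by_cases h : ∃ m, ρ.toFun m = v
  · obtain ⟨m, rfl⟩ := h
    exact ⟨m + 1, fun n hn h => by have := ρ.injective h; omega⟩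
  · push Not at h
    exact ⟨0, fun n _ => h n⟩

end TreeRay

/-- Infinite non-backtracking paths in a tree are rays. -/
theorem exists_ray (hT : T.IsTree) {Q : V → V → Prop} {a b : V} (hab : T.Adj a b) (hQ : Q a b)
    (hstep : ∀ x y, T.Adj x y → Q x y → ∃ z, T.Adj y z ∧ z ≠ x ∧ Q y z) :
    ∃ ρ : TreeRay T, ρ.toFun 0 = a ∧ ρ.toFun 1 = b ∧ ∀ n, Q (ρ.toFun n) (ρ.toFun (n + 1)) := by
  choose next hadj hne hnext using hstep
  let S := {p : V × V // T.Adj p.1 p.2 ∧ Q p.1 p.2}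
  let g : S → S := fun p =>
    ⟨(p.1.2, next _ _ p.2.1 p.2.2), hadj _ _ p.2.1 p.2.2, hnext _ _ p.2.1 p.2.2⟩
  let σ : ℕ → S := fun n => g^[n] ⟨(a, b), hab, hQ⟩
  have hσ : ∀ n, σ (n + 1) = g (σ n) := fun n => Function.iterate_succ_apply' _ _ _
  have h1 : ∀ n, (σ (n + 1)).1.1 = (σ n).1.2 := fun n => by rw [hσ]
  have hback : ∀ n, (σ (n + 1)).1.2 ≠ (σ n).1.1 := fun n => by
    rw [hσ]
    exact hne _ _ _ _
  have hanti : Antitone fun n => treeSide T (σ n).1.1 (σ n).1.2 := by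
    refine antitone_nat_of_succ_le fun n => ?_
    have := treeSide_subset_of_adj hT (σ n).2.1 (h1 n ▸ (σ (n + 1)).2.1) (hback n)
    change treeSide T (σ (n + 1)).1.1 (σ (n + 1)).1.2 ⊆ _
    rwa [h1 n]
  have hlt : ∀ m n, m < n → (σ m).1.1 ≠ (σ n).1.1 := by
    intro m n hmn h
    obtain ⟨k, rfl⟩ := Nat.exists_eq_add_of_le' (Nat.one_le_of_lt hmn)
    have hmem : (σ (k + 1)).1.1 ∈ treeSide T (σ m).1.1 (σ m).1.2 := by
      rw [h1]
      exact hanti (Nat.le_of_lt_succ hmn) (mem_treeSide_self _ _)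
    exact notMem_treeSide_self hT (σ m).2.1 (h ▸ hmem)
  refine ⟨⟨fun n => (σ n).1.1, fun n => h1 n ▸ (σ n).2.1, fun m n h => ?_⟩, rfl, h1 0, fun n => ?_⟩
  · by_contra hmn
    rcases Nat.lt_or_gt_of_ne hmn with h' | h'
    exacts [hlt _ _ h' h, hlt _ _ h' h.symm]
  · change Q (σ n).1.1 (σ (n + 1)).1.1
    rw [h1 n]
    exact (σ n).2.2

/-- An induction principle on the sides of the edges of a tree: a property of sides which passes
from the sides next to a given side to the side itself, and which holds for some side along each
ray, holds for all sides. -/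
theorem treeSide_noetherian_induction (hT : T.IsTree) {Q : V → V → Prop}
    (hstep : ∀ a b, T.Adj a b → (∀ c, T.Adj b c → c ≠ a → Q b c) → Q a b)
    (hray : ∀ ρ : TreeRay T, ∃ n, Q (ρ.toFun n) (ρ.toFun (n + 1))) {a b : V} (hab : T.Adj a b) :
    Q a b := by
  by_contra hQ
  obtain ⟨ρ, -, -, hρ⟩ := exists_ray hT (Q := fun x y => ¬ Q x y) hab hQ fun x y hxy h => by
    by_contra! h'
    exact h (hstep x y hxy h')
  obtain ⟨n, hn⟩ := hray ρ
  exact hρ n hn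

/-- The end `ξ` belongs to the part `S` of the tree: its rays stay in `S` eventually. -/
def TreeEnds.IsIn (S : Set V) (ξ : TreeEnds T) : Prop :=
  ∃ ρ : TreeRay T, ρ.toEnd = ξ ∧ ∃ N, ∀ n ≥ N, ρ.toFun n ∈ S

theorem TreeEnds.exists_ray (ξ : TreeEnds T) : ∃ ρ : TreeRay T, ρ.toEnd = ξ :=
  Quotient.exists_rep ξ

theorem TreeRay.toEnd_eq_iff {ρ σ : TreeRay T} :
    ρ.toEnd = σ.toEnd ↔ ∃ m n : ℕ, ∀ k, ρ.toFun (m + k) = σ.toFun (n + k) :=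
  Quotient.eq (r := TreeRay.setoid T)

theorem TreeRay.toEnd_isIn {ρ : TreeRay T} {S : Set V} :
    ρ.toEnd.IsIn S ↔ ∃ N, ∀ n ≥ N, ρ.toFun n ∈ S := by
  constructor
  · rintro ⟨σ, hσ, N, hN⟩
    obtain ⟨m, n, h⟩ := TreeRay.toEnd_eq_iff.1 hσ
    refine ⟨n + N, fun k hk => ?_⟩
    obtain ⟨l, rfl⟩ := Nat.exists_eq_add_of_le hk
    rw [add_assoc, ← h]
    exact hN _ (by omega)
  · exact fun h => ⟨ρ, rfl, h⟩

theorem TreeEnds.IsIn.mono {S S' : Set V} {ξ : TreeEnds T} (h : ξ.IsIn S) (hS : S ⊆ S') :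
    ξ.IsIn S' := by
  obtain ⟨ρ, hρ, N, hN⟩ := h
  exact ⟨ρ, hρ, N, fun n hn => hS (hN n hn)⟩

theorem TreeEnds.IsIn.not_disjoint {S S' : Set V} {ξ : TreeEnds T} (h : ξ.IsIn S)
    (h' : ξ.IsIn S') : ¬ Disjoint S S' := by
  obtain ⟨ρ, rfl⟩ := ξ.exists_ray
  obtain ⟨N, hN⟩ := TreeRay.toEnd_isIn.1 h
  obtain ⟨N', hN'⟩ := TreeRay.toEnd_isIn.1 h'
  exact not_disjoint_iff.2 ⟨_, hN (max N N') (le_max_left _ _), hN' (max N N') (le_max_right _ _)⟩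

theorem TreeRay.toEnd_isIn_side (hT : T.IsTree) (ρ : TreeRay T) (n : ℕ) :
    ρ.toEnd.IsIn (ρ.side n) :=
  TreeRay.toEnd_isIn.2 ⟨n + 1, fun _ hm => (ρ.mem_side hT).2 hm⟩

/-- An end lies beyond exactly one of the edges at a given vertex. -/
theorem TreeEnds.exists_isIn_treeSide (hT : T.IsTree) (ξ : TreeEnds T) (a : V) :
    ∃ b, T.Adj a b ∧ ξ.IsIn (treeSide T a b) := by
  obtain ⟨ρ, rfl⟩ := ξ.exists_ray
  obtain ⟨N, hN⟩ := ρ.eventually_ne a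
  obtain ⟨b, hb, hmem⟩ := (exists_mem_treeSide hT a (ρ.toFun N)).resolve_left (hN N le_rfl)
  refine ⟨b, hb, TreeRay.toEnd_isIn.2 ⟨N, fun n hn => ?_⟩⟩
  induction n, hn using Nat.le_induction with
  | base => exact hmem
  | succ n hn ih =>
    by_contra h
    exact hN (n + 1) (by omega) (eq_of_leave_treeSide ih (ρ.adj n) h).2

theorem TreeEnds.isIn_treeSide_or (hT : T.IsTree) (ξ : TreeEnds T) {a b : V} (hab : T.Adj a b) :
    ξ.IsIn (treeSide T a b) ∨ ξ.IsIn (treeSide T b a) := by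
  obtain ⟨c, hc, h⟩ := ξ.exists_isIn_treeSide hT a
  by_cases hcb : c = b
  · exact Or.inl (hcb ▸ h)
  · exact Or.inr (h.mono (treeSide_subset_of_adj hT hab.symm hc hcb))

theorem TreeEnds.not_isIn_treeSide_iff (hT : T.IsTree) {ξ : TreeEnds T} {a b : V}
    (hab : T.Adj a b) : ¬ ξ.IsIn (treeSide T a b) ↔ ξ.IsIn (treeSide T b a) :=
  ⟨(ξ.isIn_treeSide_or hT hab).resolve_left, fun h h' =>
    h'.not_disjoint h (disjoint_treeSide hT hab)⟩

/-- An end which lies beyond all edges of a ray is the end of this ray: a ray to this end from a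
vertex outside must run through the given ray. -/
theorem TreeRay.toEnd_eq_of_isIn_side (hT : T.IsTree) {ρ : TreeRay T} {ξ : TreeEnds T}
    (h : ∀ n, ξ.IsIn (ρ.side n)) : ξ = ρ.toEnd := by
  obtain ⟨σ, rfl⟩ := ξ.exists_ray
  obtain ⟨N, hN⟩ := ρ.exists_notMem_side hT (σ.toFun 0)
  have hcross : ∀ n ≥ N, ∃ k, σ.toFun k = ρ.toFun n ∧ σ.toFun (k + 1) = ρ.toFun (n + 1) := by
    intro n hn
    by_contra! hno
    obtain ⟨M, hM⟩ := TreeRay.toEnd_isIn.1 (h n)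
    have hout : ∀ k, σ.toFun k ∉ ρ.side n := by
      intro k
      induction k with
      | zero => exact fun hk => hN (ρ.antitone_side hT hn hk)
      | succ k ih =>
        intro hk
        obtain ⟨h1, h2⟩ := eq_of_leave_treeSide hk (σ.adj k).symm ih
        exact hno k h2 h1
    exact hout M (hM M le_rfl)
  obtain ⟨k, hk, -⟩ := hcross N le_rfl
  refine TreeRay.toEnd_eq_iff.2 ⟨k, N, fun i => ?_⟩
  induction i with
  | zero => exact hk
  | succ i ih =>
    obtain ⟨l, hl, hl'⟩ := hcross (N + i) (by omega)
    have : l = k + i := σ.injective (hl.trans ih.symm)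
    subst this
    exact hl'

/-- An end beyond the edge `ab` is the end of a ray which runs through `a` and `b` at the start. -/
theorem TreeEnds.exists_ray_of_isIn (hT : T.IsTree) {ξ : TreeEnds T} {a b : V} (hab : T.Adj a b)
    (h : ξ.IsIn (treeSide T a b)) :
    ∃ ρ : TreeRay T, ρ.toFun 0 = a ∧ ρ.toFun 1 = b ∧ ρ.toEnd = ξ := by
  obtain ⟨ρ, h0, h1, hρ⟩ := _root_.exists_ray hT (Q := fun x y => ξ.IsIn (treeSide T x y)) hab h
    fun x y hxy hx => by
      obtain ⟨z, hz, h⟩ := ξ.exists_isIn_treeSide hT y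
      refine ⟨z, hz, ?_, h⟩
      rintro rfl
      exact hx.not_disjoint h (disjoint_treeSide hT hxy)
  exact ⟨ρ, h0, h1, (TreeRay.toEnd_eq_of_isIn_side hT hρ).symm⟩

end Tree

/-! ### Points of the limit of a tree system -/

namespace TreeSystem

variable {Θ : TreeSystem.{u₁, u₂, u₃, u₄}}

/-- Adjacency of a black and a white vertex. -/
abbrev Inc (Θ : TreeSystem.{u₁, u₂, u₃, u₄}) (t : Θ.Black) (u : Θ.White) : Prop :=
  Θ.tree.Adj (Sum.inl t) (Sum.inr u)

/-- A point of a constituent space as a point of the limit. -/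
def point (t : Θ.Black) (x : Θ.K t) : Θ.Limit := Sum.inl (Θ.toGlued t x)

/-- An end of the tree as a point of the limit. -/
def endPoint (ξ : TreeEnds Θ.tree) : Θ.Limit := Sum.inr ξ

theorem eq_point_or_endPoint (z : Θ.Limit) : (∃ t x, z = point t x) ∨ ∃ ξ, z = endPoint ξ := by
  rcases z with ⟨⟨t, x⟩⟩ | ξ
  exacts [Or.inl ⟨t, x, rfl⟩, Or.inr ⟨ξ, rfl⟩]

theorem point_ne_endPoint (t : Θ.Black) (x : Θ.K t) (ξ : TreeEnds Θ.tree) :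
    point t x ≠ endPoint ξ :=
  Sum.inl_ne_inr

theorem endPoint_injective : Function.Injective (endPoint (Θ := Θ)) := Sum.inr_injective

theorem φ_injective {t : Θ.Black} {u : Θ.White} (h : Θ.Inc t u) :
    Function.Injective (Θ.φ t u h) :=
  (Θ.isEmbedding_φ t u h).injective

theorem isClosed_range_φ {t : Θ.Black} {u : Θ.White} (h : Θ.Inc t u) :
    IsClosed (range (Θ.φ t u h)) :=
  (isCompact_range (Θ.isEmbedding_φ t u h).continuous).isClosed

theorem eq_of_φ_eq {t : Θ.Black} {u u' : Θ.White} {h : Θ.Inc t u} {h' : Θ.Inc t u'} {p : Θ.P u}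
    {p' : Θ.P u'} (hp : Θ.φ t u h p = Θ.φ t u' h' p') : u = u' := by
  by_contra hne
  exact disjoint_left.1 (Θ.disjoint_φ t u u' h h' hne) (mem_range_self p) (hp ▸ mem_range_self p')

theorem glueRel_iff {a b : Σ t : Θ.Black, Θ.K t} :
    Θ.GlueRel a b ↔ ∃ (u : Θ.White) (p : Θ.P u) (h : Θ.Inc a.1 u) (h' : Θ.Inc b.1 u),
      a.2 = Θ.φ a.1 u h p ∧ b.2 = Θ.φ b.1 u h' p := by
  constructor
  · rintro ⟨u, p, t, s, h, h'⟩
    exact ⟨u, p, h, h', rfl, rfl⟩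
  · rcases a with ⟨t, x⟩
    rcases b with ⟨s, y⟩
    rintro ⟨u, p, h, h', h1, h2⟩
    have hx : x = Θ.φ t u h p := h1
    have hy : y = Θ.φ s u h' p := h2
    rw [hx, hy]
    exact .glue u p t s h h'

/-- The identifications are already transitive, as peripherals of a constituent space are
disjoint. -/
theorem toGlued_eq_iff {t s : Θ.Black} {x : Θ.K t} {y : Θ.K s} :
    Θ.toGlued t x = Θ.toGlued s y ↔ (⟨t, x⟩ : Σ t : Θ.Black, Θ.K t) = ⟨s, y⟩ ∨
      ∃ (u : Θ.White) (p : Θ.P u) (h : Θ.Inc t u) (h' : Θ.Inc s u),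
        x = Θ.φ t u h p ∧ y = Θ.φ s u h' p := by
  have key : ∀ a b, Relation.EqvGen Θ.GlueRel a b → a = b ∨ Θ.GlueRel a b := by
    intro a b h
    induction h with
    | rel a b h => exact Or.inr h
    | refl a => exact Or.inl rfl
    | symm a b _ ih =>
      rcases ih with rfl | h
      · exact Or.inl rfl
      · obtain ⟨u, p, h, h', h1, h2⟩ := glueRel_iff.1 h
        exact Or.inr (glueRel_iff.2 ⟨u, p, h', h, h2, h1⟩)
    | trans a b c _ _ ih ih' =>
      rcases ih with rfl | h
      · exact ih'
      rcases ih' with rfl | h'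
      · exact Or.inr h
      obtain ⟨u, p, ha, hb, h1, h2⟩ := glueRel_iff.1 h
      obtain ⟨u', p', hb', hc, h3, h4⟩ := glueRel_iff.1 h'
      have h23 := h2.symm.trans h3
      obtain rfl := eq_of_φ_eq h23
      obtain rfl := φ_injective _ h23
      exact Or.inr (glueRel_iff.2 ⟨u, p, ha, hc, h1, h4⟩)
  have hq : Θ.toGlued t x = Θ.toGlued s y ↔ Relation.EqvGen Θ.GlueRel ⟨t, x⟩ ⟨s, y⟩ := Quot.eq
  rw [hq]
  constructor
  · intro h
    exact (key _ _ h).imp_right glueRel_iff.1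
  · rintro (h | h)
    · rw [h]
      exact .refl _
    · exact .rel _ _ (glueRel_iff.2 h)

theorem point_eq_iff {t s : Θ.Black} {x : Θ.K t} {y : Θ.K s} :
    point t x = point s y ↔ (⟨t, x⟩ : Σ t : Θ.Black, Θ.K t) = ⟨s, y⟩ ∨
      ∃ (u : Θ.White) (p : Θ.P u) (h : Θ.Inc t u) (h' : Θ.Inc s u),
        x = Θ.φ t u h p ∧ y = Θ.φ s u h' p :=
  Sum.inl_injective.eq_iff.trans toGlued_eq_iff

theorem point_injective (t : Θ.Black) : Function.Injective (point (Θ := Θ) t) := by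
  intro x y h
  rcases point_eq_iff.1 h with h | ⟨u, p, h, h', rfl, rfl⟩
  · cases h
    rfl
  · rfl

theorem point_φ_eq {t s : Θ.Black} {u : Θ.White} (h : Θ.Inc t u) (h' : Θ.Inc s u) (p : Θ.P u) :
    point t (Θ.φ t u h p) = point s (Θ.φ s u h' p) :=
  point_eq_iff.2 (Or.inr ⟨u, p, h, h', rfl, rfl⟩)

theorem toGlued_mem_gluedPeripheral {t : Θ.Black} {x : Θ.K t} {u : Θ.White} :
    Θ.toGlued t x ∈ Θ.gluedPeripheral u ↔ ∃ h : Θ.Inc t u, x ∈ range (Θ.φ t u h) := by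
  constructor
  · rintro ⟨s, hs, p, h⟩
    rcases toGlued_eq_iff.1 h with h | ⟨u', p', h', h'', rfl, h2⟩
    · cases h
      exact ⟨hs, mem_range_self p⟩
    · obtain rfl := eq_of_φ_eq h2
      exact ⟨h', mem_range_self p'⟩
  · rintro ⟨h, p, rfl⟩
    exact ⟨t, h, p, rfl⟩

/-! ### The part of the limit beyond an edge of the tree -/

/-- The part of the limit which belongs to the component of `b` after removal of the edge `ab`. -/
def beyond (Θ : TreeSystem.{u₁, u₂, u₃, u₄}) (a b : Θ.Black ⊕ Θ.White) : Set Θ.Limit :=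
  {z | (∃ t x, Sum.inl t ∈ treeSide Θ.tree a b ∧ z = point t x) ∨
    ∃ ξ : TreeEnds Θ.tree, ξ.IsIn (treeSide Θ.tree a b) ∧ z = endPoint ξ}

theorem endPoint_mem_beyond {a b : Θ.Black ⊕ Θ.White} {ξ : TreeEnds Θ.tree} :
    endPoint ξ ∈ Θ.beyond a b ↔ ξ.IsIn (treeSide Θ.tree a b) := by
  constructor
  · rintro (⟨t, x, -, h⟩ | ⟨ξ', h, h'⟩)
    · exact absurd h.symm (point_ne_endPoint t x ξ)
    · exact endPoint_injective h' ▸ h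
  · exact fun h => Or.inr ⟨ξ, h, rfl⟩

theorem point_mem_beyond_of_mem {a b : Θ.Black ⊕ Θ.White} {t : Θ.Black}
    (ht : Sum.inl t ∈ treeSide Θ.tree a b) (x : Θ.K t) : point t x ∈ Θ.beyond a b :=
  Or.inl ⟨t, x, ht, rfl⟩

theorem beyond_mono {a b c d : Θ.Black ⊕ Θ.White}
    (h : treeSide Θ.tree a b ⊆ treeSide Θ.tree c d) : Θ.beyond a b ⊆ Θ.beyond c d := by
  rintro z (⟨t, x, ht, rfl⟩ | ⟨ξ, hξ, rfl⟩)
  exacts [Or.inl ⟨t, x, h ht, rfl⟩, Or.inr ⟨ξ, hξ.mono h, rfl⟩]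

/-- Every white vertex has exactly two neighbours. -/
def WhiteDegreeTwo (Θ : TreeSystem.{u₁, u₂, u₃, u₄}) : Prop :=
  ∀ u : Θ.White, {t : Θ.Black | Θ.tree.Adj (Sum.inl t) (Sum.inr u)}.ncard = 2

theorem WhiteDegreeTwo.exists_other (hd : Θ.WhiteDegreeTwo) {t : Θ.Black} {u : Θ.White}
    (h : Θ.Inc t u) : ∃ s, Θ.Inc s u ∧ s ≠ t ∧ ∀ r, Θ.Inc r u → r = t ∨ r = s := by
  obtain ⟨a, b, hab, he⟩ := ncard_eq_two.1 (hd u)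
  have hmem : ∀ r, Θ.Inc r u ↔ r = a ∨ r = b := fun r => Set.ext_iff.1 he r
  rcases (hmem t).1 h with rfl | rfl
  · exact ⟨b, (hmem b).2 (Or.inr rfl), hab.symm, fun r hr => (hmem r).1 hr⟩
  · exact ⟨a, (hmem a).2 (Or.inl rfl), hab, fun r hr => ((hmem r).1 hr).symm⟩

theorem inl_mem_treeSide {t s : Θ.Black} {u : Θ.White} (h' : Θ.Inc s u) (hne : s ≠ t) :
    (Sum.inl s : Θ.Black ⊕ Θ.White) ∈ treeSide Θ.tree (Sum.inl t) (Sum.inr u) := by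
  by_contra h
  exact hne (Sum.inl_injective (eq_of_leave_treeSide (mem_treeSide_self _ _) h'.symm h).2)

theorem inl_notMem_treeSide {t : Θ.Black} {u : Θ.White} (h : Θ.Inc t u) :
    (Sum.inl t : Θ.Black ⊕ Θ.White) ∉ treeSide Θ.tree (Sum.inl t) (Sum.inr u) :=
  notMem_treeSide_self Θ.isTree h

theorem point_mem_beyond_iff {t₀ t : Θ.Black} {u : Θ.White} {x : Θ.K t} (hne : t ≠ t₀) :
    point t x ∈ Θ.beyond (Sum.inl t₀) (Sum.inr u) ↔
      Sum.inl t ∈ treeSide Θ.tree (Sum.inl t₀) (Sum.inr u) := by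
  refine ⟨?_, fun h => point_mem_beyond_of_mem h x⟩
  rintro (⟨s, y, hs, hst⟩ | ⟨ξ, -, h⟩)
  · rcases point_eq_iff.1 hst with h | ⟨u', p, h, h', rfl, rfl⟩
    · cases h
      exact hs
    · -- the path from `s` through `u'` to `t` cannot leave the side
      have hu' : Sum.inr u' ∈ treeSide Θ.tree (Sum.inl t₀) (Sum.inr u) := by
        by_contra hu'
        exact Sum.inl_ne_inr (eq_of_leave_treeSide hs h' hu').1
      by_contra ht
      exact hne (Sum.inl_injective (eq_of_leave_treeSide hu' h.symm ht).2)
  · exact absurd h (point_ne_endPoint t x ξ)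

theorem point_mem_beyond_self_iff (hd : Θ.WhiteDegreeTwo) {t : Θ.Black} {u : Θ.White}
    (h : Θ.Inc t u) {x : Θ.K t} :
    point t x ∈ Θ.beyond (Sum.inl t) (Sum.inr u) ↔ x ∈ range (Θ.φ t u h) := by
  constructor
  · rintro (⟨s, y, hs, hst⟩ | ⟨ξ, -, h⟩)
    · rcases point_eq_iff.1 hst with h' | ⟨u', p, h', h'', rfl, rfl⟩
      · cases h'
        exact absurd hs (inl_notMem_treeSide h)
      · have hu' : Sum.inr u' ∈ treeSide Θ.tree (Sum.inl t) (Sum.inr u) := by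
          by_contra hu'
          exact Sum.inl_ne_inr (eq_of_leave_treeSide hs h'' hu').1
        obtain rfl := Sum.inr_injective
          (eq_of_leave_treeSide hu' h'.symm (inl_notMem_treeSide h)).1
        exact mem_range_self p
    · exact absurd h (point_ne_endPoint t x ξ)
  · rintro ⟨p, rfl⟩
    obtain ⟨s, hs, hne, -⟩ := hd.exists_other h
    rw [point_φ_eq h hs]
    exact point_mem_beyond_of_mem (inl_mem_treeSide hs hne) _

/-- The peripheral at `u` as a subset of the limit. -/
def peripheral (Θ : TreeSystem.{u₁, u₂, u₃, u₄}) (u : Θ.White) : Set Θ.Limit :=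
  Sum.inl '' Θ.gluedPeripheral u

theorem point_mem_peripheral {t : Θ.Black} {u : Θ.White} (h : Θ.Inc t u) {x : Θ.K t} :
    point t x ∈ Θ.peripheral u ↔ x ∈ range (Θ.φ t u h) := by
  constructor
  · rintro ⟨g, hg, hgx⟩
    obtain rfl := Sum.inl_injective hgx
    exact (toGlued_mem_gluedPeripheral.1 hg).2
  · exact fun hx => ⟨_, toGlued_mem_gluedPeripheral.2 ⟨h, hx⟩, rfl⟩

theorem peripheral_eq {t : Θ.Black} {u : Θ.White} (h : Θ.Inc t u) :
    Θ.peripheral u = point t '' range (Θ.φ t u h) := by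
  ext z
  constructor
  · rintro ⟨_, ⟨s, hs, p, rfl⟩, rfl⟩
    exact ⟨_, mem_range_self p, point_φ_eq h hs p⟩
  · rintro ⟨x, hx, rfl⟩
    exact (point_mem_peripheral h).2 hx

theorem peripheral_subset_beyond (hd : Θ.WhiteDegreeTwo) {t : Θ.Black} {u : Θ.White}
    (h : Θ.Inc t u) : Θ.peripheral u ⊆ Θ.beyond (Sum.inl t) (Sum.inr u) := by
  rw [peripheral_eq h]
  rintro _ ⟨x, hx, rfl⟩
  exact (point_mem_beyond_self_iff hd h).2 hx

theorem disjoint_beyond (hd : Θ.WhiteDegreeTwo) {t : Θ.Black} {u u' : Θ.White}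
    (h : Θ.Inc t u) (h' : Θ.Inc t u') (hne : u ≠ u') :
    Disjoint (Θ.beyond (Sum.inl t) (Sum.inr u)) (Θ.beyond (Sum.inl t) (Sum.inr u')) := by
  have hdisj := disjoint_treeSide_of_ne Θ.isTree h h' fun h => hne (Sum.inr_injective h)
  rw [disjoint_left]
  intro z hz hz'
  rcases eq_point_or_endPoint z with ⟨s, x, rfl⟩ | ⟨ξ, rfl⟩
  · by_cases hs : s = t
    · subst hs
      rw [point_mem_beyond_self_iff hd h] at hz
      rw [point_mem_beyond_self_iff hd h'] at hz'
      exact disjoint_left.1 (Θ.disjoint_φ s u u' h h' hne) hz hz'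
    · rw [point_mem_beyond_iff hs] at hz hz'
      exact disjoint_left.1 hdisj hz hz'
  · exact (endPoint_mem_beyond.1 hz).not_disjoint (endPoint_mem_beyond.1 hz') hdisj

/-- Every point of the limit lies in a given constituent space or beyond one of its peripherals. -/
theorem exists_mem_beyond (t : Θ.Black) (z : Θ.Limit) :
    (∃ x, z = point t x) ∨ ∃ u, Θ.Inc t u ∧ z ∈ Θ.beyond (Sum.inl t) (Sum.inr u) := by
  have hwhite : ∀ b, Θ.tree.Adj (Sum.inl t) b → ∃ u, b = Sum.inr u := by
    rintro (s | u) h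
    exacts [absurd h (Θ.not_adj_black t s), ⟨u, rfl⟩]
  rcases eq_point_or_endPoint z with ⟨s, x, rfl⟩ | ⟨ξ, rfl⟩
  · rcases exists_mem_treeSide Θ.isTree (Sum.inl t) (Sum.inl s) with h | ⟨b, hb, h⟩
    · cases h
      exact Or.inl ⟨x, rfl⟩
    · obtain ⟨u, rfl⟩ := hwhite b hb
      exact Or.inr ⟨u, hb, point_mem_beyond_of_mem h x⟩
  · obtain ⟨b, hb, h⟩ := ξ.exists_isIn_treeSide Θ.isTree (Sum.inl t)
    obtain ⟨u, rfl⟩ := hwhite b hb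
    exact Or.inr ⟨u, hb, endPoint_mem_beyond.2 h⟩

/-- Seen from the white vertex, the part beyond is the same as seen from the opposite black
vertex. -/
theorem beyond_inr_inl (hd : Θ.WhiteDegreeTwo) {t s : Θ.Black} {u : Θ.White} (ht : Θ.Inc t u)
    (hs : Θ.Inc s u) (hne : s ≠ t) :
    Θ.beyond (Sum.inr u) (Sum.inl s) = Θ.beyond (Sum.inl t) (Sum.inr u) := by
  refine Subset.antisymm (beyond_mono (treeSide_subset_of_adj Θ.isTree ht hs.symm
    fun h => hne (Sum.inl_injective h))) ?_
  obtain ⟨s', -, -, hother⟩ := hd.exists_other ht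
  -- a vertex outside the side of `s` is `u` or lies beyond `t`
  have key : ∀ v, v ∉ treeSide Θ.tree (Sum.inr u) (Sum.inl s) → v = Sum.inr u ∨
      v ∈ treeSide Θ.tree (Sum.inr u) (Sum.inl t) := by
    intro v hv
    rcases exists_mem_treeSide Θ.isTree (Sum.inr u) v with h | ⟨b, hb, h⟩
    · exact Or.inl h
    · rcases b with r | w
      · rcases hother r hb.symm with rfl | rfl
        · exact Or.inr h
        · rcases hother s hs with rfl | rfl
          exacts [absurd rfl hne, absurd h hv]
      · exact absurd hb (Θ.not_adj_white u w)
  rintro z (⟨r, x, hr, rfl⟩ | ⟨ξ, hξ, rfl⟩)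
  · refine point_mem_beyond_of_mem ?_ x
    by_contra h
    rcases key _ h with h | h
    · cases h
    · exact disjoint_left.1 (disjoint_treeSide Θ.isTree ht) hr h
  · refine endPoint_mem_beyond.2 ?_
    by_contra h
    rw [TreeEnds.not_isIn_treeSide_iff Θ.isTree hs.symm] at h
    obtain ⟨ρ, rfl⟩ := ξ.exists_ray
    obtain ⟨N, hN⟩ := ρ.eventually_ne (Sum.inr u)
    obtain ⟨N', hN'⟩ := TreeRay.toEnd_isIn.1 h
    refine hξ.not_disjoint (S' := treeSide Θ.tree (Sum.inr u) (Sum.inl t))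
      (TreeRay.toEnd_isIn.2 ⟨max N N', fun n hn => ?_⟩) (disjoint_treeSide Θ.isTree ht)
    refine (key _ ?_).resolve_left (hN n (le_trans (le_max_left _ _) hn))
    exact (notMem_treeSide_iff Θ.isTree hs.symm).2 (hN' n (le_trans (le_max_right _ _) hn))

/-! ### The basic open sets of the limit -/

section Subtree

variable {F : Set (Θ.Black ⊕ Θ.White)}

/-- The sides of the edges which lead out of a subtree `F` do not meet `F`. -/
theorem IsFiniteBSubtree.notMem_treeSide (hF : Θ.IsFiniteBSubtree F) {t : Θ.Black} {u : Θ.White}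
    (ht : Sum.inl t ∈ F) (hu : Sum.inr u ∉ F) (h : Θ.Inc t u) {v : Θ.Black ⊕ Θ.White}
    (hv : v ∈ F) : v ∉ treeSide Θ.tree (Sum.inl t) (Sum.inr u) := by
  refine reachable_induction hF.2.1 (a := ⟨Sum.inl t, ht⟩)
    (Q := fun v : F => (v : Θ.Black ⊕ Θ.White) ∉ treeSide Θ.tree (Sum.inl t) (Sum.inr u))
    (inl_notMem_treeSide h) ?_ ⟨v, hv⟩
  rintro ⟨x, hx⟩ ⟨y, hy⟩ hxs hxy hys
  have hxy' : Θ.tree.Adj x y := hxy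
  exact hu ((eq_of_leave_treeSide hys hxy'.symm hxs).1 ▸ hy)

theorem WhiteDegreeTwo.exists_inc (hd : Θ.WhiteDegreeTwo) (u : Θ.White) : ∃ t, Θ.Inc t u := by
  obtain ⟨a, b, -, he⟩ := ncard_eq_two.1 (hd u)
  exact ⟨a, (Set.ext_iff.1 he a).2 (Or.inl rfl)⟩

theorem IsFiniteBSubtree.exists_black (hF : Θ.IsFiniteBSubtree F) (hd : Θ.WhiteDegreeTwo) :
    ∃ t, Sum.inl t ∈ F := by
  obtain ⟨⟨v, hv⟩⟩ := hF.2.1.1.nonempty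
  rcases v with t | u
  · exact ⟨t, hv⟩
  · obtain ⟨t, ht⟩ := hd.exists_inc u
    exact ⟨t, hF.2.2 u t hv ht⟩

/-- A vertex outside a subtree `F` lies beyond one of the edges which lead out of `F`. -/
theorem IsFiniteBSubtree.exists_treeSide (hF : Θ.IsFiniteBSubtree F) (hd : Θ.WhiteDegreeTwo)
    {v : Θ.Black ⊕ Θ.White} (hv : v ∉ F) : ∃ t u, Sum.inl t ∈ F ∧ Sum.inr u ∉ F ∧ Θ.Inc t u ∧
      v ∈ treeSide Θ.tree (Sum.inl t) (Sum.inr u) := by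
  obtain ⟨t₀, ht₀⟩ := hF.exists_black hd
  refine (reachable_induction Θ.isTree (a := Sum.inl t₀) (Q := fun v => v ∈ F ∨ ∃ t u,
    Sum.inl t ∈ F ∧ Sum.inr u ∉ F ∧ Θ.Inc t u ∧
      v ∈ treeSide Θ.tree (Sum.inl t) (Sum.inr u)) (Or.inl ht₀) ?_ v).resolve_left hv
  rintro x y (hx | ⟨t, u, ht, hu, h, hx⟩) hxy
  · by_cases hy : y ∈ F
    · exact Or.inl hy
    rcases x with t | w
    · rcases y with s | u
      · exact absurd hxy (Θ.not_adj_black t s)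
      · exact Or.inr ⟨t, u, hx, hy, hxy, mem_treeSide_self _ _⟩
    · rcases y with s | u
      · exact absurd (hF.2.2 w s hx hxy.symm) hy
      · exact absurd hxy (Θ.not_adj_white w u)
  · by_cases hy : y ∈ treeSide Θ.tree (Sum.inl t) (Sum.inr u)
    · exact Or.inr ⟨t, u, ht, hu, h, hy⟩
    · exact Or.inl ((eq_of_leave_treeSide hx hxy hy).2 ▸ ht)

theorem IsFiniteBSubtree.exists_isIn (hF : Θ.IsFiniteBSubtree F) (hd : Θ.WhiteDegreeTwo)
    (ξ : TreeEnds Θ.tree) : ∃ t u, Sum.inl t ∈ F ∧ Sum.inr u ∉ F ∧ Θ.Inc t u ∧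
      ξ.IsIn (treeSide Θ.tree (Sum.inl t) (Sum.inr u)) := by
  obtain ⟨ρ, rfl⟩ := ξ.exists_ray
  have hfin : {n | ρ.toFun n ∈ F}.Finite := hF.1.preimage ρ.injective.injOn
  obtain ⟨N, hN⟩ := hfin.bddAbove
  have hout : ∀ n ≥ N + 1, ρ.toFun n ∉ F := fun n hn hmem => by
    have := hN hmem
    omega
  obtain ⟨t, u, ht, hu, h, hmem⟩ := hF.exists_treeSide hd (hout _ le_rfl)
  refine ⟨t, u, ht, hu, h, TreeRay.toEnd_isIn.2 ⟨N + 1, fun n hn => ?_⟩⟩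
  induction n, hn using Nat.le_induction with
  | base => exact hmem
  | succ n hn ih =>
    by_contra h'
    exact hout (n + 1) (by omega) ((eq_of_leave_treeSide ih (ρ.adj n) h').2 ▸ ht)

/-- Different edges which lead out of a subtree have disjoint sides. -/
theorem IsFiniteBSubtree.eq_of_mem_treeSide (hF : Θ.IsFiniteBSubtree F) {t t' : Θ.Black}
    {u u' : Θ.White} (ht : Sum.inl t ∈ F) (hu : Sum.inr u ∉ F) (h : Θ.Inc t u)
    (ht' : Sum.inl t' ∈ F) (hu' : Sum.inr u' ∉ F) (h' : Θ.Inc t' u') {v : Θ.Black ⊕ Θ.White}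
    (hv : v ∈ treeSide Θ.tree (Sum.inl t) (Sum.inr u))
    (hv' : v ∈ treeSide Θ.tree (Sum.inl t') (Sum.inr u')) : u = u' := by
  by_contra hne
  have hsub : treeSide Θ.tree (Sum.inl t') (Sum.inr u') ⊆
      treeSide Θ.tree (Sum.inr u) (Sum.inl t) := by
    refine treeSide_subset h' ((notMem_treeSide_iff Θ.isTree h).1 (hF.notMem_treeSide ht hu h ht'))
      fun hmem => hne ?_
    exact Sum.inr_injective (eq_of_leave_treeSide hmem h.symm (hF.notMem_treeSide ht' hu' h' ht)).1
  exact disjoint_left.1 (disjoint_treeSide Θ.isTree h) hv (hsub hv')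

theorem IsFiniteBSubtree.mem_blackBeyond (hF : Θ.IsFiniteBSubtree F) {U : Set Θ.Glued}
    {s : Θ.Black} : s ∈ Θ.blackBeyond F U ↔ ∃ t u, Sum.inl t ∈ F ∧ Θ.Inc t u ∧
      u ∈ Θ.outerNeighborsIn F U ∧
        Sum.inl s ∈ treeSide Θ.tree (Sum.inl t) (Sum.inr u) := by
  classical
  constructor
  · rintro ⟨u, hu, p, -, hp⟩
    obtain ⟨t, ht, h⟩ := hu.1.2
    refine ⟨t, u, ht, h, hu, ?_⟩
    have key : ∀ x y, ∀ q : Θ.tree.Walk x y, (∀ v ∈ q.support, v ∉ F) →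
        x ∈ treeSide Θ.tree (Sum.inl t) (Sum.inr u) →
        y ∈ treeSide Θ.tree (Sum.inl t) (Sum.inr u) := by
      intro x y q
      induction q with
      | nil => exact fun _ h => h
      | @cons x y z hxy q ih =>
        intro hq hx
        rw [SimpleGraph.Walk.support_cons] at hq
        refine ih (fun v hv => hq v (List.mem_cons_of_mem _ hv)) ?_
        by_contra hy
        exact hq y (List.mem_cons_of_mem _ q.start_mem_support)
          ((eq_of_leave_treeSide hx hxy hy).2 ▸ ht)
    exact key _ _ p hp (mem_treeSide_self _ _)
  · rintro ⟨t, u, ht, h, hu, hs⟩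
    obtain ⟨p, hp⟩ := treeSide_induction (T := Θ.tree) (a := Sum.inl t) (b := Sum.inr u)
      (Q := fun v => ∃ p : Θ.tree.Walk (Sum.inr u) v,
        ∀ w ∈ p.support, w ∈ treeSide Θ.tree (Sum.inl t) (Sum.inr u))
      ⟨.nil, fun w hw => by
        rw [SimpleGraph.Walk.support_nil, List.mem_singleton] at hw
        exact hw ▸ mem_treeSide_self _ _⟩
      (by
        rintro x y - ⟨p, hp⟩ hxy hy
        refine ⟨p.concat hxy, fun w hw => ?_⟩
        rw [SimpleGraph.Walk.support_concat, List.mem_append, List.mem_singleton] at hw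
        rcases hw with hw | rfl
        exacts [hp w hw, hy]) _ hs
    exact ⟨u, hu, p.bypass, p.bypass_isPath, fun v hv hvF =>
      hF.notMem_treeSide ht hu.1.1 h hvF (hp v (p.support_bypass_subset_support hv))⟩

theorem IsFiniteBSubtree.mem_endsBeyond (hF : Θ.IsFiniteBSubtree F) {U : Set Θ.Glued}
    {ξ : TreeEnds Θ.tree} : ξ ∈ Θ.endsBeyond F U ↔ ∃ t u, Sum.inl t ∈ F ∧ Θ.Inc t u ∧
      u ∈ Θ.outerNeighborsIn F U ∧ ξ.IsIn (treeSide Θ.tree (Sum.inl t) (Sum.inr u)) := by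
  constructor
  · rintro ⟨ρ, ⟨u, hu, h0⟩, hρ, rfl⟩
    obtain ⟨t, ht, h⟩ := hu.1.2
    refine ⟨t, u, ht, h, hu, TreeRay.toEnd_isIn.2 ⟨0, fun n _ => ?_⟩⟩
    induction n with
    | zero => exact h0 ▸ mem_treeSide_self _ _
    | succ n ih =>
      by_contra h'
      exact hρ (n + 1) ((eq_of_leave_treeSide (ih (Nat.zero_le _)) (ρ.adj n) h').2 ▸ ht)
  · rintro ⟨t, u, ht, h, hu, hξ⟩
    obtain ⟨σ, h0, h1, rfl⟩ := TreeEnds.exists_ray_of_isIn Θ.isTree h hξ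
    refine ⟨⟨fun n => σ.toFun (n + 1), fun n => σ.adj (n + 1), fun m n h => ?_⟩, ⟨u, hu, h1⟩,
      fun n hn => ?_, TreeRay.toEnd_eq_iff.2 ⟨0, 1, fun k => ?_⟩⟩
    · have := σ.injective h
      omega
    · refine hF.notMem_treeSide ht hu.1.1 h hn ?_
      rw [← h0, ← h1]
      exact (σ.mem_side Θ.isTree).2 (Nat.succ_pos n)
    · change σ.toFun (0 + k + 1) = σ.toFun (1 + k)
      congr 1
      omega

theorem IsFiniteBSubtree.point_mem_basicSet (hF : Θ.IsFiniteBSubtree F) {U : Set Θ.Glued}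
    {s : Θ.Black} {x : Θ.K s} : point s x ∈ Θ.basicSet F U ↔ Θ.toGlued s x ∈ U ∨
      ∃ t u, Sum.inl t ∈ F ∧ Θ.Inc t u ∧ u ∈ Θ.outerNeighborsIn F U ∧
        point s x ∈ Θ.beyond (Sum.inl t) (Sum.inr u) := by
  constructor
  · rintro (⟨g, hg, hgx⟩ | ⟨ξ, -, h⟩)
    · obtain rfl := Sum.inl_injective hgx
      rcases hg with hg | hg
      · exact Or.inl hg
      · obtain ⟨r, hr, y, hy⟩ := mem_iUnion₂.1 hg
        obtain ⟨t, u, ht, h, hu, hrs⟩ := hF.mem_blackBeyond.1 hr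
        refine Or.inr ⟨t, u, ht, h, hu, ?_⟩
        rw [show point s x = point r y from congrArg Sum.inl hy.symm]
        exact point_mem_beyond_of_mem hrs y
    · exact absurd h.symm (point_ne_endPoint s x ξ)
  · rintro (h | ⟨t, u, ht, h, hu, hx⟩)
    · exact Or.inl ⟨_, Or.inl h, rfl⟩
    · rcases hx with ⟨r, y, hr, hy⟩ | ⟨ξ, -, h'⟩
      · refine Or.inl ⟨_, Or.inr (mem_iUnion₂.2 ⟨r, hF.mem_blackBeyond.2 ⟨t, u, ht, h, hu, hr⟩,
          y, rfl⟩), ?_⟩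
        exact hy.symm
      · exact absurd h' (point_ne_endPoint s x ξ)

theorem IsFiniteBSubtree.endPoint_mem_basicSet (hF : Θ.IsFiniteBSubtree F) {U : Set Θ.Glued}
    {ξ : TreeEnds Θ.tree} : endPoint ξ ∈ Θ.basicSet F U ↔
      ∃ t u, Sum.inl t ∈ F ∧ Θ.Inc t u ∧ u ∈ Θ.outerNeighborsIn F U ∧
        ξ.IsIn (treeSide Θ.tree (Sum.inl t) (Sum.inr u)) := by
  rw [← hF.mem_endsBeyond]
  constructor
  · rintro (⟨g, -, h⟩ | ⟨ξ', h, h'⟩)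
    · exact absurd h Sum.inl_ne_inr
    · exact Sum.inr_injective h' ▸ h
  · exact fun h => Or.inr ⟨ξ, h, rfl⟩

theorem IsFiniteBSubtree.beyond_subset_basicSet (hF : Θ.IsFiniteBSubtree F) {U : Set Θ.Glued}
    {t : Θ.Black} {u : Θ.White} (ht : Sum.inl t ∈ F) (h : Θ.Inc t u)
    (hu : u ∈ Θ.outerNeighborsIn F U) :
    Θ.beyond (Sum.inl t) (Sum.inr u) ⊆ Θ.basicSet F U := by
  intro z hz
  rcases eq_point_or_endPoint z with ⟨s, x, rfl⟩ | ⟨ξ, rfl⟩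
  · exact hF.point_mem_basicSet.2 (Or.inr ⟨t, u, ht, h, hu, hz⟩)
  · exact hF.endPoint_mem_basicSet.2 ⟨t, u, ht, h, hu, endPoint_mem_beyond.1 hz⟩

theorem IsFiniteBSubtree.point_mem_basicSet_iff (hF : Θ.IsFiniteBSubtree F)
    (hd : Θ.WhiteDegreeTwo) {U : Set Θ.Glued} {t : Θ.Black} (ht : Sum.inl t ∈ F) {x : Θ.K t} :
    point t x ∈ Θ.basicSet F U ↔ Θ.toGlued t x ∈ U := by
  refine hF.point_mem_basicSet.trans ⟨?_, Or.inl⟩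
  rintro (h | ⟨s, u, hs, h, hu, hx⟩)
  · exact h
  · by_cases hts : t = s
    · subst hts
      exact hu.2 (toGlued_mem_gluedPeripheral.2 ⟨h, (point_mem_beyond_self_iff hd h).1 hx⟩)
    · exact absurd ((point_mem_beyond_iff hts).1 hx) (hF.notMem_treeSide hs hu.1.1 h ht)

/-- A set is open in the limit if it traces open sets on the constituent spaces of some finite
subtree and is a union of parts beyond the edges which lead out of this subtree otherwise. -/
theorem IsFiniteBSubtree.isOpen_of_forall (hF : Θ.IsFiniteBSubtree F) (hd : Θ.WhiteDegreeTwo)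
    {G : Set Θ.Limit} (hK : ∀ t, Sum.inl t ∈ F → IsOpen (point t ⁻¹' G))
    (hG : ∀ t u, Sum.inl t ∈ F → Sum.inr u ∉ F → Θ.Inc t u →
      Θ.beyond (Sum.inl t) (Sum.inr u) ⊆ G ∨ Disjoint (Θ.beyond (Sum.inl t) (Sum.inr u)) G) :
    IsOpen G := by
  set U : Set Θ.Glued := {g | g ∈ Θ.partialUnion F ∧ (Sum.inl g : Θ.Limit) ∈ G} with hU
  have hpu : ∀ t, Sum.inl t ∈ F → ∀ x, Θ.toGlued t x ∈ Θ.partialUnion F := fun t ht x =>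
    mem_iUnion₂.2 ⟨t, ht, mem_range_self x⟩
  have hper : ∀ t u, Sum.inl t ∈ F → Θ.Inc t u → Θ.gluedPeripheral u ⊆ Θ.partialUnion F := by
    rintro t u ht h _ ⟨s, hs, p, rfl⟩
    rw [toGlued_eq_iff.2 (Or.inr ⟨u, p, hs, h, rfl, rfl⟩)]
    exact hpu t ht _
  have hN : ∀ t u, Sum.inl t ∈ F → Θ.Inc t u → u ∈ Θ.outerNeighborsIn F U →
      Θ.beyond (Sum.inl t) (Sum.inr u) ⊆ G := by
    intro t u ht h hu
    refine (hG t u ht hu.1.1 h).resolve_right fun hdisj => ?_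
    obtain ⟨p⟩ := Θ.nonemptyP u
    have hp : Θ.toGlued t (Θ.φ t u h p) ∈ Θ.gluedPeripheral u := ⟨t, h, p, rfl⟩
    exact disjoint_left.1 hdisj (peripheral_subset_beyond hd h ⟨_, hp, rfl⟩) (hu.2 hp).2
  refine TopologicalSpace.isOpen_generateFrom_of_mem ⟨F, U, hF, ⟨fun g hg => hg.1, fun t ht => ?_⟩,
    fun u hu => ?_, ?_⟩
  · convert hK t ht using 1
    ext x
    exact and_iff_right (hpu t ht x)
  · obtain ⟨hu, t, ht, h⟩ := hu
    refine (hG t u ht hu h).imp (fun hsub g hg => ?_) fun hdisj => ?_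
    · exact ⟨hper t u ht h hg, hsub (peripheral_subset_beyond hd h ⟨g, hg, rfl⟩)⟩
    · exact disjoint_left.2 fun g hg hgU =>
        disjoint_left.1 hdisj (peripheral_subset_beyond hd h ⟨g, hg, rfl⟩) hgU.2
  · have hNU : ∀ t u, Sum.inl t ∈ F → Sum.inr u ∉ F → Θ.Inc t u → ∀ z ∈ G,
        z ∈ Θ.beyond (Sum.inl t) (Sum.inr u) → u ∈ Θ.outerNeighborsIn F U := by
      intro t u ht hu h z hz hzb
      have hsub := (hG t u ht hu h).resolve_right fun hdisj => disjoint_left.1 hdisj hzb hz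
      exact ⟨⟨hu, t, ht, h⟩, fun g hg => ⟨hper t u ht h hg,
        hsub (peripheral_subset_beyond hd h ⟨g, hg, rfl⟩)⟩⟩
    ext z
    rcases eq_point_or_endPoint z with ⟨s, x, rfl⟩ | ⟨ξ, rfl⟩
    · rw [hF.point_mem_basicSet]
      constructor
      · intro hz
        by_cases hs : Sum.inl s ∈ F
        · exact Or.inl ⟨hpu s hs x, hz⟩
        · obtain ⟨t, u, ht, hu, h, hst⟩ := hF.exists_treeSide hd hs
          have hzb := point_mem_beyond_of_mem hst x
          exact Or.inr ⟨t, u, ht, h, hNU t u ht hu h _ hz hzb, hzb⟩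
      · rintro (hx | ⟨t, u, ht, h, hu, hx⟩)
        exacts [hx.2, hN t u ht h hu hx]
    · rw [hF.endPoint_mem_basicSet]
      constructor
      · intro hz
        obtain ⟨t, u, ht, hu, h, hξ⟩ := hF.exists_isIn hd ξ
        exact ⟨t, u, ht, h, hNU t u ht hu h _ hz (endPoint_mem_beyond.2 hξ), hξ⟩
      · rintro ⟨t, u, ht, h, hu, hξ⟩
        exact hN t u ht h hu (endPoint_mem_beyond.2 hξ)

/-- If the constituent space at a vertex beyond the edge `su` meets a basic set, then this set
contains everything beyond the edge: by saturation if the common point is in the peripheral at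
`u`. -/
theorem IsFiniteBSubtree.mem_outerNeighborsIn (hF : Θ.IsFiniteBSubtree F) {U : Set Θ.Glued}
    (hU : Θ.IsOpenInPartialUnion F U) (hsat : Θ.IsSaturated F U) {s t : Θ.Black} {u : Θ.White}
    (ht : Sum.inl t ∉ F) (hs : Sum.inl s ∈ F) (hu : Sum.inr u ∉ F) (h : Θ.Inc s u)
    (hts : Sum.inl t ∈ treeSide Θ.tree (Sum.inl s) (Sum.inr u)) {x : Θ.K t}
    (hx : point t x ∈ Θ.basicSet F U) : u ∈ Θ.outerNeighborsIn F U := by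
  have key : ∀ s' u', Sum.inl s' ∈ F → Θ.Inc s' u' → u' ∈ Θ.outerNeighborsIn F U →
      Sum.inl t ∈ treeSide Θ.tree (Sum.inl s') (Sum.inr u') → u ∈ Θ.outerNeighborsIn F U := by
    intro s' u' hs' h' hu' hts'
    rwa [hF.eq_of_mem_treeSide hs hu h hs' hu'.1.1 h' hts hts']
  rcases hF.point_mem_basicSet.1 hx with hx | ⟨s', u', hs', h', hu', hx⟩
  · obtain ⟨s', hs', y, hy⟩ := mem_iUnion₂.1 (hU.1 hx)
    have hne : t ≠ s' := fun h => ht (h ▸ hs')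
    rcases toGlued_eq_iff.1 hy with h' | ⟨u', p, h', h'', rfl, rfl⟩
    · cases h'
      exact absurd rfl hne
    · have hu' : Sum.inr u' ∉ F := fun h => ht (hF.2.2 u' t h h'')
      have hout : u' ∈ Θ.outerNeighbors F := ⟨hu', s', hs', h'⟩
      refine key s' u' hs' h' ⟨hout, (hsat u' hout).resolve_right fun hdisj => ?_⟩
        (inl_mem_treeSide h'' hne)
      exact disjoint_left.1 hdisj ⟨t, h'', p, rfl⟩ hx
  · refine key s' u' hs' h' hu' ((point_mem_beyond_iff ?_).1 hx)
    rintro rfl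
    exact ht hs'

end Subtree

theorem continuous_point (hd : Θ.WhiteDegreeTwo) (t : Θ.Black) :
    Continuous (point (Θ := Θ) t) := by
  refine continuous_generateFrom_iff.2 ?_
  rintro _ ⟨F, U, hF, hU, hsat, rfl⟩
  by_cases ht : Sum.inl t ∈ F
  · convert hU.2 t ht using 1
    ext x
    exact hF.point_mem_basicSet_iff hd ht
  · obtain ⟨s, u, hs, hu, h, hts⟩ := hF.exists_treeSide hd ht
    by_cases huU : u ∈ Θ.outerNeighborsIn F U
    · convert isOpen_univ
      exact eq_univ_of_forall fun x =>
        hF.beyond_subset_basicSet hs h huU (point_mem_beyond_of_mem hts x)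
    · convert isOpen_empty
      exact eq_empty_of_forall_notMem fun x hx =>
        huU (hF.mem_outerNeighborsIn hU hsat ht hs hu h hts hx)

/-- A neighbourhood of a point of a constituent space contains the parts of the limit beyond all but
finitely many of those peripherals which come close to the point. -/
theorem exists_nhds_beyond_subset (hd : Θ.WhiteDegreeTwo) {t : Θ.Black} {x : Θ.K t}
    {W : Set Θ.Limit} (hW : W ∈ 𝓝 (point t x)) : ∃ V ∈ 𝓝 x, ∃ E : Set Θ.White, E.Finite ∧
      ∀ u ∉ E, ∀ h : Θ.Inc t u, (range (Θ.φ t u h) ∩ V).Nonempty →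
        Θ.beyond (Sum.inl t) (Sum.inr u) ⊆ W := by
  obtain ⟨G, hGW, hG, hxG⟩ := mem_nhds_iff.1 hW
  suffices hs : ∀ G : Set Θ.Limit, IsOpen G → point t x ∈ G → ∃ V ∈ 𝓝 x, ∃ E : Set Θ.White,
      E.Finite ∧ ∀ u ∉ E, ∀ h : Θ.Inc t u, (range (Θ.φ t u h) ∩ V).Nonempty →
        Θ.beyond (Sum.inl t) (Sum.inr u) ⊆ G by
    obtain ⟨V, hV, E, hE, h⟩ := hs G hG hxG
    exact ⟨V, hV, E, hE, fun u hu h' hne => (h u hu h' hne).trans hGW⟩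
  intro G hG
  induction hG with
  | basic G hmem =>
    intro hx
    obtain ⟨F, U, hF, hU, hsat, rfl⟩ := hmem
    by_cases ht : Sum.inl t ∈ F
    · refine ⟨Θ.toGlued t ⁻¹' U, (hU.2 t ht).mem_nhds ((hF.point_mem_basicSet_iff hd ht).1 hx),
        {u | Sum.inr u ∈ F}, hF.1.preimage Sum.inr_injective.injOn, fun u hu h hne => ?_⟩
      obtain ⟨_, ⟨p, rfl⟩, hpU⟩ := hne
      have hout : u ∈ Θ.outerNeighbors F := ⟨hu, t, ht, h⟩
      refine hF.beyond_subset_basicSet ht h ⟨hout, (hsat u hout).resolve_right fun hdisj => ?_⟩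
      exact disjoint_left.1 hdisj ⟨t, h, p, rfl⟩ hpU
    · obtain ⟨s, u, hs, hu, h, hts⟩ := hF.exists_treeSide hd ht
      have huU := hF.beyond_subset_basicSet hs h
        (hF.mem_outerNeighborsIn hU hsat ht hs hu h hts hx)
      refine ⟨univ, Filter.univ_mem, {u' | Θ.Inc t u' ∧
        Sum.inl s ∈ treeSide Θ.tree (Sum.inl t) (Sum.inr u')}, ?_, fun u' hu' h' _ => ?_⟩
      · refine Set.Subsingleton.finite fun a ha b hb => ?_
        by_contra hne
        exact disjoint_left.1 (disjoint_treeSide_of_ne Θ.isTree ha.1 hb.1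
          fun h => hne (Sum.inr_injective h)) ha.2 hb.2
      · exact (beyond_mono (treeSide_subset h' hts fun hmem => hu' ⟨h', hmem⟩)).trans huU
  | univ => exact fun _ => ⟨univ, Filter.univ_mem, ∅, finite_empty, fun _ _ _ _ => subset_univ _⟩
  | inter A B _ _ ihA ihB =>
    intro hx
    obtain ⟨V, hV, E, hE, h⟩ := ihA hx.1
    obtain ⟨V', hV', E', hE', h'⟩ := ihB hx.2
    refine ⟨V ∩ V', Filter.inter_mem hV hV', E ∪ E', hE.union hE', fun u hu hi hne => ?_⟩
    exact subset_inter
      (h u (fun hu' => hu (Or.inl hu')) hi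
        (hne.mono (inter_subset_inter_right _ inter_subset_left)))
      (h' u (fun hu' => hu (Or.inr hu')) hi
        (hne.mono (inter_subset_inter_right _ inter_subset_right)))
  | sUnion S _ ih =>
    rintro ⟨A, hA, hxA⟩
    obtain ⟨V, hV, E, hE, h⟩ := ih A hA hxA
    exact ⟨V, hV, E, hE, fun u hu hi hne => (h u hu hi hne).trans (subset_sUnion_of_mem hA)⟩

/-- A neighbourhood of an end contains the parts of the limit beyond the edges far out on a ray to
this end. -/
theorem exists_beyond_subset {ρ : TreeRay Θ.tree} {W : Set Θ.Limit}
    (hW : W ∈ 𝓝 (endPoint ρ.toEnd)) :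
    ∃ N, ∀ n ≥ N, Θ.beyond (ρ.toFun n) (ρ.toFun (n + 1)) ⊆ W := by
  obtain ⟨G, hGW, hG, hxG⟩ := mem_nhds_iff.1 hW
  suffices hs : ∀ G : Set Θ.Limit, IsOpen G → endPoint ρ.toEnd ∈ G →
      ∃ N, ∀ n ≥ N, Θ.beyond (ρ.toFun n) (ρ.toFun (n + 1)) ⊆ G by
    obtain ⟨N, hN⟩ := hs G hG hxG
    exact ⟨N, fun n hn => (hN n hn).trans hGW⟩
  intro G hG
  induction hG with
  | basic G hmem =>
    intro hx
    obtain ⟨F, U, hF, hU, hsat, rfl⟩ := hmem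
    obtain ⟨t, u, ht, h, hu, hξ⟩ := hF.endPoint_mem_basicSet.1 hx
    obtain ⟨N, hN⟩ := TreeRay.toEnd_isIn.1 hξ
    obtain ⟨M, hM⟩ := ρ.exists_notMem_side Θ.isTree (Sum.inl t)
    refine ⟨max N M, fun n hn => ?_⟩
    refine (beyond_mono (treeSide_subset (ρ.adj n) (hN n (le_trans (le_max_left _ _) hn))
      fun hmem => hM ?_)).trans (hF.beyond_subset_basicSet ht h hu)
    exact ρ.antitone_side Θ.isTree (le_trans (le_max_right _ _) hn) hmem
  | univ => exact fun _ => ⟨0, fun _ _ => subset_univ _⟩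
  | inter A B _ _ ihA ihB =>
    intro hx
    obtain ⟨N, hN⟩ := ihA hx.1
    obtain ⟨N', hN'⟩ := ihB hx.2
    exact ⟨max N N', fun n hn => subset_inter (hN n (le_trans (le_max_left _ _) hn))
      (hN' n (le_trans (le_max_right _ _) hn))⟩
  | sUnion S _ ih =>
    rintro ⟨A, hA, hxA⟩
    obtain ⟨N, hN⟩ := ih A hA hxA
    exact ⟨N, fun n hn => (hN n hn).trans (subset_sUnion_of_mem hA)⟩

/-- The subtree spanned by `t`, the white vertices in `D` and their neighbours. -/
def star (t : Θ.Black) (D : Set Θ.White) : Set (Θ.Black ⊕ Θ.White) :=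
  {v | v = Sum.inl t ∨ (∃ u ∈ D, v = Sum.inr u) ∨ ∃ u ∈ D, ∃ s, Θ.Inc s u ∧ v = Sum.inl s}

theorem isFiniteBSubtree_star {t : Θ.Black} {D : Set Θ.White} (hD : D.Finite)
    (h : ∀ u ∈ D, Θ.Inc t u) : Θ.IsFiniteBSubtree (star t D) := by
  refine ⟨?_, ⟨?_, Θ.isTree.2.induce _⟩, ?_⟩
  · refine ((finite_singleton (Sum.inl t)).union ((hD.image Sum.inr).union
      (hD.biUnion fun u _ => (Θ.finite_degree u).image Sum.inl))).subset ?_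
    rintro v (rfl | ⟨u, hu, rfl⟩ | ⟨u, hu, s, hs, rfl⟩)
    · exact Or.inl rfl
    · exact Or.inr (Or.inl ⟨u, hu, rfl⟩)
    · exact Or.inr (Or.inr (mem_iUnion₂.2 ⟨u, hu, s, hs, rfl⟩))
  · have ht : Sum.inl t ∈ star t D := Or.inl rfl
    have hw : ∀ u (hu : u ∈ D), (Θ.tree.induce (star t D)).Reachable ⟨Sum.inl t, ht⟩
        ⟨Sum.inr u, Or.inr (Or.inl ⟨u, hu, rfl⟩)⟩ := fun u hu =>
      SimpleGraph.Adj.reachable (show Θ.tree.Adj _ _ from h u hu)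
    rw [SimpleGraph.connected_iff_exists_forall_reachable]
    refine ⟨⟨Sum.inl t, ht⟩, ?_⟩
    rintro ⟨v, rfl | ⟨u, hu, rfl⟩ | ⟨u, hu, s, hs, rfl⟩⟩
    · rfl
    · exact hw u hu
    · exact (hw u hu).trans (SimpleGraph.Adj.reachable (show Θ.tree.Adj _ _ from hs.symm))
  · rintro u s (hu | ⟨u', hu, h'⟩ | ⟨u', hu, r, hr, h'⟩) hs
    · cases hu
    · obtain rfl := Sum.inr_injective h'
      exact Or.inr (Or.inr ⟨u, hu, s, hs, rfl⟩)
    · cases h'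

/-- A criterion for open sets by their traces on the constituent spaces of a star-shaped subtree. -/
theorem isOpen_of_star (hd : Θ.WhiteDegreeTwo) {t : Θ.Black} {D : Set Θ.White} (hD : D.Finite)
    (hinc : ∀ u ∈ D, Θ.Inc t u) {G : Set Θ.Limit} (h1 : IsOpen (point t ⁻¹' G))
    (h2 : ∀ u ∈ D, ∀ s, Θ.Inc s u → s ≠ t → IsOpen (point s ⁻¹' G))
    (h3 : ∀ u ∉ D, Θ.Inc t u → Θ.beyond (Sum.inl t) (Sum.inr u) ⊆ G ∨
      Disjoint (Θ.beyond (Sum.inl t) (Sum.inr u)) G)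
    (h4 : ∀ u ∈ D, ∀ s, Θ.Inc s u → s ≠ t → ∀ u' ≠ u, Θ.Inc s u' →
      Θ.beyond (Sum.inl s) (Sum.inr u') ⊆ G ∨ Disjoint (Θ.beyond (Sum.inl s) (Sum.inr u')) G) :
    IsOpen G := by
  refine (isFiniteBSubtree_star hD hinc).isOpen_of_forall hd ?_ ?_
  · rintro s (h | ⟨u, hu, h⟩ | ⟨u, hu, s', hs, h⟩)
    · obtain rfl := Sum.inl_injective h
      exact h1
    · cases h
    · obtain rfl := Sum.inl_injective h
      by_cases hst : s = t
      · exact hst ▸ h1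
      · exact h2 u hu s hs hst
  · intro s u hs hu hsu
    have huD : u ∉ D := fun h => hu (Or.inr (Or.inl ⟨u, h, rfl⟩))
    rcases hs with h | ⟨u', hu', h⟩ | ⟨u', hu', s', hs, h⟩
    · obtain rfl := Sum.inl_injective h
      exact h3 u huD hsu
    · cases h
    · obtain rfl := Sum.inl_injective h
      by_cases hst : s = t
      · subst hst
        exact h3 u huD hsu
      · exact h4 u' hu' s hs hst u (fun h => huD (h ▸ hu')) hsu

/-- A set whose traces on the constituent space at `t` and the parts beyond its peripherals are
known is open; the case of the one-vertex subtree. -/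
theorem isOpen_of_black (hd : Θ.WhiteDegreeTwo) {t : Θ.Black} {G : Set Θ.Limit}
    (h1 : IsOpen (point t ⁻¹' G))
    (h2 : ∀ u, Θ.Inc t u → Θ.beyond (Sum.inl t) (Sum.inr u) ⊆ G ∨
      Disjoint (Θ.beyond (Sum.inl t) (Sum.inr u)) G) : IsOpen G :=
  isOpen_of_star hd finite_empty (by simp) h1 (by simp) (fun u _ => h2 u) (by simp)

theorem isClosed_beyond_inl (hd : Θ.WhiteDegreeTwo) {t : Θ.Black} {u : Θ.White} (h : Θ.Inc t u) :
    IsClosed (Θ.beyond (Sum.inl t) (Sum.inr u)) := by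
  refine ⟨isOpen_of_black hd (t := t) ?_ fun u' h' => ?_⟩
  · convert (isClosed_range_φ h).isOpen_compl using 1
    ext x
    exact not_congr (point_mem_beyond_self_iff hd h)
  · by_cases hne : u' = u
    · subst hne
      exact Or.inr disjoint_compl_right
    · exact Or.inl (disjoint_beyond hd h' h hne).subset_compl_right

theorem isClosed_beyond (hd : Θ.WhiteDegreeTwo) {a b : Θ.Black ⊕ Θ.White} (hab : Θ.tree.Adj a b) :
    IsClosed (Θ.beyond a b) := by
  rcases a with t | u <;> rcases b with s | u'
  · exact absurd hab (Θ.not_adj_black t s)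
  · exact isClosed_beyond_inl hd hab
  · obtain ⟨t, ht, hne, -⟩ := hd.exists_other hab.symm
    rw [beyond_inr_inl hd ht hab.symm hne.symm]
    exact isClosed_beyond_inl hd ht
  · exact absurd hab (Θ.not_adj_white u u')

theorem beyond_union_beyond (a b : Θ.Black ⊕ Θ.White) (hab : Θ.tree.Adj a b) (z : Θ.Limit) :
    z ∈ Θ.beyond a b ∨ z ∈ Θ.beyond b a := by
  rcases eq_point_or_endPoint z with ⟨s, x, rfl⟩ | ⟨ξ, rfl⟩
  · exact (mem_treeSide_or Θ.isTree a b (Sum.inl s)).imp (point_mem_beyond_of_mem · x)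
      (point_mem_beyond_of_mem · x)
  · exact (ξ.isIn_treeSide_or Θ.isTree hab).imp endPoint_mem_beyond.2 endPoint_mem_beyond.2

theorem endPoint_notMem_beyond {a b : Θ.Black ⊕ Θ.White} (hab : Θ.tree.Adj a b)
    {ξ : TreeEnds Θ.tree} (hξ : ξ.IsIn (treeSide Θ.tree a b)) : endPoint ξ ∉ Θ.beyond b a :=
  fun h => hξ.not_disjoint (endPoint_mem_beyond.1 h) (disjoint_treeSide Θ.isTree hab)

/-- The two parts into which an edge divides the limit meet in a peripheral. -/
theorem beyond_inter_beyond (hd : Θ.WhiteDegreeTwo) {s : Θ.Black} {u : Θ.White} (h : Θ.Inc s u) :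
    Θ.beyond (Sum.inr u) (Sum.inl s) ∩ Θ.beyond (Sum.inl s) (Sum.inr u) ⊆ Θ.peripheral u := by
  rintro _ ⟨⟨r, x, hr, rfl⟩ | ⟨ξ, hξ, rfl⟩, hz⟩
  · by_cases hrs : r = s
    · subst hrs
      exact (point_mem_peripheral h).2 ((point_mem_beyond_self_iff hd h).1 hz)
    · exact absurd ((point_mem_beyond_iff hrs).1 hz)
        (disjoint_left.1 (disjoint_treeSide Θ.isTree h.symm) hr)
  · exact absurd hz (endPoint_notMem_beyond h.symm hξ)

theorem exists_of_mem_beyond_inr (hd : Θ.WhiteDegreeTwo) {s : Θ.Black} {u : Θ.White}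
    (h : Θ.Inc s u) {z : Θ.Limit} (hz : z ∈ Θ.beyond (Sum.inr u) (Sum.inl s)) :
    (∃ x, z = point s x) ∨ ∃ u', u' ≠ u ∧ Θ.Inc s u' ∧ z ∈ Θ.beyond (Sum.inl s) (Sum.inr u') := by
  rcases exists_mem_beyond s z with hx | ⟨u', h', hz'⟩
  · exact Or.inl hx
  · by_cases hne : u' = u
    · subst hne
      have := beyond_inter_beyond hd h ⟨hz, hz'⟩
      rw [peripheral_eq h] at this
      obtain ⟨x, -, rfl⟩ := this
      exact Or.inl ⟨x, rfl⟩
    · exact Or.inr ⟨u', hne, h', hz'⟩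

theorem beyond_subset_beyond_inr {s : Θ.Black} {u u' : Θ.White} (h : Θ.Inc s u)
    (h' : Θ.Inc s u') (hne : u' ≠ u) :
    Θ.beyond (Sum.inl s) (Sum.inr u') ⊆ Θ.beyond (Sum.inr u) (Sum.inl s) :=
  beyond_mono (treeSide_subset_of_adj Θ.isTree h.symm h' fun h => hne (Sum.inr_injective h))

theorem point_mem_beyond_inr (u : Θ.White) {s : Θ.Black} (x : Θ.K s) :
    point s x ∈ Θ.beyond (Sum.inr u) (Sum.inl s) :=
  point_mem_beyond_of_mem (mem_treeSide_self _ _) x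

/-! ### Connectedness of the limit -/

theorem range_φ_mem_peripherals {s : Θ.Black} {u : Θ.White} (h : Θ.Inc s u) :
    range (Θ.φ s u h) ∈ Θ.peripherals s :=
  ⟨u, h, rfl⟩

/-- If `f` is constant beyond each peripheral of a constituent space except possibly one, then it is
constant on this space, also after removal of points of the exceptional peripheral. -/
theorem constOn_point_compl (hd : Θ.WhiteDegreeTwo) {s : Θ.Black}
    (hg : IsGraphlike (Θ.peripherals s)) {u : Θ.White} (h : Θ.Inc s u) {f : Θ.Limit → Bool}
    {R : Set (Θ.K s)} (hR : R ⊆ range (Θ.φ s u h)) (hf : ContinuousOn f (point s '' Rᶜ))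
    (hconst : ∀ u' ≠ u, Θ.Inc s u' → ConstOn f (Θ.beyond (Sum.inl s) (Sum.inr u'))) :
    ConstOn f (point s '' Rᶜ) := by
  have hfc : ContinuousOn (f ∘ point s) Rᶜ :=
    hf.comp (continuous_point hd s).continuousOn fun x hx => mem_image_of_mem _ hx
  have hsub : (range (Θ.φ s u h))ᶜ ⊆ Rᶜ := compl_subset_compl.2 hR
  have hc := hg.constOn_compl _ (range_φ_mem_peripherals h) (f ∘ point s) (hfc.mono hsub) (by
    rintro _ ⟨u', h', rfl⟩ hne x hx y hy
    have hne' : u' ≠ u := by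
      rintro rfl
      exact hne rfl
    exact hconst u' hne' h' _ ((point_mem_beyond_self_iff hd h').2 hx) _
      ((point_mem_beyond_self_iff hd h').2 hy))
  have := hc.of_dense hfc hsub fun x _ => hg.dense_compl _ (range_φ_mem_peripherals h) x
  rintro _ ⟨x, hx, rfl⟩ _ ⟨y, hy, rfl⟩
  exact this x hx y hy

/-- A two-valued function which is constant on the constituent space at `s` without `R` is constant
on sets of such points together with parts beyond peripherals, if it is constant on these parts and
the peripherals are not contained in `R`. -/
theorem constOn_of_point (hd : Θ.WhiteDegreeTwo) {s : Θ.Black} {f : Θ.Limit → Bool}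
    {R : Set (Θ.K s)} {S : Set Θ.Limit} (hK : ConstOn f (point s '' Rᶜ))
    (hS : ∀ z ∈ S, (∃ x ∉ R, z = point s x) ∨ ∃ u, ∃ h : Θ.Inc s u,
      ConstOn f (Θ.beyond (Sum.inl s) (Sum.inr u)) ∧ z ∈ Θ.beyond (Sum.inl s) (Sum.inr u) ∧
        ¬ range (Θ.φ s u h) ⊆ R) : ConstOn f S := by
  have key : ∀ z ∈ S, ∃ w ∈ point s '' Rᶜ, f z = f w := by
    intro z hz
    rcases hS z hz with ⟨x, hx, rfl⟩ | ⟨u, h, hc, hzu, hR⟩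
    · exact ⟨_, mem_image_of_mem _ hx, rfl⟩
    · obtain ⟨x, hx, hxR⟩ := not_subset.1 hR
      exact ⟨_, mem_image_of_mem _ hxR, hc _ hzu _ ((point_mem_beyond_self_iff hd h).2 hx)⟩
  intro z hz z' hz'
  obtain ⟨w, hw, h⟩ := key z hz
  obtain ⟨w', hw', h'⟩ := key z' hz'
  rw [h, h', hK w hw w' hw']

/-- The part of the limit beyond an edge is connected: a continuous two-valued function on it is
constant near each end, and if it is constant beyond all other peripherals of a constituent space,
then it is constant on this space. -/
theorem isPreconnected_beyond (hd : Θ.WhiteDegreeTwo)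
    (hg : ∀ t, IsGraphlike (Θ.peripherals t)) {a b : Θ.Black ⊕ Θ.White}
    (hab : Θ.tree.Adj a b) : IsPreconnected (Θ.beyond a b) := by
  refine isPreconnected_of_forall_constant fun f hf => ?_
  suffices h : Θ.beyond a b ⊆ Θ.beyond a b → ConstOn f (Θ.beyond a b) from h Subset.rfl
  refine treeSide_noetherian_induction Θ.isTree
    (Q := fun x y => Θ.beyond x y ⊆ Θ.beyond a b → ConstOn f (Θ.beyond x y)) ?_ ?_ hab
  · rintro x (s | u) hxy ih hsub
    · rcases x with t | u
      · exact absurd hxy (Θ.not_adj_black t s)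
      have hc : ∀ u' ≠ u, Θ.Inc s u' → ConstOn f (Θ.beyond (Sum.inl s) (Sum.inr u')) :=
        fun u' hne h' => ih _ h' (fun h => hne (Sum.inr_injective h))
          ((beyond_subset_beyond_inr hxy.symm h' hne).trans hsub)
      refine constOn_of_point hd (R := ∅) (constOn_point_compl hd (hg s) hxy.symm
        (empty_subset _) (hf.mono ?_) hc) fun z hz => ?_
      · rintro _ ⟨x, -, rfl⟩
        exact hsub (point_mem_beyond_inr u x)
      · rcases exists_of_mem_beyond_inr hd hxy.symm hz with ⟨x, rfl⟩ | ⟨u', hne, h', hz'⟩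
        · exact Or.inl ⟨x, notMem_empty x, rfl⟩
        · exact Or.inr ⟨u', h', hc u' hne h', hz',
            fun h => ((hg s).nontrivial _ (range_φ_mem_peripherals h')).nonempty.not_subset_empty h⟩
    · rcases x with t | w
      · obtain ⟨s, hs, hne, -⟩ := hd.exists_other hxy
        rw [← beyond_inr_inl hd hxy hs hne] at hsub ⊢
        exact ih _ hs.symm (fun h => hne (Sum.inl_injective h)) hsub
      · exact absurd hxy (Θ.not_adj_white w u)
  · intro ρ
    by_cases hρ : endPoint ρ.toEnd ∈ Θ.beyond a b
    · have h1 : f ⁻¹' {f (endPoint ρ.toEnd)} ∈ 𝓝[Θ.beyond a b] endPoint ρ.toEnd :=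
        hf _ hρ (by simp [nhds_discrete])
      obtain ⟨W, hW, hWf⟩ := mem_nhdsWithin_iff_exists_mem_nhds_inter.1 h1
      obtain ⟨N, hN⟩ := exists_beyond_subset hW
      refine ⟨N, fun hsub x hx y hy => ?_⟩
      have hx' : f x = _ := hWf ⟨hN N le_rfl hx, hsub hx⟩
      have hy' : f y = _ := hWf ⟨hN N le_rfl hy, hsub hy⟩
      rw [hx', hy']
    · obtain ⟨N, hN⟩ := exists_beyond_subset ((isClosed_beyond hd hab).isOpen_compl.mem_nhds hρ)
      exact ⟨N, fun hsub x hx => absurd (hsub hx) (hN N le_rfl hx)⟩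

/-- The part of the limit beyond an edge stays connected when a point of the peripheral at this edge
is removed. -/
theorem isPreconnected_beyond_diff (hd : Θ.WhiteDegreeTwo)
    (hg : ∀ t, IsGraphlike (Θ.peripherals t)) {s : Θ.Black} {u : Θ.White} (h : Θ.Inc s u)
    {x : Θ.K s} (hx : x ∈ range (Θ.φ s u h)) :
    IsPreconnected (Θ.beyond (Sum.inr u) (Sum.inl s) \ {point s x}) := by
  refine isPreconnected_of_forall_constant fun f hf => ?_
  have hc : ∀ u' ≠ u, Θ.Inc s u' → ConstOn f (Θ.beyond (Sum.inl s) (Sum.inr u')) := by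
    intro u' hne h'
    refine fun z hz w hw => (isPreconnected_beyond hd hg h').constant (hf.mono ?_) hz hw
    refine fun z hz => ⟨beyond_subset_beyond_inr h h' hne hz, ?_⟩
    rintro rfl
    exact disjoint_left.1 (Θ.disjoint_φ s u u' h h' hne.symm) hx
      ((point_mem_beyond_self_iff hd h').1 hz)
  have hK := constOn_point_compl hd (hg s) h (R := {x}) (singleton_subset_iff.2 hx) (hf.mono (by
    rintro _ ⟨y, hy, rfl⟩
    exact ⟨point_mem_beyond_inr u y, fun h => hy (point_injective s h)⟩)) hc
  refine constOn_of_point hd hK fun z hz => ?_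
  rcases exists_of_mem_beyond_inr hd h hz.1 with ⟨y, rfl⟩ | ⟨u', hne, h', hz'⟩
  · exact Or.inl ⟨y, fun h => hz.2 (by rw [h]; rfl), rfl⟩
  · refine Or.inr ⟨u', h', hc u' hne h', hz', fun h => ?_⟩
    exact ((hg s).nontrivial _ (range_φ_mem_peripherals h')).not_subset_singleton h

theorem nonempty_black (hd : Θ.WhiteDegreeTwo) : Nonempty Θ.Black := by
  obtain ⟨t | u⟩ := Θ.isTree.1.nonempty
  · exact ⟨t⟩
  · exact ⟨(hd.exists_inc u).choose⟩

/-- The parts of the limit on both sides of an edge are connected and share a peripheral. -/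
theorem connectedSpace_limit (hd : Θ.WhiteDegreeTwo)
    (hg : ∀ t, IsGraphlike (Θ.peripherals t)) : ConnectedSpace Θ.Limit := by
  obtain ⟨t⟩ := nonempty_black hd
  obtain ⟨_, u, h, -⟩ := (hg t).nonempty
  obtain ⟨x⟩ := Θ.nonemptyK t
  obtain ⟨p⟩ := Θ.nonemptyP u
  have : IsPreconnected (univ : Set Θ.Limit) := by
    have huniv : univ = Θ.beyond (Sum.inr u) (Sum.inl t) ∪ Θ.beyond (Sum.inl t) (Sum.inr u) :=
      (eq_univ_of_forall fun z => beyond_union_beyond _ _ h.symm z).symm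
    rw [huniv]
    exact IsPreconnected.union (point t (Θ.φ t u h p)) (point_mem_beyond_inr u _)
      ((point_mem_beyond_self_iff hd h).2 (mem_range_self p))
      (isPreconnected_beyond hd hg h.symm) (isPreconnected_beyond hd hg h)
  exact { isPreconnected_univ := this, toNonempty := ⟨point t x⟩ }

/-- The limit has no cutpoint. For a point of a constituent space this comes from the corresponding
property of punctured 2-connected graphs, as the parts beyond the peripherals are connected. -/
theorem not_isCutpoint (hd : Θ.WhiteDegreeTwo)
    (hg : ∀ t, IsGraphlike (Θ.peripherals t)) (z : Θ.Limit) : ¬ IsCutpoint z := by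
  rw [IsCutpoint, not_not]
  rcases eq_point_or_endPoint z with ⟨t, x, rfl⟩ | ⟨ξ, rfl⟩
  · by_cases hper : ∃ u, ∃ h : Θ.Inc t u, x ∈ range (Θ.φ t u h)
    · -- the point lies in a peripheral; both parts beyond it stay connected and keep a common point
      obtain ⟨u, h, hx⟩ := hper
      obtain ⟨s, hs, hne, -⟩ := hd.exists_other h
      obtain ⟨y, hy, hyx⟩ := ((hg t).nontrivial _ (range_φ_mem_peripherals h)).exists_ne x
      have hxs : ∃ x' ∈ range (Θ.φ s u hs), point t x = point s x' := by
        obtain ⟨p, rfl⟩ := hx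
        exact ⟨_, mem_range_self p, point_φ_eq h hs p⟩
      obtain ⟨x', hx', hxx⟩ := hxs
      have h1 := isPreconnected_beyond_diff hd hg h hx
      have h2 := isPreconnected_beyond_diff hd hg hs hx'
      rw [← hxx, beyond_inr_inl hd h hs hne] at h2
      have huniv : ({point t x}ᶜ : Set Θ.Limit) =
          (Θ.beyond (Sum.inr u) (Sum.inl t) \ {point t x}) ∪
            (Θ.beyond (Sum.inl t) (Sum.inr u) \ {point t x}) := by
        have hu : Θ.beyond (Sum.inr u) (Sum.inl t) ∪ Θ.beyond (Sum.inl t) (Sum.inr u) = univ :=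
          eq_univ_of_forall fun z => beyond_union_beyond _ _ h.symm z
        rw [← union_sdiff_distrib, hu, compl_eq_univ_sdiff]
      rw [huniv]
      have hyx' : point t y ∉ ({point t x} : Set Θ.Limit) := fun h => hyx (point_injective t h)
      exact IsPreconnected.union (point t y) ⟨point_mem_beyond_inr u y, hyx'⟩
        ⟨(point_mem_beyond_self_iff hd h).2 hy, hyx'⟩ h1 h2
    · push Not at hper
      refine isPreconnected_of_forall_constant fun f hf => ?_
      have hc : ∀ u, Θ.Inc t u → ConstOn f (Θ.beyond (Sum.inl t) (Sum.inr u)) := by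
        intro u h
        refine fun z hz w hw => (isPreconnected_beyond hd hg h).constant (hf.mono ?_) hz hw
        rintro z hz rfl
        exact hper u h ((point_mem_beyond_self_iff hd h).1 hz)
      have hK := (hg t).constOn_compl_singleton x (by
          rintro _ ⟨u, h, rfl⟩
          exact hper u h) (f ∘ point t)
        (hf.comp (continuous_point hd t).continuousOn fun y hy h => hy (point_injective t h)) (by
          rintro _ ⟨u, h, rfl⟩ y hy z hz
          exact hc u h _ ((point_mem_beyond_self_iff hd h).2 hy) _
            ((point_mem_beyond_self_iff hd h).2 hz))
      refine constOn_of_point hd (R := {x}) (s := t) ?_ fun z hz => ?_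
      · rintro _ ⟨y, hy, rfl⟩ _ ⟨z, hz, rfl⟩
        exact hK y hy z hz
      · rcases exists_mem_beyond t z with ⟨y, rfl⟩ | ⟨u, h, hz'⟩
        · exact Or.inl ⟨y, fun h => hz (by rw [h]; rfl), rfl⟩
        · refine Or.inr ⟨u, h, hc u h, hz', fun h' => ?_⟩
          exact ((hg t).nontrivial _ (range_φ_mem_peripherals h)).not_subset_singleton h'
  · -- the complement of an end is the increasing union of the parts behind the edges of a ray
    obtain ⟨ρ, rfl⟩ := ξ.exists_ray
    have hcompl : ({endPoint ρ.toEnd}ᶜ : Set Θ.Limit) =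
        ⋃ n, Θ.beyond (ρ.toFun (n + 2)) (ρ.toFun (n + 1)) := by
      ext z
      rw [mem_iUnion]
      constructor
      · intro hz
        rcases eq_point_or_endPoint z with ⟨s, x, rfl⟩ | ⟨ξ', rfl⟩
        · obtain ⟨n, hn⟩ := ρ.exists_notMem_side Θ.isTree (Sum.inl s)
          refine ⟨n, point_mem_beyond_of_mem
            ((notMem_treeSide_iff Θ.isTree (ρ.adj _)).1 fun h => ?_) x⟩
          exact hn (ρ.antitone_side Θ.isTree (Nat.le_succ n) h)
        · have : ∃ n, ¬ ξ'.IsIn (ρ.side n) := by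
            by_contra! h
            exact hz (by rw [TreeRay.toEnd_eq_of_isIn_side Θ.isTree h]; rfl)
          obtain ⟨n, hn⟩ := this
          refine ⟨n, endPoint_mem_beyond.2 ((TreeEnds.not_isIn_treeSide_iff Θ.isTree
            (ρ.adj _)).1 fun h => hn ?_)⟩
          exact TreeEnds.IsIn.mono h (ρ.antitone_side Θ.isTree (Nat.le_succ n))
      · rintro ⟨n, hn⟩ rfl
        exact endPoint_notMem_beyond (ρ.adj _) (ρ.toEnd_isIn_side Θ.isTree (n + 1)) hn
    have hblack : ∃ t m, m ≤ 1 ∧ ρ.toFun m = Sum.inl t := by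
      rcases h0 : ρ.toFun 0 with t | u
      · exact ⟨t, 0, zero_le_one, h0⟩
      · rcases h1 : ρ.toFun 1 with t | u'
        · exact ⟨t, 1, le_rfl, h1⟩
        · have := ρ.adj 0
          rw [h0, h1] at this
          exact absurd this (Θ.not_adj_white u u')
    obtain ⟨t, m, hm, ht⟩ := hblack
    obtain ⟨x⟩ := Θ.nonemptyK t
    rw [hcompl]
    refine isPreconnected_iUnion ⟨point t x, mem_iInter.2 fun n => ?_⟩
      fun n => isPreconnected_beyond hd hg (ρ.adj _).symm
    refine point_mem_beyond_of_mem ((notMem_treeSide_iff Θ.isTree (ρ.adj _)).1 fun h => ?_) x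
    rw [← ht] at h
    have := (ρ.mem_side Θ.isTree).1 h
    omega

/-! ### Compactness of the limit -/

section Compactness

variable {C : Set Θ.Limit → Prop}

/-- A property of sets which is inherited by subsets and finite unions and holds locally passes to a
set which is composed of points of a constituent space and of the parts beyond some of its
peripherals, if it holds for these parts. -/
theorem property_of_beyond (hd : Θ.WhiteDegreeTwo) (hempty : C ∅)
    (hmono : ∀ S S', S ⊆ S' → C S' → C S) (hunion : ∀ S S', C S → C S' → C (S ∪ S'))
    (hnhds : ∀ z, ∃ W ∈ 𝓝 z, C W) {s : Θ.Black} {D : Set Θ.White} {S : Set Θ.Limit}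
    (hD : ∀ u ∈ D, Θ.Inc s u → C (Θ.beyond (Sum.inl s) (Sum.inr u)))
    (hS : ∀ z ∈ S, (∃ x, z = point s x) ∨
      ∃ u ∈ D, Θ.Inc s u ∧ z ∈ Θ.beyond (Sum.inl s) (Sum.inr u)) : C S := by
  -- the points of `V` and the parts beyond the relevant peripherals which meet `V`
  let N : Set (Θ.K s) → Set Θ.Limit := fun V => {z | (∃ x ∈ V, z = point s x) ∨
    ∃ u ∈ D, ∃ h : Θ.Inc s u, (range (Θ.φ s u h) ∩ V).Nonempty ∧
      z ∈ Θ.beyond (Sum.inl s) (Sum.inr u)}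
  have hNmono : ∀ V V', V ⊆ V' → N V ⊆ N V' := by
    rintro V V' hV z (⟨x, hx, rfl⟩ | ⟨u, hu, h, hne, hz⟩)
    · exact Or.inl ⟨x, hV hx, rfl⟩
    · exact Or.inr ⟨u, hu, h, hne.mono (inter_subset_inter_right _ hV), hz⟩
  have hfin : ∀ E : Set Θ.White, E.Finite →
      C (⋃ u ∈ {u ∈ E | u ∈ D ∧ Θ.Inc s u}, Θ.beyond (Sum.inl s) (Sum.inr u)) := by
    intro E hE
    induction E, hE using Set.Finite.induction_on with
    | empty => simpa using hempty
    | @insert a E _ _ ih =>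
      by_cases ha : a ∈ D ∧ Θ.Inc s a
      · refine hmono _ _ ?_ (hunion _ _ (hD a ha.1 ha.2) ih)
        refine iUnion₂_subset fun u hu => ?_
        rcases hu.1 with rfl | h
        · exact subset_union_left
        · exact (subset_biUnion_of_mem (u := fun u => Θ.beyond (Sum.inl s) (Sum.inr u))
            (show u ∈ {u ∈ E | u ∈ D ∧ Θ.Inc s u} from ⟨h, hu.2⟩)).trans subset_union_right
      · refine hmono _ _ (biUnion_subset_biUnion_left ?_) ih
        rintro u ⟨rfl | h, hu⟩
        exacts [absurd hu ha, ⟨h, hu⟩]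
  have hC : C (N univ) := by
    refine isCompact_univ.induction_on (p := fun V => C (N V)) ?_
      (fun V V' hV h => hmono _ _ (hNmono V V' hV) h) (fun V V' h h' => ?_) fun x _ => ?_
    · refine hmono _ _ ?_ hempty
      rintro z (⟨x, hx, -⟩ | ⟨u, -, h, ⟨y, -, hy⟩, -⟩)
      exacts [hx, hy]
    · refine hmono _ _ ?_ (hunion _ _ h h')
      rintro z (⟨x, hx | hx, rfl⟩ | ⟨u, hu, h, ⟨y, hy, hyV | hyV⟩, hz⟩)
      · exact Or.inl (Or.inl ⟨x, hx, rfl⟩)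
      · exact Or.inr (Or.inl ⟨x, hx, rfl⟩)
      · exact Or.inl (Or.inr ⟨u, hu, h, ⟨y, hy, hyV⟩, hz⟩)
      · exact Or.inr (Or.inr ⟨u, hu, h, ⟨y, hy, hyV⟩, hz⟩)
    · obtain ⟨W, hW, hCW⟩ := hnhds (point s x)
      obtain ⟨V, hV, E, hE, hVE⟩ := exists_nhds_beyond_subset hd hW
      refine ⟨V ∩ point s ⁻¹' W, mem_nhdsWithin_of_mem_nhds (Filter.inter_mem hV
        ((continuous_point hd s).continuousAt.preimage_mem_nhds hW)),
        hmono _ _ ?_ (hunion _ _ hCW (hfin E hE))⟩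
      rintro z (⟨y, hy, rfl⟩ | ⟨u, hu, h, ⟨y, hy, hyV⟩, hz⟩)
      · exact Or.inl hy.2
      · by_cases huE : u ∈ E
        · exact Or.inr (mem_biUnion (show u ∈ {u ∈ E | u ∈ D ∧ Θ.Inc s u} from ⟨huE, hu, h⟩) hz)
        · exact Or.inl (hVE u huE h ⟨y, hy, hyV.1⟩ hz)
  refine hmono _ _ (fun z hz => ?_) hC
  rcases hS z hz with ⟨x, rfl⟩ | ⟨u, hu, h, hz⟩
  · exact Or.inl ⟨x, mem_univ x, rfl⟩
  · obtain ⟨p⟩ := Θ.nonemptyP u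
    exact Or.inr ⟨u, hu, h, ⟨_, mem_range_self p, mem_univ _⟩, hz⟩

/-- A property of sets which is inherited by subsets and finite unions and holds locally holds for
the whole limit: near each end it holds beyond some edge, and it passes from the parts beyond the
edges at a vertex to the part beyond the edge which leads to this vertex. -/
theorem property_univ (hd : Θ.WhiteDegreeTwo) (hempty : C ∅)
    (hmono : ∀ S S', S ⊆ S' → C S' → C S) (hunion : ∀ S S', C S → C S' → C (S ∪ S'))
    (hnhds : ∀ z, ∃ W ∈ 𝓝 z, C W) : C univ := by
  have hC : ∀ a b, Θ.tree.Adj a b → C (Θ.beyond a b) := by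
    intro a b hab
    refine treeSide_noetherian_induction Θ.isTree (Q := fun x y => C (Θ.beyond x y)) ?_ ?_ hab
    · rintro x (s | u) hxy ih
      · rcases x with t | u
        · exact absurd hxy (Θ.not_adj_black t s)
        refine property_of_beyond hd hempty hmono hunion hnhds (s := s) (D := {u' | u' ≠ u})
          (fun u' hne h' => ih _ h' fun h => hne (Sum.inr_injective h)) fun z hz => ?_
        exact exists_of_mem_beyond_inr hd hxy.symm hz
      · rcases x with t | w
        · obtain ⟨s, hs, hne, -⟩ := hd.exists_other hxy
          rw [← beyond_inr_inl hd hxy hs hne]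
          exact ih _ hs.symm (fun h => hne (Sum.inl_injective h))
        · exact absurd hxy (Θ.not_adj_white w u)
    · intro ρ
      obtain ⟨W, hW, hCW⟩ := hnhds (endPoint ρ.toEnd)
      obtain ⟨N, hN⟩ := exists_beyond_subset hW
      exact ⟨N, hmono _ _ (hN N le_rfl) hCW⟩
  obtain ⟨t⟩ := nonempty_black hd
  refine property_of_beyond hd hempty hmono hunion hnhds (s := t) (D := univ)
    (fun u _ h => hC _ _ h) fun z _ => ?_
  exact (exists_mem_beyond t z).imp_right fun ⟨u, h⟩ => ⟨u, mem_univ u, h⟩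

end Compactness

theorem compactSpace_limit (hd : Θ.WhiteDegreeTwo) : CompactSpace Θ.Limit := by
  refine ⟨isCompact_of_finite_subcover fun {ι} U hU hcov => ?_⟩
  refine property_univ hd (C := fun S => ∃ I : Finset ι, S ⊆ ⋃ i ∈ I, U i)
    ⟨∅, empty_subset _⟩ (fun S S' h ⟨I, hI⟩ => ⟨I, h.trans hI⟩) ?_ fun z => ?_
  · classical
    rintro S S' ⟨I, hI⟩ ⟨I', hI'⟩
    refine ⟨I ∪ I', union_subset (hI.trans ?_) (hI'.trans ?_)⟩
    · exact biUnion_subset_biUnion_left fun i hi => Finset.mem_union_left _ hi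
    · exact biUnion_subset_biUnion_left fun i hi => Finset.mem_union_right _ hi
  · obtain ⟨i, hi⟩ := mem_iUnion.1 (hcov (mem_univ z))
    exact ⟨U i, (hU i).mem_nhds hi, {i}, by simp⟩

/-! ### A basis of neighbourhoods of the limit -/

/-- The points of the subset `A` of a constituent space together with the parts of the limit beyond
the peripherals which `A` contains. -/
def hull (t : Θ.Black) (A : Set (Θ.K t)) : Set Θ.Limit :=
  {z | (∃ x ∈ A, z = point t x) ∨ ∃ u, ∃ h : Θ.Inc t u, range (Θ.φ t u h) ⊆ A ∧
    z ∈ Θ.beyond (Sum.inl t) (Sum.inr u)}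

/-- The white vertices whose peripherals meet `A` without being contained in `A`. -/
def cutVertices (t : Θ.Black) (A : Set (Θ.K t)) : Set Θ.White :=
  {u | ∃ h : Θ.Inc t u, (range (Θ.φ t u h) ∩ A).Nonempty ∧ ¬ range (Θ.φ t u h) ⊆ A}

/-- The points of `A` in peripherals which are not contained in `A`. -/
def cutPoints (t : Θ.Black) (A : Set (Θ.K t)) : Set (Θ.K t) :=
  {x ∈ A | ∃ u, ∃ h : Θ.Inc t u, x ∈ range (Θ.φ t u h) ∧ ¬ range (Θ.φ t u h) ⊆ A}

/-- The points of the hull of `A` other than the cut points different from `x`. -/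
def core (t : Θ.Black) (x : Θ.K t) (A : Set (Θ.K t)) : Set Θ.Limit :=
  hull t A \ point t '' (cutPoints t A \ {x})

/-- Only finitely many peripherals are divided by a clopen set, as they form a null family. -/
theorem finite_cutVertices {t : Θ.Black} {A : Set (Θ.K t)} (hA : IsClopen A) :
    (cutVertices t A).Finite := by
  obtain ⟨δ, hδ, hdisj⟩ := (disjoint_compl_right (a := A)).exists_thickenings
    hA.isClosed.isCompact hA.compl.isClosed
  refine (Θ.null_φ t δ hδ).subset ?_
  rintro u ⟨h, ⟨x, hx, hxA⟩, hsub⟩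
  obtain ⟨y, hy, hyA⟩ := not_subset.1 hsub
  refine ⟨h, le_trans ?_ (Metric.dist_le_diam_of_mem
    (isClosed_range_φ h).isCompact.isBounded hx hy)⟩
  by_contra! hlt
  refine disjoint_left.1 hdisj (Metric.self_subset_thickening hδ A hxA) ?_
  exact Metric.mem_thickening_iff.2 ⟨y, hyA, hlt⟩

theorem finite_range_φ {t : Θ.Black} (hg : IsGraphlike (Θ.peripherals t)) {u : Θ.White}
    (h : Θ.Inc t u) : (range (Θ.φ t u h)).Finite :=
  hg.finite _ (range_φ_mem_peripherals h)

theorem finite_cutPoints {t : Θ.Black} (hg : IsGraphlike (Θ.peripherals t)) {A : Set (Θ.K t)}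
    (hA : IsClopen A) : (cutPoints t A).Finite := by
  refine ((finite_cutVertices hA).biUnion (t := fun u => {x | ∃ h : Θ.Inc t u,
    x ∈ range (Θ.φ t u h)}) ?_).subset ?_
  · rintro u ⟨h, -⟩
    exact (finite_range_φ hg h).subset fun x ⟨_, hx⟩ => hx
  · rintro x ⟨hxA, u, h, hx, hsub⟩
    exact mem_biUnion (show u ∈ cutVertices t A from ⟨h, ⟨x, hx, hxA⟩, hsub⟩) ⟨h, hx⟩

section Hull

variable {t : Θ.Black} {A : Set (Θ.K t)}

theorem point_mem_hull (hd : Θ.WhiteDegreeTwo) {x : Θ.K t} : point t x ∈ hull t A ↔ x ∈ A := by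
  constructor
  · rintro (⟨y, hy, h⟩ | ⟨u, h, hsub, hx⟩)
    · exact point_injective t h ▸ hy
    · exact hsub ((point_mem_beyond_self_iff hd h).1 hx)
  · exact fun hx => Or.inl ⟨x, hx, rfl⟩

theorem exists_of_mem_hull_of_mem_beyond (hd : Θ.WhiteDegreeTwo) {u : Θ.White} (h : Θ.Inc t u)
    (hsub : ¬ range (Θ.φ t u h) ⊆ A) {z : Θ.Limit} (hz : z ∈ hull t A)
    (hzu : z ∈ Θ.beyond (Sum.inl t) (Sum.inr u)) :
    ∃ x ∈ A, x ∈ range (Θ.φ t u h) ∧ z = point t x := by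
  rcases hz with ⟨x, hx, rfl⟩ | ⟨u', h', hsub', hz'⟩
  · exact ⟨x, hx, (point_mem_beyond_self_iff hd h).1 hzu, rfl⟩
  · have hne : u' ≠ u := by
      rintro rfl
      exact hsub hsub'
    exact absurd hzu (disjoint_left.1 (disjoint_beyond hd h' h hne) hz')

/-- The hull is closed as only finitely many peripherals are divided by `A`: the complement is
described by the star of the corresponding white vertices. -/
theorem isClosed_hull (hd : Θ.WhiteDegreeTwo) (hg : ∀ t, IsGraphlike (Θ.peripherals t))
    (hA : IsClopen A) : IsClosed (hull t A) := by
  refine ⟨isOpen_of_star hd (finite_cutVertices hA) (fun u hu => hu.1) ?_ ?_ ?_ ?_⟩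
  · convert hA.compl.isOpen using 1
    ext x
    exact not_congr (point_mem_hull hd)
  · rintro u ⟨h, -, hsub⟩ s hs hne
    refine (isOpen_compl_iff (s := point s ⁻¹' hull t A)).2 ?_
    refine ((finite_range_φ (hg s) hs).subset fun y hy => ?_).isClosed
    obtain ⟨x, -, hx, hxy⟩ := exists_of_mem_hull_of_mem_beyond hd h hsub hy
      (point_mem_beyond_of_mem (inl_mem_treeSide hs hne) y)
    rw [← point_mem_peripheral hs, hxy]
    exact (point_mem_peripheral h).2 hx
  · intro u hu h
    by_cases hsub : range (Θ.φ t u h) ⊆ A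
    · exact Or.inr (disjoint_compl_right_iff_subset.2 fun z hz => Or.inr ⟨u, h, hsub, hz⟩)
    · refine Or.inl fun z hz hzA => hu ⟨h, ?_, hsub⟩
      obtain ⟨x, hxA, hx, -⟩ := exists_of_mem_hull_of_mem_beyond hd h hsub hzA hz
      exact ⟨x, hx, hxA⟩
  · rintro u ⟨h, -, hsub⟩ s hs hne u' hu' h'
    refine Or.inl fun z hz hzA => ?_
    have hzu := beyond_subset_beyond_inr hs h' hu' hz
    rw [beyond_inr_inl hd h hs hne] at hzu
    obtain ⟨x, -, ⟨p, rfl⟩, rfl⟩ := exists_of_mem_hull_of_mem_beyond hd h hsub hzA hzu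
    rw [point_φ_eq h hs p, point_mem_beyond_self_iff hd h'] at hz
    exact disjoint_left.1 (Θ.disjoint_φ s u' u h' hs hu') hz (mem_range_self p)

theorem isPreconnected_hull (hd : Θ.WhiteDegreeTwo) (hg : ∀ t, IsGraphlike (Θ.peripherals t))
    (hA : ∀ f : Θ.K t → Bool, ContinuousOn f A →
      (∀ P ∈ Θ.peripherals t, P ⊆ A → ConstOn f P) → ConstOn f A) :
    IsPreconnected (hull t A) := by
  refine isPreconnected_of_forall_constant fun f hf => ?_
  have hc : ∀ u, ∀ h : Θ.Inc t u, range (Θ.φ t u h) ⊆ A →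
      ConstOn f (Θ.beyond (Sum.inl t) (Sum.inr u)) := fun u h hsub z hz w hw =>
    (isPreconnected_beyond hd hg h).constant (hf.mono fun z hz => Or.inr ⟨u, h, hsub, hz⟩) hz hw
  have hK := hA (f ∘ point t) (hf.comp (continuous_point hd t).continuousOn
    fun x hx => (point_mem_hull hd).2 hx) (by
      rintro _ ⟨u, h, rfl⟩ hsub x hx y hy
      exact hc u h hsub _ ((point_mem_beyond_self_iff hd h).2 hx) _
        ((point_mem_beyond_self_iff hd h).2 hy))
  refine constOn_of_point hd (s := t) (R := Aᶜ) ?_ ?_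
  · rw [compl_compl]
    rintro _ ⟨x, hx, rfl⟩ _ ⟨y, hy, rfl⟩
    exact hK x hx y hy
  · rintro z (⟨x, hx, rfl⟩ | ⟨u, h, hsub, hz⟩)
    · exact Or.inl ⟨x, fun h => h hx, rfl⟩
    · obtain ⟨p⟩ := Θ.nonemptyP u
      exact Or.inr ⟨u, h, hc u h hsub, hz,
        fun h' => h' (mem_range_self p) (hsub (mem_range_self p))⟩

/-- Every neighbourhood of a point of a constituent space contains a connected hull of a small
clopen set. -/
theorem exists_hull_subset (hd : Θ.WhiteDegreeTwo) (hg : ∀ t, IsGraphlike (Θ.peripherals t))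
    {x : Θ.K t} {W : Set Θ.Limit} (hW : W ∈ 𝓝 (point t x)) {V : Set (Θ.K t)} (hV : V ∈ 𝓝 x) :
    ∃ A : Set (Θ.K t), IsClopen A ∧ x ∈ A ∧ A ⊆ V ∧ hull t A ⊆ W ∧ IsPreconnected (hull t A) := by
  obtain ⟨V', hV', E, hE, hVE⟩ := exists_nhds_beyond_subset hd hW
  have hne : ∀ u, ∀ h : Θ.Inc t u, ∃ y ∈ range (Θ.φ t u h), y ≠ x := fun u h =>
    ((hg t).nontrivial _ (range_φ_mem_peripherals h)).exists_ne x
  choose y hy hyx using hne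
  -- the exceptional peripherals are not contained in `A` if one point of each is avoided
  have hfin : {z | ∃ u ∈ E, ∃ h : Θ.Inc t u, z = y u h}.Finite := by
    refine (hE.biUnion (t := fun u => {z | ∃ h : Θ.Inc t u, z = y u h}) fun u _ => ?_).subset ?_
    · refine Set.Subsingleton.finite ?_
      rintro _ ⟨h, rfl⟩ _ ⟨h', rfl⟩
      rfl
    · rintro z ⟨u, hu, h, rfl⟩
      exact mem_biUnion hu ⟨h, rfl⟩
  obtain ⟨A, hA, hxA, hAV, hconst⟩ := (hg t).exists_isClopen x
    (V ∩ (V' ∩ (point t ⁻¹' W ∩ {z | ∃ u ∈ E, ∃ h : Θ.Inc t u, z = y u h}ᶜ)))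
    (Filter.inter_mem hV (Filter.inter_mem hV' (Filter.inter_mem
      ((continuous_point hd t).continuousAt.preimage_mem_nhds hW)
      (hfin.isClosed.isOpen_compl.mem_nhds fun ⟨u, _, h, hx⟩ => hyx u h hx.symm))))
  refine ⟨A, hA, hxA, fun z hz => (hAV hz).1, ?_, isPreconnected_hull hd hg hconst⟩
  rintro z (⟨z, hz, rfl⟩ | ⟨u, h, hsub, hz⟩)
  · exact (hAV hz).2.2.1
  · obtain ⟨p⟩ := Θ.nonemptyP u
    refine hVE u (fun hu => ?_) h ⟨_, mem_range_self p, (hAV (hsub (mem_range_self p))).2.1⟩ hz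
    exact (hAV (hsub (hy u h))).2.2.2 ⟨u, hu, h, rfl⟩

theorem isOpen_preimage_core (hd : Θ.WhiteDegreeTwo) (hg : IsGraphlike (Θ.peripherals t))
    (hA : IsClopen A) (x : Θ.K t) : IsOpen (point t ⁻¹' core t x A) := by
  convert hA.isOpen.sdiff ((finite_cutPoints hg hA).subset
    (sdiff_subset (t := {x}))).isClosed using 1
  ext y
  exact and_congr (point_mem_hull hd) (not_congr (point_injective t).mem_set_image)

theorem beyond_subset_core_or_disjoint (hd : Θ.WhiteDegreeTwo) {x : Θ.K t} {u : Θ.White}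
    (h : Θ.Inc t u) (hx : x ∉ range (Θ.φ t u h)) :
    Θ.beyond (Sum.inl t) (Sum.inr u) ⊆ core t x A ∨
      Disjoint (Θ.beyond (Sum.inl t) (Sum.inr u)) (core t x A) := by
  by_cases hsub : range (Θ.φ t u h) ⊆ A
  · refine Or.inl fun z hz => ⟨Or.inr ⟨u, h, hsub, hz⟩, ?_⟩
    rintro ⟨y, ⟨⟨-, u', h', hy, hsub'⟩, -⟩, rfl⟩
    have hne : u' ≠ u := by
      rintro rfl
      exact hsub' hsub
    exact disjoint_left.1 (Θ.disjoint_φ t u' u h' h hne) hy ((point_mem_beyond_self_iff hd h).1 hz)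
  · refine Or.inr (disjoint_left.2 fun z hz hzc => ?_)
    obtain ⟨y, hyA, hy, rfl⟩ := exists_of_mem_hull_of_mem_beyond hd h hsub hzc.1 hz
    exact hzc.2 (mem_image_of_mem _ ⟨⟨hyA, u, h, hy, hsub⟩, fun hyx => hx (hyx ▸ hy)⟩)

/-- The peripheral through `x` meets the core only in `x`, if it is not contained in `A`. -/
theorem eq_point_of_mem_core (hd : Θ.WhiteDegreeTwo) {x : Θ.K t} {u : Θ.White} (h : Θ.Inc t u)
    (hsub : ¬ range (Θ.φ t u h) ⊆ A) {z : Θ.Limit} (hz : z ∈ core t x A)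
    (hzu : z ∈ Θ.beyond (Sum.inl t) (Sum.inr u)) : z = point t x := by
  obtain ⟨y, hyA, hy, rfl⟩ := exists_of_mem_hull_of_mem_beyond hd h hsub hz.1 hzu
  by_contra hne
  exact hz.2 (mem_image_of_mem _ ⟨⟨hyA, u, h, hy, hsub⟩, fun hyx => hne (congrArg _ hyx)⟩)

theorem point_mem_core (hd : Θ.WhiteDegreeTwo) {x : Θ.K t} (hx : x ∈ A) :
    point t x ∈ core t x A := by
  refine ⟨(point_mem_hull hd).2 hx, ?_⟩
  rintro ⟨y, hy, hyx⟩
  exact hy.2 (point_injective t hyx)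

theorem finite_hull_diff_core (hg : IsGraphlike (Θ.peripherals t)) (hA : IsClopen A) (x : Θ.K t) :
    (hull t A \ core t x A).Finite := by
  refine (((finite_cutPoints hg hA).subset (sdiff_subset (t := {x}))).image (point t)).subset ?_
  rw [core, sdiff_sdiff_right_self]
  exact inter_subset_right

end Hull

/-- The union of open subsets of two parts into which a white vertex divides the limit is open, if
they meet the peripheral between these parts in the same point. -/
theorem isOpen_union_of_white (hd : Θ.WhiteDegreeTwo) {t s : Θ.Black} {u : Θ.White}
    (ht : Θ.Inc t u) (hs : Θ.Inc s u) (hne : s ≠ t) {G G' : Set Θ.Limit} {z : Θ.Limit}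
    (hzG : z ∈ G) (hzG' : z ∈ G') (hz : z ∈ Θ.peripheral u)
    (hG : ∀ w ∈ G, w ∈ Θ.beyond (Sum.inl t) (Sum.inr u) → w = z)
    (hG' : ∀ w ∈ G', w ∈ Θ.beyond (Sum.inl s) (Sum.inr u) → w = z)
    (hK : IsOpen (point t ⁻¹' G)) (hK' : IsOpen (point s ⁻¹' G'))
    (hu : ∀ u' ≠ u, Θ.Inc t u' → Θ.beyond (Sum.inl t) (Sum.inr u') ⊆ G ∨
      Disjoint (Θ.beyond (Sum.inl t) (Sum.inr u')) G)
    (hu' : ∀ u' ≠ u, Θ.Inc s u' → Θ.beyond (Sum.inl s) (Sum.inr u') ⊆ G' ∨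
      Disjoint (Θ.beyond (Sum.inl s) (Sum.inr u')) G') : IsOpen (G ∪ G') := by
  have hpre : ∀ t s : Θ.Black, Θ.Inc t u → Θ.Inc s u → s ≠ t → ∀ G G' : Set Θ.Limit, z ∈ G →
      (∀ w ∈ G', w ∈ Θ.beyond (Sum.inl s) (Sum.inr u) → w = z) → IsOpen (point t ⁻¹' G) →
      IsOpen (point t ⁻¹' (G ∪ G')) := by
    intro t s ht hs hne G G' hzG hG' hK
    convert hK using 1
    refine Subset.antisymm (fun x hx => hx.elim id fun hx => ?_) fun x hx => Or.inl hx
    change point t x ∈ G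
    rwa [hG' _ hx (point_mem_beyond_of_mem (inl_mem_treeSide ht hne.symm) x)]
  have hside : ∀ t s : Θ.Black, Θ.Inc t u → Θ.Inc s u → s ≠ t → ∀ G G' : Set Θ.Limit,
      (∀ w ∈ G', w ∈ Θ.beyond (Sum.inl s) (Sum.inr u) → w = z) → ∀ u' ≠ u, Θ.Inc t u' →
      (Θ.beyond (Sum.inl t) (Sum.inr u') ⊆ G ∨
        Disjoint (Θ.beyond (Sum.inl t) (Sum.inr u')) G) →
      (Θ.beyond (Sum.inl t) (Sum.inr u') ⊆ G ∪ G' ∨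
        Disjoint (Θ.beyond (Sum.inl t) (Sum.inr u')) (G ∪ G')) := by
    intro t s ht hs hne G G' hG' u' hu' h' hor
    refine hor.imp (fun h => h.trans subset_union_left) fun h => disjoint_union_right.2 ⟨h, ?_⟩
    refine disjoint_left.2 fun w hw hwG' => ?_
    have hwu := beyond_subset_beyond_inr ht h' hu' hw
    rw [beyond_inr_inl hd hs ht hne.symm] at hwu
    obtain rfl := hG' w hwG' hwu
    exact disjoint_left.1 (disjoint_beyond hd h' ht hu') hw (peripheral_subset_beyond hd ht hz)
  obtain ⟨s', hs', -, hother⟩ := hd.exists_other ht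
  have heq : ∀ r, Θ.Inc r u → r ≠ t → r = s := by
    intro r hr hrt
    rw [(hother r hr).resolve_left hrt, (hother s hs).resolve_left hne]
  refine isOpen_of_star hd (t := t) (D := {u}) (finite_singleton u) ?_ ?_ ?_ ?_ ?_
  · rintro _ rfl
    exact ht
  · exact hpre t s ht hs hne G G' hzG hG' hK
  · rintro _ rfl r hr hrt
    obtain rfl := heq r hr hrt
    rw [union_comm]
    exact hpre r t hs ht hne.symm G' G hzG' hG hK'
  · exact fun u' hu'u h' => hside t s ht hs hne G G' hG' u' hu'u h' (hu u' hu'u h')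
  · rintro _ rfl r hr hrt u' hu'u h'
    obtain rfl := heq r hr hrt
    rw [union_comm]
    exact hside r t hs ht hne.symm G' G hG u' hu'u h' (hu' u' hu'u h')

/-- The limit has a basis of neighbourhoods of finite boundary: hulls of clopen subsets of
constituent spaces, unions of two such hulls at points of peripherals, and the parts of the limit
beyond edges at the ends. -/
theorem hasFiniteBoundaryBasis_limit (hd : Θ.WhiteDegreeTwo)
    (hg : ∀ t, IsGraphlike (Θ.peripherals t)) : HasFiniteBoundaryBasis Θ.Limit := by
  intro z W hW
  rcases eq_point_or_endPoint z with ⟨t, x, rfl⟩ | ⟨ξ, rfl⟩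
  · by_cases hper : ∃ u, ∃ h : Θ.Inc t u, x ∈ range (Θ.φ t u h)
    · -- hulls on both sides of the peripheral are combined
      obtain ⟨u, h, p, rfl⟩ := hper
      obtain ⟨s, hs, hne, -⟩ := hd.exists_other h
      have hz := point_φ_eq h hs p
      have key : ∀ r, ∀ h : Θ.Inc r u, W ∈ 𝓝 (point r (Θ.φ r u h p)) →
          ∃ A : Set (Θ.K r), IsClopen A ∧ Θ.φ r u h p ∈ A ∧ hull r A ⊆ W ∧
            IsPreconnected (hull r A) ∧ ¬ range (Θ.φ r u h) ⊆ A := by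
        intro r h hW
        obtain ⟨y, hy, hyx⟩ :=
          ((hg r).nontrivial _ (range_φ_mem_peripherals h)).exists_ne (Θ.φ r u h p)
        obtain ⟨A, hA, hxA, hAV, hAW, hc⟩ := exists_hull_subset hd hg hW
          (isOpen_compl_singleton.mem_nhds hyx.symm)
        exact ⟨A, hA, hxA, hAW, hc, fun hsub => hAV (hsub hy) rfl⟩
      obtain ⟨A, hA, hxA, hAW, hc, hsub⟩ := key t h hW
      obtain ⟨A', hA', hxA', hAW', hc', hsub'⟩ := key s hs (hz ▸ hW)
      have hnot : ∀ r, ∀ h : Θ.Inc r u, ∀ u' ≠ u, ∀ h' : Θ.Inc r u',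
          Θ.φ r u h p ∉ range (Θ.φ r u' h') := fun r h u' hne h' hmem =>
        disjoint_left.1 (Θ.disjoint_φ r u' u h' h hne) hmem (mem_range_self p)
      refine ⟨core t (Θ.φ t u h p) A ∪ core s (Θ.φ s u hs p) A', hull t A ∪ hull s A', ?_,
        (isClosed_hull hd hg hA).union (isClosed_hull hd hg hA'), Or.inl (point_mem_core hd hxA),
        union_subset_union sdiff_subset sdiff_subset, union_subset hAW hAW', ?_, ?_⟩
      · refine isOpen_union_of_white hd h hs hne (z := point t (Θ.φ t u h p))
          (point_mem_core hd hxA) (hz ▸ point_mem_core hd hxA')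
          ((point_mem_peripheral h).2 (mem_range_self p))
          (fun w hw hwu => eq_point_of_mem_core hd h hsub hw hwu)
          (fun w hw hwu => hz ▸ eq_point_of_mem_core hd hs hsub' hw hwu)
          (isOpen_preimage_core hd (hg t) hA _) (isOpen_preimage_core hd (hg s) hA' _) ?_ ?_
        · exact fun u' hu' h' => beyond_subset_core_or_disjoint hd h' (hnot t h u' hu' h')
        · exact fun u' hu' h' => beyond_subset_core_or_disjoint hd h' (hnot s hs u' hu' h')
      · refine ((finite_hull_diff_core (hg t) hA (Θ.φ t u h p)).union
          (finite_hull_diff_core (hg s) hA' (Θ.φ s u hs p))).subset ?_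
        rintro w ⟨hw | hw, hwc⟩
        · exact Or.inl ⟨hw, fun h => hwc (Or.inl h)⟩
        · exact Or.inr ⟨hw, fun h => hwc (Or.inr h)⟩
      · exact IsPreconnected.union _ ((point_mem_hull hd).2 hxA)
          (hz ▸ (point_mem_hull hd).2 hxA') hc hc'
    · push Not at hper
      obtain ⟨A, hA, hxA, -, hAW, hc⟩ := exists_hull_subset hd hg hW Filter.univ_mem
      exact ⟨core t x A, hull t A, isOpen_of_black hd (isOpen_preimage_core hd (hg t) hA x)
        fun u h => beyond_subset_core_or_disjoint hd h (hper u h), isClosed_hull hd hg hA,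
        point_mem_core hd hxA, sdiff_subset, hAW, finite_hull_diff_core (hg t) hA x, hc⟩
  · obtain ⟨ρ, rfl⟩ := ξ.exists_ray
    obtain ⟨n, hn⟩ := exists_beyond_subset hW
    have hab := ρ.adj n
    have hmem : endPoint ρ.toEnd ∈ (Θ.beyond (ρ.toFun (n + 1)) (ρ.toFun n))ᶜ :=
      endPoint_notMem_beyond hab (ρ.toEnd_isIn_side Θ.isTree n)
    refine ⟨(Θ.beyond (ρ.toFun (n + 1)) (ρ.toFun n))ᶜ, Θ.beyond (ρ.toFun n) (ρ.toFun (n + 1)),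
      (isClosed_beyond hd hab.symm).isOpen_compl, isClosed_beyond hd hab, hmem,
      fun w hw => (beyond_union_beyond _ _ hab w).resolve_right hw, hn n le_rfl, ?_,
      isPreconnected_beyond hd hg hab⟩
    rw [Set.sdiff_compl]
    have hfin : ∀ t u, Θ.Inc t u → (Θ.peripheral u).Finite := fun t u h => by
      rw [peripheral_eq h]
      exact (finite_range_φ (hg t) h).image _
    revert hab
    generalize ρ.toFun n = a, ρ.toFun (n + 1) = b
    intro hab
    rcases a with t | u <;> rcases b with s | u'
    · exact absurd hab (Θ.not_adj_black t s)
    · rw [inter_comm]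
      exact (hfin t u' hab).subset (beyond_inter_beyond hd hab)
    · exact (hfin s u hab.symm).subset (beyond_inter_beyond hd hab.symm)
    · exact absurd hab (Θ.not_adj_white u u')

/-! ### Separation -/

theorem isClosed_singleton_point (hd : Θ.WhiteDegreeTwo) (t : Θ.Black) (x : Θ.K t) :
    IsClosed {point t x} := by
  have hpre : ∀ s, IsOpen (point s ⁻¹' ({point t x}ᶜ : Set Θ.Limit)) := fun s => by
    refine (isOpen_compl_iff (s := point s ⁻¹' {point t x})).2 ?_
    exact ((subsingleton_singleton.preimage (point_injective s)).finite).isClosed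
  have hnot : ∀ s, ∀ y : Θ.K s, point s y = point t x → ∀ u, ∀ h : Θ.Inc s u,
      y ∉ range (Θ.φ s u h) → Θ.beyond (Sum.inl s) (Sum.inr u) ⊆ {point t x}ᶜ := by
    rintro s y hy u h hyu z hz rfl
    rw [← hy, point_mem_beyond_self_iff hd h] at hz
    exact hyu hz
  refine ⟨?_⟩
  by_cases hper : ∃ u, ∃ h : Θ.Inc t u, x ∈ range (Θ.φ t u h)
  · obtain ⟨u, h, p, rfl⟩ := hper
    have hdisj : ∀ s, ∀ hs : Θ.Inc s u, ∀ u' ≠ u, Θ.Inc s u' →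
        Θ.beyond (Sum.inl s) (Sum.inr u') ⊆ {point t (Θ.φ t u h p)}ᶜ := fun s hs u' hne h' =>
      hnot s (Θ.φ s u hs p) (point_φ_eq hs h p) u' h' fun hmem =>
        disjoint_left.1 (Θ.disjoint_φ s u' u h' hs hne) hmem (mem_range_self p)
    refine isOpen_of_star hd (t := t) (D := {u}) (finite_singleton u) ?_ (hpre t)
      (fun _ _ s _ _ => hpre s) (fun u' hu' h' => Or.inl (hdisj t h u' hu' h')) ?_
    · rintro _ rfl
      exact h
    · rintro _ rfl s hs - u' hu' h'
      exact Or.inl (hdisj s hs u' hu' h')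
  · push Not at hper
    exact isOpen_of_black hd (hpre t) fun u h => Or.inl (hnot t x rfl u h (hper u h))

/-- Points of constituent spaces are closed, and different ends are separated by the closed part of
the limit beyond some edge. -/
theorem t0Space_limit (hd : Θ.WhiteDegreeTwo) : T0Space Θ.Limit := by
  refine ⟨fun z w h => ?_⟩
  rcases eq_point_or_endPoint z with ⟨t, x, rfl⟩ | ⟨ξ, rfl⟩
  · exact ((h.mem_closed_iff (isClosed_singleton_point hd t x)).1 rfl).symm
  rcases eq_point_or_endPoint w with ⟨t, x, rfl⟩ | ⟨ξ', rfl⟩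
  · exact (h.mem_closed_iff (isClosed_singleton_point hd t x)).2 rfl
  · obtain ⟨ρ, rfl⟩ := ξ.exists_ray
    refine congrArg endPoint (TreeRay.toEnd_eq_of_isIn_side Θ.isTree fun n => ?_).symm
    exact endPoint_mem_beyond.1 ((h.mem_closed_iff (isClosed_beyond hd (ρ.adj n))).1
      (endPoint_mem_beyond.2 (ρ.toEnd_isIn_side Θ.isTree n)))

theorem nontrivial_limit (hd : Θ.WhiteDegreeTwo) (hg : ∀ t, IsGraphlike (Θ.peripherals t)) :
    Nontrivial Θ.Limit := by
  obtain ⟨t⟩ := nonempty_black hd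
  obtain ⟨P, hP⟩ := (hg t).nonempty
  obtain ⟨x, -, y, -, hne⟩ := (hg t).nontrivial P hP
  exact ⟨point t x, point t y, (point_injective t).ne hne⟩

end TreeSystem

/-! ### Trees of 2-connected graphs -/

theorem IsCutpoint.of_homeomorph {X Y : Type*} [TopologicalSpace X] [TopologicalSpace Y]
    (e : X ≃ₜ Y) {x : X} (h : IsCutpoint x) : IsCutpoint (e x) := by
  refine fun hc => h ?_
  have : ({x}ᶜ : Set X) = e ⁻¹' {e x}ᶜ := by
    ext y
    exact not_congr e.injective.eq_iff.symm
  rw [this]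
  exact e.isPreconnected_preimage.2 hc

/-- A tree of 2-connected graphs, that is, a space homeomorphic to the limit of a tree system of
punctured 2-connected graphs, is connected, locally connected, has no cutpoint, and has topological
dimension 1 (in the sense of the covering dimension and of the small inductive dimension). -/
theorem mainTheorem5 (Θ : TreeSystem.{u₁, u₂, u₃, u₄})
    (hΘ : Θ.IsOfPuncturedTwoConnectedGraphs)
    (Z : Type u₅) [TopologicalSpace Z] (e : Z ≃ₜ Θ.Limit) :
    ConnectedSpace Z ∧ LocallyConnectedSpace Z ∧ (∀ p : Z, ¬ IsCutpoint p) ∧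
      HasCoveringDim Z 1 ∧ smallInductiveDimension Z = 1 := by
  have hd : Θ.WhiteDegreeTwo := hΘ.1
  have hg : ∀ t, IsGraphlike (Θ.peripherals t) := fun t => by
    obtain ⟨Γ, hΓ, h2, h⟩ := hΘ.2 t
    exact h.isGraphlike hΓ h2
  have hlim := TreeSystem.connectedSpace_limit hd hg
  have hbasis : HasFiniteBoundaryBasis Z :=
    .of_homeomorph e (TreeSystem.hasFiniteBoundaryBasis_limit hd hg)
  have := TreeSystem.compactSpace_limit hd
  have := TreeSystem.t0Space_limit hd
  have := TreeSystem.nontrivial_limit hd hg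
  have : ConnectedSpace Z := e.symm.surjective.connectedSpace e.symm.continuous
  have : CompactSpace Z := e.symm.compactSpace
  have : T0Space Z := e.isEmbedding.t0Space
  have : Nontrivial Z := e.toEquiv.nontrivial
  have : RegularSpace Z := hbasis.regularSpace
  have : T3Space Z := {}
  exact ⟨inferInstance, hbasis.locallyConnectedSpace,
    fun p hp => TreeSystem.not_isCutpoint hd hg _ (hp.of_homeomorph e),
    hbasis.hasCoveringDim_one, hbasis.smallInductiveDimension_eq_one⟩
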